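/- Let $K$ be a field of characteristic $0$, let $\lambda\vdash n$ and $\mu\vdash m$ be partitions ($n,m\ge 0$), and let $S_\lambda=K\mathfrak S_n c_\lambda$ denote the Specht module ($c_\lambda$ the Young symmetrizer of the canonical tableau). A $K$-linear PROP is a $K$-linear strict symmetric monoidal category whose objects are the natural numbers with $\otimes=+$; its homs $\mathcal C(n,m)$ are $(K\mathfrak S_m,K\mathfrak S_n)$-bimodules. A (left) module over it is a $K$-linear functor to $K$-vector spaces; modules form an abelian category. Let $\mathrm{catLie}$ be the $K$-linear PROP freely generated by a Lie algebra, i.e. by $[\,,]:2\to1$ with the antisymmetry and Jacobi relations, and let $\mathrm{catLie}_C$ be the $K$-linear PROP freely generated by a Casimir Lie algebra, i.e. by $[\,,]$ as before and $c:0\to2$ with the relations $$P_{1,1}\,c=c,\qquad ([\,,]\otimes \mathrm{id}_1)(\mathrm{id}_1\otimes c)=(\mathrm{id}_1\otimes[\,,])(c\otimes \mathrm{id}_1),$$ where $P_{1,1}:2\to 2$ is the symmetry. Let $T$ be the functor from $\mathrm{catLie}$-modules to $\mathrm{catLie}_C$-modules induced by the projection $\mathrm{catLie}_C\to\mathrm{catLie}$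 which preserves $[\,,]$ and sends $c$ to $0$. Regard $S_\lambda$ as the $\mathrm{catLie}$-module which is $S_\lambda$ in degree $n$ and $0$ in all other degrees. Let $\mathrm{ub}(n,m)$ be the space of morphisms $n\to m$ of the upward Brauer category: the $K$-vector space spanned by the partitionings of $\{1^+,\dots,n^+\}\sqcup\{1^-,\dots,m^-\}$ into unordered pairs none of which consists of two positive elements, with $\mathfrak S_m$ and $\mathfrak S_n$ acting by composition with permutations (relabelling). In the tensor products below $S_\mu$ is considered as a right $K\mathfrak S_m$-module by $v\sigma=\sigma^{-1}v$. Finally, let $LR^{\alpha}_{\beta,\gamma}$ be the Littlewood–Richardson coefficient, i.e. the multiplicity of $S_\alpha$ in $\mathrm{Ind}_{\mathfrak S_{|\beta|}\times\mathfrak S_{|\gamma|}}^{\mathfrak S_{|\alpha|}}(S_\beta\boxtimes S_\gamma)$ (zero if $|\alpha|\ne|\beta|+|\gamma|$). Then there is an isomorphism of $K$-vector spaces $$\mathrm{Ext}^1_{\mathrm{catLie}_C\text{-}\mathrm{Mod}}(T(S_\lambda),T(S_\mu))\cong\begin{cases}S_\mu\otimes_{K\mathfrak S_m}\mathrm{catLie}(n,m)\otimes_{K\mathfrak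 S_n}S_\lambda & \text{if } m=n-1,\\ S_\mu\otimes_{K\mathfrak S_m}\mathrm{ub}(n,m)\otimes_{K\mathfrak S_n}S_\lambda & \text{if } m=n+2,\\ 0&\text{otherwise.}\end{cases}$$ Moreover this Ext-group is finite-dimensional, and $$\dim_K\mathrm{Ext}^1_{\mathrm{catLie}_C\text{-}\mathrm{Mod}}(T(S_\lambda),T(S_\mu))=\begin{cases}\sum_{\rho\vdash n-2}LR^{\lambda}_{\rho,1^2}\,LR^{\mu}_{\rho,1}&\text{if } m=n-1,\\ LR^{\mu}_{\lambda,2}&\text{if } m=n+2,\\ 0&\text{otherwise.}\end{cases}$$ (The sum is empty, hence $0$, if $n=1$.) -/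

import Mathlib

open CategoryTheory

set_option linter.unusedSimpArgs false

universe u

noncomputable section

namespace ExtCasimir

/-! ## Linear PROPs -/

/-- The juxtaposition of two permutations. -/
def juxt {m n m' n' : ℕ} (e : Fin m ≃ Fin n) (e' : Fin m' ≃ Fin n') :
    Fin (m + m') ≃ Fin (n + n') :=
  finSumFinEquiv.symm.trans ((Equiv.sumCongr e e').trans finSumFinEquiv)

/-- A `K`-linear PROP: a `K`-linear strict symmetric monoidal category whose objects are the
natural numbers, with tensor product `+` on objects.  The composition `comp f g` is written in
diagrammatic order (first `f`, then `g`).  The symmetry is recorded by all the permutations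
`perm e`; `Fin m ≃ Fin n` is empty unless `m = n`, so that `perm (finCongr h)` is the identity
transported along `h : m = n`, by means of which strict associativity and unitality are expressed.
The permutation `finAddFlip` is the block transposition. -/
structure LinearPROP (K : Type u) [Field K] where
  Hom : ℕ → ℕ → Type u
  [addCommGroup : ∀ m n, AddCommGroup (Hom m n)]
  [module : ∀ m n, Module K (Hom m n)]
  perm : ∀ {m n : ℕ}, (Fin m ≃ Fin n) → Hom m n
  comp : ∀ {m n p : ℕ}, Hom m n →ₗ[K] Hom n p →ₗ[K] Hom m p
  tensor : ∀ {m n m' n' : ℕ}, Hom m n →ₗ[K] Hom m' n' →ₗ[K] Hom (m + m') (n + n')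
  id_comp : ∀ {m n : ℕ} (f : Hom m n), comp (perm (Equiv.refl (Fin m))) f = f
  comp_id : ∀ {m n : ℕ} (f : Hom m n), comp f (perm (Equiv.refl (Fin n))) = f
  assoc : ∀ {m n p q : ℕ} (f : Hom m n) (g : Hom n p) (h : Hom p q),
    comp (comp f g) h = comp f (comp g h)
  perm_comp : ∀ {m n p : ℕ} (e : Fin m ≃ Fin n) (e' : Fin n ≃ Fin p),
    comp (perm e) (perm e') = perm (e.trans e')
  perm_tensor : ∀ {m n m' n' : ℕ} (e : Fin m ≃ Fin n) (e' : Fin m' ≃ Fin n'),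
    tensor (perm e) (perm e') = perm (juxt e e')
  interchange : ∀ {m n p m' n' p' : ℕ} (f : Hom m n) (g : Hom n p) (f' : Hom m' n')
    (g' : Hom n' p'), tensor (comp f g) (comp f' g') = comp (tensor f f') (tensor g g')
  tensor_assoc : ∀ {m n m' n' m'' n'' : ℕ} (f : Hom m n) (g : Hom m' n') (h : Hom m'' n''),
    comp (tensor (tensor f g) h) (perm (finCongr (add_assoc n n' n''))) =
      comp (perm (finCongr (add_assoc m m' m''))) (tensor f (tensor g h))
  unit_tensor : ∀ {m n : ℕ} (f : Hom m n),
    comp (tensor (perm (Equiv.refl (Fin 0))) f) (perm (finCongr (zero_add n))) =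
      comp (perm (finCongr (zero_add m))) f
  tensor_unit : ∀ {m n : ℕ} (f : Hom m n),
    comp (tensor f (perm (Equiv.refl (Fin 0)))) (perm (finCongr (add_zero n))) =
      comp (perm (finCongr (add_zero m))) f
  symmetry : ∀ {m n m' n' : ℕ} (f : Hom m n) (g : Hom m' n'),
    comp (tensor f g) (perm finAddFlip) = comp (perm finAddFlip) (tensor g f)

attribute [instance] LinearPROP.addCommGroup LinearPROP.module

variable {K : Type u} [Field K]

/-- A morphism of `K`-linear PROPs. -/
structure PROPHom (P Q : LinearPROP K) where
  map : ∀ {m n : ℕ}, P.Hom m n →ₗ[K] Q.Hom m n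
  map_perm : ∀ {m n : ℕ} (e : Fin m ≃ Fin n), map (P.perm e) = Q.perm e
  map_comp : ∀ {m n p : ℕ} (f : P.Hom m n) (g : P.Hom n p),
    map (P.comp f g) = Q.comp (map f) (map g)
  map_tensor : ∀ {m n m' n' : ℕ} (f : P.Hom m n) (g : P.Hom m' n'),
    map (P.tensor f g) = Q.tensor (map f) (map g)

/-- The objects of a PROP, as a type carrying the category structure. -/
structure LinearPROP.Obj (P : LinearPROP K) : Type where
  deg : ℕ

instance (P : LinearPROP K) : Category.{u} P.Obj where
  Hom X Y := P.Hom X.deg Y.deg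
  id X := P.perm (Equiv.refl (Fin X.deg))
  comp f g := P.comp f g
  id_comp f := P.id_comp f
  comp_id f := P.comp_id f
  assoc f g h := P.assoc f g h

instance (P : LinearPROP K) : Preadditive P.Obj where
  homGroup X Y := P.addCommGroup X.deg Y.deg
  add_comp _ _ _ f f' g := LinearMap.map_add₂ P.comp f f' g
  comp_add _ _ _ f g g' := (P.comp f).map_add g g'

instance (P : LinearPROP K) : Linear K P.Obj where
  homModule X Y := P.module X.deg Y.deg
  smul_comp _ _ _ r f g := LinearMap.map_smul₂ P.comp r f g
  comp_smul _ _ _ f r g := (P.comp f).map_smul r g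

/-- The functor underlying a morphism of PROPs. -/
def PROPHom.functor {P Q : LinearPROP K} (φ : PROPHom P Q) : P.Obj ⥤ Q.Obj where
  obj X := ⟨X.deg⟩
  map f := φ.map f
  map_id X := φ.map_perm (Equiv.refl (Fin X.deg))
  map_comp f g := φ.map_comp f g

instance {P Q : LinearPROP K} (φ : PROPHom P Q) : φ.functor.Additive where
  map_add {_ _ f g} := φ.map.map_add f g

instance {P Q : LinearPROP K} (φ : PROPHom P Q) : φ.functor.Linear K where
  map_smul f r := φ.map.map_smul r f

/-! ## Modules over a linear PROP -/

/-- The property of being a `K`-linear functor to `K`-vector spaces. -/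
def isLinear (P : LinearPROP K) : ObjectProperty (P.Obj ⥤ ModuleCat.{u} K) :=
  fun F => F.Additive ∧ F.Linear K

/-- The category of (left) modules over a `K`-linear PROP `P`, i.e. `K`-linear functors from `P`
to `K`-vector spaces, with natural transformations as morphisms. -/
abbrev LinearPROP.Mod (P : LinearPROP K) : Type (u + 1) := (isLinear P).FullSubcategory

instance (P : LinearPROP K) : (isLinear P).IsClosedUnderSubobjects where
  prop_of_mono {F G} i _ h := by
    obtain ⟨h1, h2⟩ := h
    refine ⟨⟨fun {X Y f g} => ?_⟩, ⟨fun {X Y} f r => ?_⟩⟩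
    · rw [← cancel_mono (i.app Y)]
      simp [Functor.map_add]
    · rw [← cancel_mono (i.app Y)]
      simp [Functor.map_smul]

instance (P : LinearPROP K) : (isLinear P).IsClosedUnderQuotients where
  prop_of_epi {F G} p _ h := by
    obtain ⟨h1, h2⟩ := h
    refine ⟨⟨fun {X Y f g} => ?_⟩, ⟨fun {X Y} f r => ?_⟩⟩
    · rw [← cancel_epi (p.app X)]
      simp only [← NatTrans.naturality, Preadditive.comp_add, Functor.map_add,
        Preadditive.add_comp]
    · rw [← cancel_epi (p.app X)]
      simp only [← NatTrans.naturality, Linear.comp_smul, Functor.map_smul, Linear.smul_comp]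

instance (P : LinearPROP K) : (isLinear P).ContainsZero where
  exists_zero := by
    refine ⟨_, Limits.isZero_zero _, ⟨⟨fun {X Y f g} => ?_⟩, ⟨fun {X Y} f r => ?_⟩⟩⟩
    · exact (((Functor.isZero_iff _).1 (Limits.isZero_zero _)) X).eq_of_src _ _
    · exact (((Functor.isZero_iff _).1 (Limits.isZero_zero _)) X).eq_of_src _ _

instance (P : LinearPROP K) : (isLinear P).IsClosedUnderFiniteProducts where
  isClosedUnderLimitsOfShape J _ := by
    refine ⟨?_⟩
    rintro F ⟨h⟩
    have hl := fun Y => Limits.isLimitOfPreserves ((evaluation P.Obj (ModuleCat.{u} K)).obj Y)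
      h.isLimit
    refine ⟨⟨fun {X Y f g} => (hl Y).hom_ext fun j => ?_⟩,
      ⟨fun {X Y} f r => (hl Y).hom_ext fun j => ?_⟩⟩
    · have h1 := (h.prop_diag_obj j).1
      change F.map (f + g) ≫ (h.π.app j).app Y = (F.map f + F.map g) ≫ (h.π.app j).app Y
      simp only [NatTrans.naturality, Preadditive.add_comp]
      simp [Functor.map_add]
    · have h1 := (h.prop_diag_obj j).1
      have h2 := (h.prop_diag_obj j).2
      change F.map (r • f) ≫ (h.π.app j).app Y = (r • F.map f) ≫ (h.π.app j).app Y
      simp only [NatTrans.naturality, Linear.smul_comp]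
      simp [Functor.map_smul]

instance (P : LinearPROP K) : HasExt.{u + 1} P.Mod := HasExt.standard _

/-- Restriction of modules along a morphism of PROPs. -/
def PROPHom.restrict {P Q : LinearPROP K} (φ : PROPHom P Q) : Q.Mod ⥤ P.Mod :=
  (isLinear P).lift ((isLinear Q).ι ⋙ (Functor.whiskeringLeft _ _ _).obj φ.functor)
    (fun M => by
      obtain ⟨h1, h2⟩ := M.property
      exact ⟨(inferInstance : (φ.functor ⋙ M.obj).Additive),
        (inferInstance : (φ.functor ⋙ M.obj).Linear K)⟩)

/-! ## Linear PROPs presented by generators and relations -/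

/-- Formal expressions in the operations of a `K`-linear PROP, built from the generators `G`. -/
inductive Term (K : Type u) (G : ℕ → ℕ → Type) : ℕ → ℕ → Type u
  | gen {m n : ℕ} : G m n → Term K G m n
  | perm {m n : ℕ} : (Fin m ≃ Fin n) → Term K G m n
  | comp {m n p : ℕ} : Term K G m n → Term K G n p → Term K G m p
  | tensor {m n m' n' : ℕ} : Term K G m n → Term K G m' n' → Term K G (m + m') (n + n')
  | zero {m n : ℕ} : Term K G m n
  | add {m n : ℕ} : Term K G m n → Term K G m n → Term K G m n
  | smul {m n : ℕ} : K → Term K G m n → Term K G m n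

/-- The identity of the object `n`. -/
def Term.id {G : ℕ → ℕ → Type} (n : ℕ) : Term K G n n := .perm (Equiv.refl (Fin n))

/-- The congruence on formal expressions generated by the relations `R` and the axioms of a
`K`-linear PROP. -/
inductive Cong {G : ℕ → ℕ → Type} (R : ∀ m n : ℕ, Term K G m n → Term K G m n → Prop) :
    ∀ {m n : ℕ}, Term K G m n → Term K G m n → Prop
  | rel {m n : ℕ} {f g : Term K G m n} : R m n f g → Cong R f g
  | refl {m n : ℕ} (f : Term K G m n) : Cong R f f
  | symm {m n : ℕ} {f g : Term K G m n} : Cong R f g → Cong R g f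
  | trans {m n : ℕ} {f g h : Term K G m n} : Cong R f g → Cong R g h → Cong R f h
  | comp_congr {m n p : ℕ} {f f' : Term K G m n} {g g' : Term K G n p} :
      Cong R f f' → Cong R g g' → Cong R (f.comp g) (f'.comp g')
  | tensor_congr {m n m' n' : ℕ} {f f' : Term K G m n} {g g' : Term K G m' n'} :
      Cong R f f' → Cong R g g' → Cong R (f.tensor g) (f'.tensor g')
  | add_congr {m n : ℕ} {f f' g g' : Term K G m n} :
      Cong R f f' → Cong R g g' → Cong R (f.add g) (f'.add g')
  | smul_congr {m n : ℕ} (a : K) {f f' : Term K G m n} :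
      Cong R f f' → Cong R (.smul a f) (.smul a f')
  | add_assoc {m n : ℕ} (f g h : Term K G m n) :
      Cong R ((f.add g).add h) (f.add (g.add h))
  | add_comm {m n : ℕ} (f g : Term K G m n) : Cong R (f.add g) (g.add f)
  | zero_add {m n : ℕ} (f : Term K G m n) : Cong R (Term.zero.add f) f
  | neg_add {m n : ℕ} (f : Term K G m n) : Cong R ((Term.smul (-1) f).add f) .zero
  | one_smul {m n : ℕ} (f : Term K G m n) : Cong R (.smul 1 f) f
  | mul_smul {m n : ℕ} (a b : K) (f : Term K G m n) :
      Cong R (.smul (a * b) f) (.smul a (.smul b f))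
  | smul_add {m n : ℕ} (a : K) (f g : Term K G m n) :
      Cong R (.smul a (f.add g)) ((Term.smul a f).add (.smul a g))
  | add_smul {m n : ℕ} (a b : K) (f : Term K G m n) :
      Cong R (.smul (a + b) f) ((Term.smul a f).add (.smul b f))
  | comp_add {m n p : ℕ} (f : Term K G m n) (g g' : Term K G n p) :
      Cong R (f.comp (g.add g')) ((f.comp g).add (f.comp g'))
  | add_comp {m n p : ℕ} (f f' : Term K G m n) (g : Term K G n p) :
      Cong R ((f.add f').comp g) ((f.comp g).add (f'.comp g))
  | comp_smul {m n p : ℕ} (a : K) (f : Term K G m n) (g : Term K G n p) :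
      Cong R (f.comp (.smul a g)) (.smul a (f.comp g))
  | smul_comp {m n p : ℕ} (a : K) (f : Term K G m n) (g : Term K G n p) :
      Cong R ((Term.smul a f).comp g) (.smul a (f.comp g))
  | tensor_add {m n m' n' : ℕ} (f : Term K G m n) (g g' : Term K G m' n') :
      Cong R (f.tensor (g.add g')) ((f.tensor g).add (f.tensor g'))
  | add_tensor {m n m' n' : ℕ} (f f' : Term K G m n) (g : Term K G m' n') :
      Cong R ((f.add f').tensor g) ((f.tensor g).add (f'.tensor g))
  | tensor_smul {m n m' n' : ℕ} (a : K) (f : Term K G m n) (g : Term K G m' n') :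
      Cong R (f.tensor (.smul a g)) (.smul a (f.tensor g))
  | smul_tensor {m n m' n' : ℕ} (a : K) (f : Term K G m n) (g : Term K G m' n') :
      Cong R ((Term.smul a f).tensor g) (.smul a (f.tensor g))
  | id_comp {m n : ℕ} (f : Term K G m n) : Cong R ((Term.id m).comp f) f
  | comp_id {m n : ℕ} (f : Term K G m n) : Cong R (f.comp (Term.id n)) f
  | assoc {m n p q : ℕ} (f : Term K G m n) (g : Term K G n p) (h : Term K G p q) :
      Cong R ((f.comp g).comp h) (f.comp (g.comp h))
  | perm_comp {m n p : ℕ} (e : Fin m ≃ Fin n) (e' : Fin n ≃ Fin p) :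
      Cong R ((Term.perm e).comp (.perm e')) (.perm (e.trans e'))
  | perm_tensor {m n m' n' : ℕ} (e : Fin m ≃ Fin n) (e' : Fin m' ≃ Fin n') :
      Cong R ((Term.perm e).tensor (.perm e')) (.perm (juxt e e'))
  | interchange {m n p m' n' p' : ℕ} (f : Term K G m n) (g : Term K G n p)
      (f' : Term K G m' n') (g' : Term K G n' p') :
      Cong R ((f.comp g).tensor (f'.comp g')) ((f.tensor f').comp (g.tensor g'))
  | tensor_assoc {m n m' n' m'' n'' : ℕ} (f : Term K G m n) (g : Term K G m' n')
      (h : Term K G m'' n'') :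
      Cong R (((f.tensor g).tensor h).comp (.perm (finCongr (_root_.add_assoc n n' n''))))
        ((Term.perm (finCongr (_root_.add_assoc m m' m''))).comp (f.tensor (g.tensor h)))
  | unit_tensor {m n : ℕ} (f : Term K G m n) :
      Cong R (((Term.id 0).tensor f).comp (.perm (finCongr (_root_.zero_add n))))
        ((Term.perm (finCongr (_root_.zero_add m))).comp f)
  | tensor_unit {m n : ℕ} (f : Term K G m n) :
      Cong R ((f.tensor (Term.id 0)).comp (.perm (finCongr (_root_.add_zero n))))
        ((Term.perm (finCongr (_root_.add_zero m))).comp f)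
  | symmetry {m n m' n' : ℕ} (f : Term K G m n) (g : Term K G m' n') :
      Cong R ((f.tensor g).comp (.perm finAddFlip)) ((Term.perm finAddFlip).comp (g.tensor f))

section Presented

variable {G : ℕ → ℕ → Type} (R : ∀ m n : ℕ, Term K G m n → Term K G m n → Prop)

/-- The setoid of the congruence generated by `R`. -/
def congSetoid (m n : ℕ) : Setoid (Term K G m n) where
  r := Cong R
  iseqv := ⟨Cong.refl, Cong.symm, Cong.trans⟩

/-- The morphisms `m → n` of the PROP with generators `G` and relations `R`. -/
def PresHom (m n : ℕ) : Type u := Quotient (congSetoid R m n)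

/-- The class of a formal expression. -/
def PresHom.mk {m n : ℕ} (f : Term K G m n) : PresHom R m n := Quotient.mk (congSetoid R m n) f

variable {R}

lemma PresHom.sound {m n : ℕ} {f g : Term K G m n} (h : Cong R f g) :
    PresHom.mk R f = PresHom.mk R g := Quotient.sound h

lemma PresHom.exact {m n : ℕ} {f g : Term K G m n} (h : PresHom.mk R f = PresHom.mk R g) :
    Cong R f g := Quotient.exact h

lemma PresHom.ind {m n : ℕ} {p : PresHom R m n → Prop} (h : ∀ f, p (PresHom.mk R f))
    (x : PresHom R m n) : p x := Quotient.ind h x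

instance (m n : ℕ) : Add (PresHom R m n) where
  add := Quotient.map₂ Term.add fun _ _ h _ _ h' => Cong.add_congr h h'

instance (m n : ℕ) : Zero (PresHom R m n) where
  zero := PresHom.mk R .zero

instance (m n : ℕ) : Neg (PresHom R m n) where
  neg := Quotient.map (Term.smul (-1)) fun _ _ h => Cong.smul_congr _ h

instance (m n : ℕ) : AddCommGroup (PresHom R m n) where
  add_assoc := by
    intro a b c
    induction a using PresHom.ind
    induction b using PresHom.ind
    induction c using PresHom.ind
    exact PresHom.sound (Cong.add_assoc _ _ _)
  zero_add := by
    intro a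
    induction a using PresHom.ind
    exact PresHom.sound (Cong.zero_add _)
  add_zero := by
    intro a
    induction a using PresHom.ind
    exact PresHom.sound ((Cong.add_comm _ _).trans (Cong.zero_add _))
  add_comm := by
    intro a b
    induction a using PresHom.ind
    induction b using PresHom.ind
    exact PresHom.sound (Cong.add_comm _ _)
  neg_add_cancel := by
    intro a
    induction a using PresHom.ind
    exact PresHom.sound (Cong.neg_add _)
  nsmul := nsmulRec
  zsmul := zsmulRec

instance (m n : ℕ) : SMul K (PresHom R m n) where
  smul a := Quotient.map (Term.smul a) fun _ _ h => Cong.smul_congr _ h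

lemma PresHom.mk_add {m n : ℕ} (f g : Term K G m n) :
    PresHom.mk R (f.add g) = PresHom.mk R f + PresHom.mk R g := rfl

lemma PresHom.mk_zero {m n : ℕ} : PresHom.mk R (.zero : Term K G m n) = 0 := rfl

lemma PresHom.mk_smul {m n : ℕ} (a : K) (f : Term K G m n) :
    PresHom.mk R (.smul a f) = a • PresHom.mk R f := rfl

instance (m n : ℕ) : Module K (PresHom R m n) :=
  Module.ofMinimalAxioms
    (by
      intro a x y
      induction x using PresHom.ind
      induction y using PresHom.ind
      exact PresHom.sound (Cong.smul_add _ _ _))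
    (by
      intro a b x
      induction x using PresHom.ind
      exact PresHom.sound (Cong.add_smul _ _ _))
    (by
      intro a b x
      induction x using PresHom.ind
      exact PresHom.sound (Cong.mul_smul _ _ _))
    (by
      intro x
      induction x using PresHom.ind
      exact PresHom.sound (Cong.one_smul _))

/-- Composition in the presented PROP. -/
def PresHom.comp {m n p : ℕ} : PresHom R m n →ₗ[K] PresHom R n p →ₗ[K] PresHom R m p :=
  LinearMap.mk₂ K
    (Quotient.map₂ Term.comp fun _ _ h _ _ h' => Cong.comp_congr h h')
    (by
      intro f f' g
      induction f using PresHom.ind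
      induction f' using PresHom.ind
      induction g using PresHom.ind
      exact PresHom.sound (Cong.add_comp _ _ _))
    (by
      intro a f g
      induction f using PresHom.ind
      induction g using PresHom.ind
      exact PresHom.sound (Cong.smul_comp _ _ _))
    (by
      intro f g g'
      induction f using PresHom.ind
      induction g using PresHom.ind
      induction g' using PresHom.ind
      exact PresHom.sound (Cong.comp_add _ _ _))
    (by
      intro a f g
      induction f using PresHom.ind
      induction g using PresHom.ind
      exact PresHom.sound (Cong.comp_smul _ _ _))

/-- Tensor product of morphisms in the presented PROP. -/
def PresHom.tensor {m n m' n' : ℕ} :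
    PresHom R m n →ₗ[K] PresHom R m' n' →ₗ[K] PresHom R (m + m') (n + n') :=
  LinearMap.mk₂ K
    (Quotient.map₂ Term.tensor fun _ _ h _ _ h' => Cong.tensor_congr h h')
    (by
      intro f f' g
      induction f using PresHom.ind
      induction f' using PresHom.ind
      induction g using PresHom.ind
      exact PresHom.sound (Cong.add_tensor _ _ _))
    (by
      intro a f g
      induction f using PresHom.ind
      induction g using PresHom.ind
      exact PresHom.sound (Cong.smul_tensor _ _ _))
    (by
      intro f g g'
      induction f using PresHom.ind
      induction g using PresHom.ind
      induction g' using PresHom.ind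
      exact PresHom.sound (Cong.tensor_add _ _ _))
    (by
      intro a f g
      induction f using PresHom.ind
      induction g using PresHom.ind
      exact PresHom.sound (Cong.tensor_smul _ _ _))

variable (R) in
/-- The `K`-linear PROP with generators `G` and relations `R`. -/
def presented : LinearPROP K where
  Hom := PresHom R
  perm e := PresHom.mk R (.perm e)
  comp := PresHom.comp
  tensor := PresHom.tensor
  id_comp f := by
    induction f using PresHom.ind
    exact PresHom.sound (Cong.id_comp _)
  comp_id f := by
    induction f using PresHom.ind
    exact PresHom.sound (Cong.comp_id _)
  assoc f g h := by
    induction f using PresHom.ind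
    induction g using PresHom.ind
    induction h using PresHom.ind
    exact PresHom.sound (Cong.assoc _ _ _)
  perm_comp e e' := PresHom.sound (Cong.perm_comp e e')
  perm_tensor e e' := PresHom.sound (Cong.perm_tensor e e')
  interchange f g f' g' := by
    induction f using PresHom.ind
    induction g using PresHom.ind
    induction f' using PresHom.ind
    induction g' using PresHom.ind
    exact PresHom.sound (Cong.interchange _ _ _ _)
  tensor_assoc f g h := by
    induction f using PresHom.ind
    induction g using PresHom.ind
    induction h using PresHom.ind
    exact PresHom.sound (Cong.tensor_assoc _ _ _)
  unit_tensor f := by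
    induction f using PresHom.ind
    exact PresHom.sound (Cong.unit_tensor _)
  tensor_unit f := by
    induction f using PresHom.ind
    exact PresHom.sound (Cong.tensor_unit _)
  symmetry f g := by
    induction f using PresHom.ind
    induction g using PresHom.ind
    exact PresHom.sound (Cong.symmetry _ _)

/-- The value of a formal expression in a PROP `P`, given the values of the generators. -/
def Term.eval (P : LinearPROP K) (v : ∀ {m n : ℕ}, G m n → P.Hom m n) :
    ∀ {m n : ℕ}, Term K G m n → P.Hom m n
  | _, _, .gen x => v x
  | _, _, .perm e => P.perm e
  | _, _, .comp f g => P.comp (f.eval P v) (g.eval P v)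
  | _, _, .tensor f g => P.tensor (f.eval P v) (g.eval P v)
  | _, _, .zero => 0
  | _, _, .add f g => f.eval P v + g.eval P v
  | _, _, .smul a f => a • f.eval P v

lemma Cong.eval_eq (P : LinearPROP K) (v : ∀ {m n : ℕ}, G m n → P.Hom m n)
    (hv : ∀ {m n : ℕ} (f g : Term K G m n), R m n f g → f.eval P v = g.eval P v)
    {m n : ℕ} {f g : Term K G m n} (h : Cong R f g) : f.eval P v = g.eval P v := by
  induction h with
  | rel h => exact hv _ _ h
  | refl f => rfl
  | symm _ ih => exact ih.symm
  | trans _ _ ih ih' => exact ih.trans ih'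
  | comp_congr _ _ ih ih' => simp only [Term.eval, ih, ih']
  | tensor_congr _ _ ih ih' => simp only [Term.eval, ih, ih']
  | add_congr _ _ ih ih' => simp only [Term.eval, ih, ih']
  | smul_congr _ _ ih => simp only [Term.eval, ih]
  | add_assoc f g h => exact _root_.add_assoc _ _ _
  | add_comm f g => exact _root_.add_comm _ _
  | zero_add f => exact _root_.zero_add _
  | neg_add f => simp [Term.eval]
  | one_smul f => exact _root_.one_smul _ _
  | mul_smul a b f => exact SemigroupAction.mul_smul _ _ _
  | smul_add a f g => exact _root_.smul_add _ _ _
  | add_smul a b f => exact _root_.add_smul _ _ _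
  | comp_add f g g' => simp [Term.eval]
  | add_comp f f' g => simp [Term.eval]
  | comp_smul a f g => simp [Term.eval]
  | smul_comp a f g => simp [Term.eval]
  | tensor_add f g g' => simp [Term.eval]
  | add_tensor f f' g => simp [Term.eval]
  | tensor_smul a f g => simp [Term.eval]
  | smul_tensor a f g => simp [Term.eval]
  | id_comp f => exact P.id_comp _
  | comp_id f => exact P.comp_id _
  | assoc f g h => exact P.assoc _ _ _
  | perm_comp e e' => exact P.perm_comp _ _
  | perm_tensor e e' => exact P.perm_tensor _ _
  | interchange f g f' g' => exact P.interchange _ _ _ _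
  | tensor_assoc f g h => exact P.tensor_assoc _ _ _
  | unit_tensor f => exact P.unit_tensor _
  | tensor_unit f => exact P.tensor_unit _
  | symmetry f g => exact P.symmetry _ _

variable (R) in
/-- The morphism out of a presented PROP determined by values of the generators which satisfy the
relations. -/
def presentedLift (P : LinearPROP K) (v : ∀ {m n : ℕ}, G m n → P.Hom m n)
    (hv : ∀ {m n : ℕ} (f g : Term K G m n), R m n f g → f.eval P v = g.eval P v) :
    PROPHom (presented R) P where
  map {m n} :=
    { toFun := Quotient.lift (fun f : Term K G m n => f.eval P v) fun _ _ h => Cong.eval_eq P v hv h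
      map_add' := fun f g => by
        induction f using PresHom.ind
        induction g using PresHom.ind
        rfl
      map_smul' := fun a f => by
        induction f using PresHom.ind
        rfl }
  map_perm e := rfl
  map_comp f g := by
    induction f using PresHom.ind
    induction g using PresHom.ind
    rfl
  map_tensor f g := by
    induction f using PresHom.ind
    induction g using PresHom.ind
    rfl

end Presented

/-! ## The PROPs for Lie algebras and for Casimir Lie algebras -/

section Relations

variable {G : ℕ → ℕ → Type}

/-- The antisymmetry and Jacobi (AS and IHX) relations for `b : 2 → 1`. -/
inductive IsLieRel (b : Term K G 2 1) : ∀ m n : ℕ, Term K G m n → Term K G m n → Prop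
  | antisymm : IsLieRel b 2 1 (b.add ((Term.perm (Equiv.swap 0 1)).comp b)) .zero
  | jacobi : IsLieRel b 3 1
      (((Term.tensor b (Term.id 1)).comp b).add
        (((Term.perm (finRotate 3)).comp ((Term.tensor b (Term.id 1)).comp b)).add
          ((Term.perm ((finRotate 3).trans (finRotate 3))).comp
            ((Term.tensor b (Term.id 1)).comp b))))
      .zero

/-- The symmetry and invariance relations for `c : 0 → 2` with respect to `b : 2 → 1`. -/
inductive IsCasimirRel (b : Term K G 2 1) (c : Term K G 0 2) :
    ∀ m n : ℕ, Term K G m n → Term K G m n → Prop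
  | symm : IsCasimirRel b c 0 2 (c.comp (Term.perm (Equiv.swap 0 1))) c
  | invariant : IsCasimirRel b c 1 2
      (Term.comp (Term.tensor (Term.id 1) c : Term K G 1 3) (Term.tensor b (Term.id 1)))
      (Term.comp (Term.tensor c (Term.id 1) : Term K G 1 3) (Term.tensor (Term.id 1) b))

end Relations

/-- The generator of the PROP for Lie algebras. -/
inductive LieGen : ℕ → ℕ → Type
  | bracket : LieGen 2 1

/-- The generators of the PROP for Casimir Lie algebras. -/
inductive CasimirGen : ℕ → ℕ → Type
  | bracket : CasimirGen 2 1
  | casimir : CasimirGen 0 2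

variable (K) in
/-- The `K`-linear PROP for Lie algebras, freely generated by a Lie algebra. -/
def catLie : LinearPROP K :=
  presented (IsLieRel (K := K) (.gen LieGen.bracket))

variable (K) in
/-- The `K`-linear PROP for Casimir Lie algebras, freely generated by a Casimir Lie algebra. -/
def catLieC : LinearPROP K :=
  presented fun m n f g =>
    IsLieRel (K := K) (.gen CasimirGen.bracket) m n f g ∨
      IsCasimirRel (K := K) (.gen CasimirGen.bracket) (.gen CasimirGen.casimir) m n f g

variable (K) in
/-- The bracket of the PROP for Lie algebras. -/
def catLie.bracket : (catLie K).Hom 2 1 := PresHom.mk _ (.gen LieGen.bracket)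

/-- The values of the generators under the projection to degree `0`. -/
def projVal : ∀ {m n : ℕ}, CasimirGen m n → (catLie K).Hom m n
  | _, _, .bracket => catLie.bracket K
  | _, _, .casimir => 0

variable (K) in
/-- The projection of the PROP for Casimir Lie algebras, graded by the number of Casimir elements,
onto its degree `0` part, the PROP for Lie algebras: it preserves the bracket and kills the Casimir
element. -/
def projLie : PROPHom (catLieC K) (catLie K) :=
  presentedLift _ (catLie K) projVal (by
    intro m n f g h
    rcases h with h | h
    · cases h
      · exact PresHom.sound (Cong.rel IsLieRel.antisymm)
      · exact PresHom.sound (Cong.rel IsLieRel.jacobi)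
    · cases h <;> simp [Term.eval, projVal])

variable (K) in
/-- The exact functor `T` from modules over the PROP for Lie algebras to modules over the PROP for
Casimir Lie algebras induced by the projection to degree `0`. -/
def trivialCasimir : (catLie K).Mod ⥤ (catLieC K).Mod := (projLie K).restrict

/-! ## The linear PROP of permutations -/

lemma juxt_trans {m n p m' n' p' : ℕ} (e : Fin m ≃ Fin n) (f : Fin n ≃ Fin p)
    (e' : Fin m' ≃ Fin n') (f' : Fin n' ≃ Fin p') :
    juxt (e.trans f) (e'.trans f') = (juxt e e').trans (juxt f f') := by
  ext x
  simp [juxt]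

lemma juxt_castAdd {m n m' n' : ℕ} (e : Fin m ≃ Fin n) (e' : Fin m' ≃ Fin n') (x : Fin m) :
    juxt e e' (Fin.castAdd m' x) = Fin.castAdd n' (e x) := by simp [juxt]

lemma juxt_natAdd {m n m' n' : ℕ} (e : Fin m ≃ Fin n) (e' : Fin m' ≃ Fin n') (x : Fin m') :
    juxt e e' (Fin.natAdd m x) = Fin.natAdd n (e' x) := by simp [juxt]

lemma juxt_assoc {m n m' n' m'' n'' : ℕ} (e : Fin m ≃ Fin n) (e' : Fin m' ≃ Fin n')
    (e'' : Fin m'' ≃ Fin n'') :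
    (juxt (juxt e e') e'').trans (finCongr (add_assoc n n' n'')) =
      (finCongr (add_assoc m m' m'')).trans (juxt e (juxt e' e'')) := by
  ext x
  induction x using Fin.addCases with
  | left x =>
    induction x using Fin.addCases with
    | left x =>
      have h : finCongr (add_assoc m m' m'') (Fin.castAdd m'' (Fin.castAdd m' x)) =
        Fin.castAdd (m' + m'') x := rfl
      simp [h, juxt_castAdd]
    | right x =>
      have h : finCongr (add_assoc m m' m'') (Fin.castAdd m'' (Fin.natAdd m x)) =
        Fin.natAdd m (Fin.castAdd m'' x) := rfl
      simp only [Equiv.trans_apply, h, juxt_castAdd, juxt_natAdd]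
      rfl
  | right x =>
    have h : finCongr (add_assoc m m' m'') (Fin.natAdd (m + m') x) =
      Fin.natAdd m (Fin.natAdd m' x) := by ext; simp [add_assoc]
    simp only [Equiv.trans_apply, h, juxt_natAdd]
    simp [add_assoc]

lemma unit_juxt {m n : ℕ} (e : Fin m ≃ Fin n) :
    (juxt (Equiv.refl (Fin 0)) e).trans (finCongr (zero_add n)) =
      (finCongr (zero_add m)).trans e := by
  ext x
  induction x using Fin.addCases with
  | left x => exact x.elim0
  | right x =>
    have h : finCongr (zero_add m) (Fin.natAdd 0 x) = x := by ext; simp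
    simp only [Equiv.trans_apply, h, juxt_natAdd]
    simp

lemma juxt_unit {m n : ℕ} (e : Fin m ≃ Fin n) :
    (juxt e (Equiv.refl (Fin 0))).trans (finCongr (add_zero n)) =
      (finCongr (add_zero m)).trans e := by
  ext x
  induction x using Fin.addCases with
  | left x =>
    have h : finCongr (add_zero m) (Fin.castAdd 0 x) = x := rfl
    simp only [Equiv.trans_apply, h, juxt_castAdd]
    rfl
  | right x => exact x.elim0

lemma juxt_symmetry {m n m' n' : ℕ} (e : Fin m ≃ Fin n) (e' : Fin m' ≃ Fin n') :
    (juxt e e').trans finAddFlip = finAddFlip.trans (juxt e' e) := by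
  ext x
  induction x using Fin.addCases with
  | left x => simp [juxt]
  | right x => simp [juxt]

variable (K) in
/-- The bilinear extension of a binary operation to the free vector spaces. -/
def bilin {X Y Z : Type} (op : X → Y → Z) : (X →₀ K) →ₗ[K] (Y →₀ K) →ₗ[K] (Z →₀ K) :=
  Finsupp.lift _ K _ fun x => Finsupp.lmapDomain K K (op x)

lemma bilin_single {X Y Z : Type} (op : X → Y → Z) (x : X) (y : Y) (a b : K) :
    bilin K op (Finsupp.single x a) (Finsupp.single y b) = Finsupp.single (op x y) (a * b) := by
  rw [bilin, Finsupp.lift_apply, Finsupp.sum_single_index (by simp), LinearMap.smul_apply,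
    Finsupp.lmapDomain_apply, Finsupp.mapDomain_single, Finsupp.smul_single, smul_eq_mul]

variable (K) in
/-- The `K`-linear PROP `𝕊` of permutations: the morphisms `n → n` are the group algebra of the
symmetric group, and there is no nonzero morphism `m → n` if `m ≠ n`. -/
def symPROP : LinearPROP K where
  Hom m n := (Fin m ≃ Fin n) →₀ K
  perm e := Finsupp.single e 1
  comp := bilin K fun e e' => e.trans e'
  tensor := bilin K juxt
  id_comp f := by
    induction f using Finsupp.induction_linear with
    | zero => simp only [map_zero, LinearMap.zero_apply]
    | add x y hx hy => simp only [map_add, LinearMap.add_apply, hx, hy]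
    | single e_f a_f =>
      simp only [bilin_single, Equiv.refl_trans, one_mul]
  comp_id f := by
    induction f using Finsupp.induction_linear with
    | zero => simp only [map_zero, LinearMap.zero_apply]
    | add x y hx hy => simp only [map_add, LinearMap.add_apply, hx, hy]
    | single e_f a_f =>
      simp only [bilin_single, Equiv.trans_refl, mul_one]
  assoc f g h := by
    induction f using Finsupp.induction_linear with
    | zero => simp only [map_zero, LinearMap.zero_apply]
    | add x y hx hy => simp only [map_add, LinearMap.add_apply, hx, hy]
    | single e_f a_f =>
    induction g using Finsupp.induction_linear with
    | zero => simp only [map_zero, LinearMap.zero_apply]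
    | add x y hx hy => simp only [map_add, LinearMap.add_apply, hx, hy]
    | single e_g a_g =>
    induction h using Finsupp.induction_linear with
    | zero => simp only [map_zero, LinearMap.zero_apply]
    | add x y hx hy => simp only [map_add, LinearMap.add_apply, hx, hy]
    | single e_h a_h =>
      simp only [bilin_single, Equiv.trans_assoc, mul_assoc]
  perm_comp e e' := by simp only [bilin_single, mul_one]
  perm_tensor e e' := by simp only [bilin_single, mul_one]
  interchange f g f' g' := by
    induction f using Finsupp.induction_linear with
    | zero => simp only [map_zero, LinearMap.zero_apply]
    | add x y hx hy => simp only [map_add, LinearMap.add_apply, hx, hy]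
    | single e_f a_f =>
    induction g using Finsupp.induction_linear with
    | zero => simp only [map_zero, LinearMap.zero_apply]
    | add x y hx hy => simp only [map_add, LinearMap.add_apply, hx, hy]
    | single e_g a_g =>
    induction f' using Finsupp.induction_linear with
    | zero => simp only [map_zero, LinearMap.zero_apply]
    | add x y hx hy => simp only [map_add, LinearMap.add_apply, hx, hy]
    | single e_f' a_f' =>
    induction g' using Finsupp.induction_linear with
    | zero => simp only [map_zero, LinearMap.zero_apply]
    | add x y hx hy => simp only [map_add, LinearMap.add_apply, hx, hy]
    | single e_g' a_g' =>
      simp only [bilin_single, juxt_trans, mul_mul_mul_comm]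
  tensor_assoc f g h := by
    induction f using Finsupp.induction_linear with
    | zero => simp only [map_zero, LinearMap.zero_apply]
    | add x y hx hy => simp only [map_add, LinearMap.add_apply, hx, hy]
    | single e_f a_f =>
    induction g using Finsupp.induction_linear with
    | zero => simp only [map_zero, LinearMap.zero_apply]
    | add x y hx hy => simp only [map_add, LinearMap.add_apply, hx, hy]
    | single e_g a_g =>
    induction h using Finsupp.induction_linear with
    | zero => simp only [map_zero, LinearMap.zero_apply]
    | add x y hx hy => simp only [map_add, LinearMap.add_apply, hx, hy]
    | single e_h a_h =>
      simp only [bilin_single, juxt_assoc, mul_assoc, one_mul, mul_one]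
  unit_tensor f := by
    induction f using Finsupp.induction_linear with
    | zero => simp only [map_zero, LinearMap.zero_apply]
    | add x y hx hy => simp only [map_add, LinearMap.add_apply, hx, hy]
    | single e_f a_f =>
      simp only [bilin_single, unit_juxt, one_mul, mul_one]
  tensor_unit f := by
    induction f using Finsupp.induction_linear with
    | zero => simp only [map_zero, LinearMap.zero_apply]
    | add x y hx hy => simp only [map_add, LinearMap.add_apply, hx, hy]
    | single e_f a_f =>
      simp only [bilin_single, juxt_unit, one_mul, mul_one]
  symmetry f g := by
    induction f using Finsupp.induction_linear with
    | zero => simp only [map_zero, LinearMap.zero_apply]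
    | add x y hx hy => simp only [map_add, LinearMap.add_apply, hx, hy]
    | single e_f a_f =>
    induction g using Finsupp.induction_linear with
    | zero => simp only [map_zero, LinearMap.zero_apply]
    | add x y hx hy => simp only [map_add, LinearMap.add_apply, hx, hy]
    | single e_g a_g =>
      simp only [bilin_single, juxt_symmetry, one_mul, mul_one, mul_comm]

variable (K) in
/-- The morphism from the PROP for Lie algebras to `𝕊` which kills the bracket. -/
def lieToSym : PROPHom (catLie K) (symPROP K) :=
  presentedLift _ (symPROP K) (fun _ => 0) (by
    intro m n f g h
    cases h <;> simp [Term.eval])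

section Concentrated

variable {n : ℕ} {V : Type u} [AddCommGroup V] [Module K V]
  (ρ : Representation K (Equiv.Perm (Fin n)) V)

/-- The action of a bijection `Fin p ≃ Fin q` on a representation of the symmetric group on `n`
letters: the given one if `p = q = n`, zero otherwise. -/
def permAct {p q : ℕ} (e : Fin p ≃ Fin q) : V →ₗ[K] V :=
  if h : p = n ∧ q = n then
    ρ ((finCongr h.1).symm.trans (e.trans (finCongr h.2)))
  else 0

variable (K n V) in
/-- The value in degree `p` of a module concentrated in degree `n`: all of `V` if `p = n`, and zero
otherwise. -/
def concentratedValue (p : ℕ) : Submodule K V := if p = n then ⊤ else ⊥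

lemma permAct_mem {p q : ℕ} (e : Fin p ≃ Fin q) (x : V) :
    permAct ρ e x ∈ concentratedValue K n V q := by
  unfold permAct concentratedValue
  split_ifs <;> simp_all

lemma permAct_refl {p : ℕ} (x : concentratedValue K n V p) :
    permAct ρ (Equiv.refl (Fin p)) x = (x : V) := by
  by_cases h : p = n
  · subst h
    simp only [permAct, and_self, dite_true]
    exact LinearMap.congr_fun (map_one ρ) (x : V)
  · have hx := x.2
    simp only [concentratedValue, h, if_false, Submodule.mem_bot] at hx
    simp [hx]

lemma permAct_trans {p q r : ℕ} (e : Fin p ≃ Fin q) (e' : Fin q ≃ Fin r) (x : V) :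
    permAct ρ (e.trans e') x = permAct ρ e' (permAct ρ e x) := by
  obtain rfl : p = q := Fin.equiv_iff_eq.1 ⟨e⟩
  obtain rfl : p = r := Fin.equiv_iff_eq.1 ⟨e'⟩
  by_cases h : p = n
  · subst h
    simp only [permAct, and_self, dite_true]
    exact LinearMap.congr_fun (map_mul ρ e' e) x
  · simp [permAct, h]

/-- The action of a morphism of `𝕊` on the module concentrated in degree `n`. -/
def concentratedMap (p q : ℕ) :
    ((Fin p ≃ Fin q) →₀ K) →ₗ[K] concentratedValue K n V p →ₗ[K] concentratedValue K n V q :=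
  Finsupp.lift _ K _ fun e : Fin p ≃ Fin q =>
    (permAct ρ e).restrict fun x _ => permAct_mem ρ e x

lemma concentratedMap_single {p q : ℕ} (e : Fin p ≃ Fin q) (a : K)
    (x : concentratedValue K n V p) :
    (concentratedMap ρ p q (Finsupp.single e a) x : V) = a • permAct ρ e x := by
  rw [concentratedMap, Finsupp.lift_apply, Finsupp.sum_single_index (by simp)]
  rfl

lemma concentratedMap_id {p : ℕ} :
    concentratedMap ρ p p (Finsupp.single (Equiv.refl (Fin p)) 1) = LinearMap.id := by
  refine LinearMap.ext fun x => Subtype.ext ?_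
  rw [concentratedMap_single, one_smul, permAct_refl]
  rfl

lemma concentratedMap_comp {p q r : ℕ} (f : (Fin p ≃ Fin q) →₀ K) (g : (Fin q ≃ Fin r) →₀ K) :
    concentratedMap ρ p r (bilin K (fun e e' => e.trans e') f g) =
      concentratedMap ρ q r g ∘ₗ concentratedMap ρ p q f := by
  induction f using Finsupp.induction_linear with
  | zero => simp only [map_zero, LinearMap.zero_apply, LinearMap.comp_zero]
  | add x y hx hy => simp only [map_add, LinearMap.add_apply, hx, hy, LinearMap.comp_add]
  | single e a =>
  induction g using Finsupp.induction_linear with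
  | zero => simp only [map_zero, LinearMap.zero_comp]
  | add x y hx hy => simp only [map_add, hx, hy, LinearMap.add_comp]
  | single e' a' =>
    refine LinearMap.ext fun x => Subtype.ext ?_
    rw [bilin_single, LinearMap.comp_apply, concentratedMap_single, concentratedMap_single,
      concentratedMap_single, map_smul, permAct_trans, smul_smul, mul_comm]

/-- The `𝕊`-module which is a given representation of the symmetric group in degree `n` and is zero
in all other degrees. -/
def concentrated : (symPROP K).Mod where
  obj :=
    { obj := fun X => ModuleCat.of K (concentratedValue K n V X.deg)
      map := fun {X Y} f => ModuleCat.ofHom (concentratedMap ρ X.deg Y.deg f)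
      map_id := fun X => congrArg ModuleCat.ofHom (concentratedMap_id ρ)
      map_comp := fun {X Y Z} f g => congrArg ModuleCat.ofHom (concentratedMap_comp ρ f g) }
  property :=
    ⟨⟨fun {X Y f g} => congrArg ModuleCat.ofHom ((concentratedMap ρ X.deg Y.deg).map_add f g)⟩,
      ⟨fun {X Y} f r => congrArg ModuleCat.ofHom ((concentratedMap ρ X.deg Y.deg).map_smul r f)⟩⟩

end Concentrated

/-! ## Specht modules and Littlewood-Richardson coefficients -/

section Specht

open Equiv

/-- The rows of the Young diagram of a partition, in weakly decreasing order. -/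
def rows {n : ℕ} (lam : n.Partition) : Composition n where
  blocks := lam.parts.sort (· ≥ ·)
  blocks_pos h := lam.parts_pos ((Multiset.mem_sort _).1 h)
  blocks_sum := by
    rw [← Multiset.sum_coe, Multiset.sort_eq, lam.parts_sum]

/-- The index of the row containing the letter `i` in the canonical tableau, which is filled with
`0, 1, …, n - 1` row by row. -/
def rowIndex {n : ℕ} (lam : n.Partition) (i : Fin n) : ℕ := (rows lam).index i

/-- The index of the column containing the letter `i` in the canonical tableau. -/
def colIndex {n : ℕ} (lam : n.Partition) (i : Fin n) : ℕ := (rows lam).invEmbedding i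

variable (K) in
open Classical in
/-- The Young symmetrizer of a partition: the sum of the row stabilizer of the canonical tableau
times the signed sum of its column stabilizer. -/
def youngSymmetrizer {n : ℕ} (lam : n.Partition) : MonoidAlgebra K (Perm (Fin n)) :=
  (∑ σ : Perm (Fin n) with ∀ i, rowIndex lam (σ i) = rowIndex lam i, MonoidAlgebra.single σ 1) *
    ∑ τ : Perm (Fin n) with ∀ i, colIndex lam (τ i) = colIndex lam i,
      MonoidAlgebra.single τ ((Perm.sign τ : ℤ) : K)

variable (K) in
/-- The Specht module of a partition: the left ideal generated by the Young symmetrizer. -/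
abbrev Specht {n : ℕ} (lam : n.Partition) : Type u :=
  Ideal.span {youngSymmetrizer K lam}

variable (K) in
/-- The action of the symmetric group on a Specht module, by multiplication on the left. -/
def spechtRep {n : ℕ} (lam : n.Partition) :
    Representation K (Perm (Fin n)) (Specht K lam) :=
  (Algebra.lsmul K K (Specht K lam)).toMonoidHom.comp (MonoidAlgebra.of K (Perm (Fin n)))

variable (K) in
/-- The Specht module as a module over the PROP for Lie algebras: it is concentrated in degree `n`,
and the bracket acts by zero. -/
def spechtLie {n : ℕ} (lam : n.Partition) : (catLie K).Mod :=
  (lieToSym K).restrict.obj (concentrated (spechtRep K lam))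

/-- The inclusion of the Young subgroup. -/
def youngSubgroup {a b n : ℕ} (h : a + b = n) :
    Perm (Fin a) × Perm (Fin b) →* Perm (Fin n) where
  toFun σ := (finCongr h).symm.trans ((juxt σ.1 σ.2).trans (finCongr h))
  map_one' := by
    subst h
    ext i
    simp [juxt]
  map_mul' σ τ := by
    subst h
    ext i
    simp [juxt]

section Induction

variable {V W : Type u} [AddCommGroup V] [Module K V] [AddCommGroup W] [Module K W] {a b n : ℕ}
  (ρ : Representation K (Perm (Fin a)) V) (σ : Representation K (Perm (Fin b)) W)

/-- The external tensor product of two representations. -/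
abbrev externalTensor : Representation K (Perm (Fin a) × Perm (Fin b)) (TensorProduct K V W) :=
  Representation.tprod (ρ.comp (MonoidHom.fst _ _)) (σ.comp (MonoidHom.snd _ _))

/-- The space of the induction product of two representations. -/
abbrev InductionSpace (h : a + b = n) : Type u :=
  Representation.IndV (k := K) (youngSubgroup h) (externalTensor ρ σ)

/-- The induction product of two representations: the representation of the symmetric group on
`n = a + b` letters induced from the external tensor product. -/
abbrev inductionProduct (h : a + b = n) :
    Representation K (Perm (Fin n)) (InductionSpace ρ σ h) :=
  Representation.ind (k := K) (youngSubgroup h) (externalTensor ρ σ)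

end Induction

variable (K) in
/-- The Littlewood-Richardson coefficient `LR^λ_{ρ,ν}`: the multiplicity of the (absolutely)
irreducible representation `S_λ` in the induction product of `S_ρ` and `S_ν`, which is zero unless
`|λ| = |ρ| + |ν|`. -/
def LR {a b n : ℕ} (lam : n.Partition) (rho : a.Partition) (nu : b.Partition) : ℕ :=
  if h : a + b = n then
    Module.finrank K (Representation.IntertwiningMap (spechtRep K lam) (inductionProduct (spechtRep K rho) (spechtRep K nu) h))
  else 0

/-- The partition `(1)`. -/
def part1 : Nat.Partition 1 := ⟨{1}, by simp, by simp⟩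

/-- The partition `(2)`. -/
def part2 : Nat.Partition 2 := ⟨{2}, by simp, by simp⟩

/-- The partition `(1, 1)`. -/
def part11 : Nat.Partition 2 := ⟨{1, 1}, by simp, by simp⟩

end Specht

/-! ## Bimodules over symmetric groups and tensor products -/

section Bimodules

open Equiv MulOpposite TensorProduct

/-- The left action of the symmetric group on the morphisms `n → m` of a PROP, by composition with
permutations of the target. -/
def LinearPROP.leftAct (P : LinearPROP K) (n m : ℕ) :
    Representation K (Perm (Fin m)) (P.Hom n m) where
  toFun σ := P.comp.flip (P.perm σ)
  map_one' := by
    ext f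
    exact P.comp_id f
  map_mul' σ τ := by
    ext f
    change P.comp f (P.perm (τ.trans σ)) = P.comp (P.comp f (P.perm τ)) (P.perm σ)
    rw [P.assoc, P.perm_comp]

/-- The right action of the symmetric group on the morphisms `n → m` of a PROP, by composition with
permutations of the source. -/
def LinearPROP.rightAct (P : LinearPROP K) (n m : ℕ) :
    Representation K (Perm (Fin n))ᵐᵒᵖ (P.Hom n m) where
  toFun σ := P.comp (P.perm σ.unop)
  map_one' := by
    ext f
    exact P.id_comp f
  map_mul' σ τ := by
    ext f
    change P.comp (P.perm (σ.unop.trans τ.unop)) f = P.comp (P.perm σ.unop) (P.comp (P.perm τ.unop) f)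
    rw [← P.assoc, P.perm_comp]

/-- The partitionings of `{1⁺, …, n⁺} ⊔ {1⁻, …, m⁻}` into unordered pairs none of which consists of
two positive elements, given by the fixed point free involution which exchanges the elements of each
pair.  The positive elements are those of the left summand. -/
def UpMatching (n m : ℕ) : Type :=
  {π : Perm (Fin n ⊕ Fin m) //
    (∀ x, π (π x) = x ∧ π x ≠ x) ∧ ∀ i j : Fin n, π (Sum.inl i) ≠ Sum.inl j}

/-- Relabelling of a pairing: the pairs `{x, y}` are replaced by `{(σ ⊔ τ) x, (σ ⊔ τ) y}`. -/
def UpMatching.relabel {n m : ℕ} (σ : Perm (Fin n)) (τ : Perm (Fin m)) (π : UpMatching n m) :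
    UpMatching n m :=
  ⟨(Equiv.sumCongr σ τ).symm.trans (π.1.trans (Equiv.sumCongr σ τ)), by
    obtain ⟨π, h1, h2⟩ := π
    refine ⟨fun x => ⟨?_, fun h => ?_⟩, fun i j h => ?_⟩
    · simp [(h1 _).1]
    · apply (h1 ((Equiv.sumCongr σ τ).symm x)).2
      rw [Equiv.eq_symm_apply]
      exact h
    · apply h2 (σ.symm i) (σ.symm j)
      simp only [Equiv.trans_apply] at h
      rw [← Equiv.eq_symm_apply] at h
      exact h⟩

lemma UpMatching.relabel_relabel {n m : ℕ} (σ σ' : Perm (Fin n)) (τ τ' : Perm (Fin m))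
    (π : UpMatching n m) : (π.relabel σ τ).relabel σ' τ' = π.relabel (σ' * σ) (τ' * τ) := by
  apply Subtype.ext
  ext x
  rcases x with x | x <;> simp [relabel, Perm.mul_def]

lemma UpMatching.relabel_one {n m : ℕ} (π : UpMatching n m) : π.relabel 1 1 = π := by
  apply Subtype.ext
  ext x
  rcases x with x | x <;> simp [relabel, Perm.one_def]

variable (K) in
/-- The space of morphisms `n → m` of the upward Brauer category. -/
abbrev ub (n m : ℕ) : Type u := UpMatching n m →₀ K

variable (K) in
/-- The left action of the symmetric group on the morphisms `n → m` of the upward Brauer category: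
composing with a permutation `τ` of the target relabels the negative elements by `τ`. -/
def ubLeftAct (n m : ℕ) : Representation K (Perm (Fin m)) (ub K n m) where
  toFun τ := Finsupp.lmapDomain K K (UpMatching.relabel 1 τ)
  map_one' := by
    ext π : 1
    ext
    simp [UpMatching.relabel_one]
  map_mul' σ τ := by
    ext π : 1
    ext
    simp [UpMatching.relabel_relabel]

variable (K) in
/-- The right action of the symmetric group on the morphisms `n → m` of the upward Brauer category:
composing with a permutation `σ` of the source relabels the positive elements by `σ⁻¹`. -/
def ubRightAct (n m : ℕ) : Representation K (Perm (Fin n))ᵐᵒᵖ (ub K n m) where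
  toFun σ := Finsupp.lmapDomain K K (UpMatching.relabel σ.unop⁻¹ 1)
  map_one' := by
    ext π : 1
    ext
    simp [UpMatching.relabel_one]
  map_mul' σ τ := by
    ext π : 1
    ext
    simp [UpMatching.relabel_relabel]

section Balanced

variable {G H : Type} [Group G] [Group H] {V W B : Type u} [AddCommGroup V] [Module K V]
  [AddCommGroup W] [Module K W] [AddCommGroup B] [Module K B]

/-- The relations `(v g) ⊗ b ⊗ w = v ⊗ (g b) ⊗ w` and `v ⊗ (b h) ⊗ w = v ⊗ b ⊗ (h w)`, where the
representation `V` of `G` is considered as a right module by `v g = g⁻¹ v`. -/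
def balancedRel (ρ : Representation K G V) (L : Representation K G B)
    (R : Representation K Hᵐᵒᵖ B) (σ : Representation K H W) : Submodule K (V ⊗[K] (B ⊗[K] W)) :=
  Submodule.span K
    ({x | ∃ (g : G) (v : V) (b : B) (w : W),
        x = ρ g⁻¹ v ⊗ₜ[K] (b ⊗ₜ[K] w) - v ⊗ₜ[K] (L g b ⊗ₜ[K] w)} ∪
      {x | ∃ (h : H) (v : V) (b : B) (w : W),
        x = v ⊗ₜ[K] (R (op h) b ⊗ₜ[K] w) - v ⊗ₜ[K] (b ⊗ₜ[K] σ h w)})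

/-- The tensor product `V ⊗_{KG} B ⊗_{KH} W` of a representation `V` of `G`, considered as a right
module by means of the inverse, a `(KG, KH)`-bimodule `B` and a representation `W` of `H`. -/
abbrev Balanced (ρ : Representation K G V) (L : Representation K G B)
    (R : Representation K Hᵐᵒᵖ B) (σ : Representation K H W) : Type u :=
  (V ⊗[K] (B ⊗[K] W)) ⧸ balancedRel ρ L R σ

end Balanced

end Bimodules

variable (K) in
/-- The first Ext-group between `T(S_λ)` and `T(S_μ)` in the category of modules over the PROP for
Casimir Lie algebras. -/
abbrev Ext1 {n m : ℕ} (lam : n.Partition) (mu : m.Partition) : Type (u + 1) :=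
  Abelian.Ext.{u + 1} ((trivialCasimir K).obj (spechtLie K lam))
    ((trivialCasimir K).obj (spechtLie K mu)) 1

end ExtCasimir

end

/-! Both modules are pulled back along the augmentation `aug` of the Casimir Lie PROP onto the PROP
of permutations. Let I be its kernel, the ideal generated by the bracket and the Casimir element. In
characteristic zero the symmetric groups contribute no cohomology, so Ext¹ should be the space of
bimodule maps from I/I² in bidegree (n, m) to Hom(S_λ, S_μ). Modulo I² only words with a single
generator survive. Hence I/I² is generated by the elements id_k ⊗ [,] in bidegree (k+2, k+1) and
id_k ⊗ c in bidegree (k, k+2), and this is the origin of the three cases.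

To make this precise, cover a concentrated module by the module P(n, -) ⊗ V, with the tensor product
taken over the field K and not over the group algebra. It is projective, and `connecting_surjective`
and `connecting_eq_zero_iff` present Ext¹ as morphisms out of the kernel modulo those that extend to
the cover. If n ≠ m the target vanishes in degree n, so nothing nonzero extends and Ext¹ is the
space of morphisms out of the kernel (`extOfKer_bijective`). Such a morphism kills I² and is
determined by its value at id_k ⊗ x, a vector of Hom(V, W) on which the stabilizer S_k × S_a × S_b
of that element acts through the sign of S_a (`genEval_injective`). If n = m a morphism gives a
group cocycle, which is a coboundary by averaging (`subsingleton_ext_self`).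

The converse is that every such vector occurs (`genEval_surjective`). The translates of id_k ⊗ x
must satisfy no relation modulo I² beyond those imposed by the stabilizer. This is seen in a PROP of
matrices over the dual numbers: send one generator to ε times an antisymmetric or symmetric matrix,
and the other to zero. The Jacobi and invariance relations are quadratic in the generators, hence
hold because ε² = 0, and for the same reason I² is sent to zero. A suitable matrix coefficient is a
linear form that equals 1 at id_k ⊗ x and 0 at its translates outside the stabilizer
(`detected_casPad`); averaging it yields the required equivariant maps.

The bimodules catLie(k+2, k+1) and ub(k, k+2) are cyclic, on a generator with the same stabilizer
and the same character. The dual of the balanced tensor product is therefore the isotypic part of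
the dual of S_μ ⊗ S_λ (`balanced_of_detected`). Permutations are conjugate to their inverses, so
this has the same dimension as the isotypic part of Hom(S_λ, S_μ), namely the character sum
`stabSum` divided by the order of the stabilizer. The isomorphisms are obtained from this equality
of finite dimensions.

It remains to express the sum through Littlewood–Richardson coefficients. For the Casimir element
this is Frobenius reciprocity (`LR_casimir`). For the bracket one also expands class functions of
S_k in the characters of the Specht modules (`sum_char_mul_sum_char`). This needs the classical
theory of Young symmetrizers: Specht modules of distinct partitions are disjoint, each has only
scalar endomorphisms, and there are as many of them as cycle types. -/

set_option linter.unusedSectionVars false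

noncomputable section

namespace ExtCasimir

variable {K : Type u} [Field K]

/-! ## Extensions from a projective presentation -/

section Presentation

open Abelian Limits

universe v' u' w'

variable {C : Type u'} [Category.{v'} C] [Abelian C] [Linear K C] [HasExt.{w'} C]

/-- The connecting homomorphism of a short exact sequence, as a linear map. -/
def connecting {S : ShortComplex C} (hS : S.ShortExact) (Y : C) :
    (S.X₁ ⟶ Y) →ₗ[K] Ext S.X₃ Y 1 :=
  (Ext.precompOfLinear hS.extClass K Y (add_zero 1)) ∘ₗ
    (Ext.linearEquiv₀ (R := K)).symm.toLinearMap

lemma connecting_apply {S : ShortComplex C} (hS : S.ShortExact) {Y : C} (f : S.X₁ ⟶ Y) :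
    connecting (K := K) hS Y f = hS.extClass.comp (Ext.mk₀ f) (add_zero 1) := by
  simp [connecting]

/-- The next term of the long exact sequence is Ext¹ out of the projective middle object, which
vanishes. -/
lemma connecting_surjective {S : ShortComplex C} (hS : S.ShortExact) [Projective S.X₂] (Y : C) :
    Function.Surjective (connecting (K := K) hS Y) := by
  intro e
  obtain ⟨x, hx⟩ := Ext.contravariant_sequence_exact₃ hS Y e (Ext.eq_zero_of_projective _)
    (n₀ := 0) (add_zero 1)
  refine ⟨Ext.linearEquiv₀ (R := K) x, ?_⟩
  rw [connecting_apply, Ext.mk₀_linearEquiv₀_apply, hx]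

/-- Exactness one place earlier. With surjectivity, this presents Ext¹ as Hom(X₁, Y) modulo the
morphisms that extend to X₂. -/
lemma connecting_eq_zero_iff {S : ShortComplex C} (hS : S.ShortExact) {Y : C} (f : S.X₁ ⟶ Y) :
    connecting (K := K) hS Y f = 0 ↔ ∃ g : S.X₂ ⟶ Y, S.f ≫ g = f := by
  rw [connecting_apply]
  constructor
  · intro h
    obtain ⟨x, hx⟩ := Ext.contravariant_sequence_exact₁ hS Y (Ext.mk₀ f) (add_zero 1) h
    refine ⟨Ext.linearEquiv₀ (R := K) x, ?_⟩
    apply (Ext.linearEquiv₀ (R := K)).symm.injective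
    rw [← Ext.mk₀_linearEquiv₀_apply (R := K) x, Ext.mk₀_comp_mk₀] at hx
    simpa using hx
  · rintro ⟨g, rfl⟩
    rw [← Ext.mk₀_comp_mk₀, hS.extClass_comp_assoc]

end Presentation

/-! ## Modules over a linear PROP in terms of linear maps -/

section Modules

variable {P : LinearPROP K}

/-- The action of a morphism on a module. -/
def modAct (M : P.Mod) (p q : ℕ) :
    P.Hom p q →ₗ[K] M.obj.obj ⟨p⟩ →ₗ[K] M.obj.obj ⟨q⟩ where
  toFun f := (M.obj.map (X := ⟨p⟩) (Y := ⟨q⟩) f).hom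
  map_add' f g := by
    have := M.property.1
    exact congrArg ModuleCat.Hom.hom (M.obj.map_add (X := ⟨p⟩) (Y := ⟨q⟩) (f := f) (g := g))
  map_smul' a f := by
    have := M.property.1
    have := M.property.2
    exact congrArg ModuleCat.Hom.hom (M.obj.map_smul (X := ⟨p⟩) (Y := ⟨q⟩) a f)

lemma modAct_comp (M : P.Mod) {p q r : ℕ} (f : P.Hom p q) (g : P.Hom q r) (x : M.obj.obj ⟨p⟩) :
    modAct M p r (P.comp f g) x = modAct M q r g (modAct M p q f x) := by
  have := M.obj.map_comp (X := ⟨p⟩) (Y := ⟨q⟩) (Z := ⟨r⟩) f g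
  exact congrArg (fun h => h.hom x) this

lemma modAct_id (M : P.Mod) {p : ℕ} (x : M.obj.obj ⟨p⟩) :
    modAct M p p (P.perm (Equiv.refl _)) x = x := by
  have := M.obj.map_id ⟨p⟩
  exact congrArg (fun h => h.hom x) this

/-- A module constructed from linear maps. -/
def mkMod (X : ℕ → Type u) [∀ p, AddCommGroup (X p)] [∀ p, Module K (X p)]
    (act : ∀ p q, P.Hom p q →ₗ[K] X p →ₗ[K] X q)
    (hid : ∀ p x, act p p (P.perm (Equiv.refl _)) x = x)
    (hcomp : ∀ p q r (f : P.Hom p q) (g : P.Hom q r) x,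
      act p r (P.comp f g) x = act q r g (act p q f x)) : P.Mod where
  obj :=
    { obj := fun Y => ModuleCat.of K (X Y.deg)
      map := fun {Y Z} f => ModuleCat.ofHom (act Y.deg Z.deg f)
      map_id := fun Y => by
        ext x
        exact hid Y.deg x
      map_comp := fun f g => by
        ext x
        exact hcomp _ _ _ f g x }
  property :=
    ⟨⟨fun {Y Z f g} => congrArg ModuleCat.ofHom ((act Y.deg Z.deg).map_add f g)⟩,
      ⟨fun {Y Z} f r => congrArg ModuleCat.ofHom ((act Y.deg Z.deg).map_smul r f)⟩⟩

/-- A morphism of modules constructed from linear maps. -/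
def mkHom {M N : P.Mod} (φ : ∀ p, M.obj.obj ⟨p⟩ →ₗ[K] N.obj.obj ⟨p⟩)
    (h : ∀ p q (f : P.Hom p q) x, φ q (modAct M p q f x) = modAct N p q f (φ p x)) : M ⟶ N :=
  ObjectProperty.homMk
    { app := fun Y => ModuleCat.ofHom (φ Y.deg)
      naturality := fun Y Z f => by
        ext x
        exact h Y.deg Z.deg f x }

/-- The components of a morphism of modules, depending linearly on the morphism. -/
def homAt {M N : P.Mod} (p : ℕ) : (M ⟶ N) →ₗ[K] M.obj.obj ⟨p⟩ →ₗ[K] N.obj.obj ⟨p⟩ where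
  toFun φ := (φ.hom.app ⟨p⟩).hom
  map_add' _ _ := rfl
  map_smul' _ _ := rfl

lemma homAt_modAct {M N : P.Mod} (φ : M ⟶ N) {p q : ℕ} (f : P.Hom p q) (x : M.obj.obj ⟨p⟩) :
    homAt q φ (modAct M p q f x) = modAct N p q f (homAt p φ x) := by
  have := φ.hom.naturality (X := ⟨p⟩) (Y := ⟨q⟩) f
  exact congrArg (fun h => h.hom x) this

lemma mod_hom_ext {M N : P.Mod} {φ ψ : M ⟶ N} (h : ∀ p, homAt p φ = homAt p ψ) : φ = ψ := by
  apply ObjectProperty.hom_ext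
  ext Y x
  exact LinearMap.congr_fun (h Y.deg) x

lemma homAt_comp {M N L : P.Mod} (φ : M ⟶ N) (ψ : N ⟶ L) (p : ℕ) (x) :
    homAt p (φ ≫ ψ) x = homAt p ψ (homAt p φ x) := rfl

lemma mono_of_homAt_injective {M N : P.Mod} (φ : M ⟶ N)
    (h : ∀ p, Function.Injective (homAt p φ)) : Mono φ where
  right_cancellation f g hfg := mod_hom_ext fun p => LinearMap.ext fun x => h p (by
    rw [← homAt_comp, hfg, homAt_comp])

lemma epi_of_homAt_surjective {M N : P.Mod} (φ : M ⟶ N)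
    (h : ∀ p, Function.Surjective (homAt p φ)) : Epi φ where
  left_cancellation f g hfg := mod_hom_ext fun p => LinearMap.ext fun x => by
    obtain ⟨y, rfl⟩ := h p x
    rw [← homAt_comp, hfg, homAt_comp]

/-- Projectivity of free modules needs pointwise lifts, whereas an epimorphism is only given by a
cancellation property. The quotient by the pointwise image is again a module, and its projection,
killed by `φ`, must be zero. -/
lemma homAt_surjective_of_epi {M N : P.Mod} (φ : M ⟶ N) [Epi φ] (p : ℕ) :
    Function.Surjective (homAt p φ) := by
  -- the cokernel of `φ` is computed pointwise
  let Q (q : ℕ) := N.obj.obj ⟨q⟩ ⧸ LinearMap.range (homAt q φ)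
  let act (q r : ℕ) : P.Hom q r →ₗ[K] Q q →ₗ[K] Q r :=
    { toFun := fun f => Submodule.mapQ _ _ (modAct N q r f) (by
        rintro _ ⟨x, rfl⟩
        exact ⟨modAct M q r f x, homAt_modAct φ f x⟩)
      map_add' := fun f g => by
        ext x
        simp
      map_smul' := fun a f => by
        ext x
        simp }
  let L : P.Mod := mkMod Q act
    (fun q x => by
      induction x using Submodule.Quotient.induction_on
      exact congrArg Submodule.Quotient.mk (modAct_id N _))
    (fun q r s f g x => by
      induction x using Submodule.Quotient.induction_on
      exact congrArg Submodule.Quotient.mk (modAct_comp N f g _))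
  let π : N ⟶ L := mkHom (fun q => Submodule.mkQ _) (fun q r f x => rfl)
  have hπ : π = 0 := by
    rw [← cancel_epi φ]
    refine mod_hom_ext fun q => LinearMap.ext fun x => ?_
    refine (Submodule.Quotient.mk_eq_zero _).2 ⟨x, rfl⟩
  intro y
  have : homAt p π y = 0 := by
    rw [hπ]
    rfl
  exact (Submodule.Quotient.mk_eq_zero _).1 this

end Modules

/-! ## Free modules and kernels -/

section Free

open TensorProduct

variable {P : LinearPROP K}

variable (P) in
/-- The free module on a vector space placed in degree `n`. -/
def freeMod (n : ℕ) (V : Type u) [AddCommGroup V] [Module K V] : P.Mod :=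
  mkMod (fun p => P.Hom n p ⊗[K] V)
    (fun _ _ => (LinearMap.rTensorHom V) ∘ₗ P.comp.flip)
    (fun p x => by
      induction x with
      | zero => simp
      | add x y hx hy => rw [map_add, hx, hy]
      | tmul f v => simp [P.comp_id])
    (fun p q r f g x => by
      induction x with
      | zero => simp
      | add x y hx hy => simp only [map_add, hx, hy]
      | tmul h v => simp [P.assoc])

variable {n : ℕ} {V : Type u} [AddCommGroup V] [Module K V]

/-- The pure tensors in a free module. -/
def tm (p : ℕ) : P.Hom n p →ₗ[K] V →ₗ[K] (freeMod P n V).obj.obj ⟨p⟩ :=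
  TensorProduct.mk K (P.Hom n p) V

lemma modAct_tm {p q : ℕ} (f : P.Hom p q) (g : P.Hom n p) (v : V) :
    modAct (freeMod P n V) p q f (tm p g v) = tm q (P.comp g f) v := rfl

lemma free_ext {p : ℕ} {W : Type*} [AddCommGroup W] [Module K W]
    {φ ψ : (freeMod P n V).obj.obj ⟨p⟩ →ₗ[K] W}
    (h : ∀ (f : P.Hom n p) (v : V), φ (tm p f v) = ψ (tm p f v)) : φ = ψ :=
  TensorProduct.ext' (M := P.Hom n p) (N := V) h

/-- Linear maps out of a free module are determined by their values on pure tensors. -/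
def freeLift {p : ℕ} {W : Type*} [AddCommGroup W] [Module K W] (b : P.Hom n p →ₗ[K] V →ₗ[K] W) :
    (freeMod P n V).obj.obj ⟨p⟩ →ₗ[K] W :=
  TensorProduct.lift b

lemma freeLift_tm {p : ℕ} {W : Type*} [AddCommGroup W] [Module K W]
    (b : P.Hom n p →ₗ[K] V →ₗ[K] W) (f : P.Hom n p) (v : V) :
    freeLift b (tm p f v) = b f v := rfl

/-- The morphism out of a free module determined by a linear map. -/
def freeHom (M : P.Mod) (φ : V →ₗ[K] M.obj.obj ⟨n⟩) : freeMod P n V ⟶ M :=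
  mkHom (fun p => freeLift ((LinearMap.lcomp K _ φ) ∘ₗ modAct M n p))
    (fun p q f x => by
      refine LinearMap.congr_fun (f := freeLift ((LinearMap.lcomp K _ φ) ∘ₗ modAct M n q) ∘ₗ
        modAct (freeMod P n V) p q f) (g := modAct M p q f ∘ₗ
          freeLift ((LinearMap.lcomp K _ φ) ∘ₗ modAct M n p)) (free_ext fun g v => ?_) x
      rw [LinearMap.comp_apply, modAct_tm, freeLift_tm]
      exact modAct_comp M g f _)

lemma homAt_freeHom_tm (M : P.Mod) (φ : V →ₗ[K] M.obj.obj ⟨n⟩) {p : ℕ} (f : P.Hom n p) (v : V) :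
    homAt p (freeHom M φ) (tm p f v) = modAct M n p f (φ v) := rfl

lemma freeMod_hom_ext {M : P.Mod} {φ ψ : freeMod P n V ⟶ M}
    (h : ∀ v : V, homAt n φ (tm n (P.perm (Equiv.refl _)) v) =
      homAt n ψ (tm n (P.perm (Equiv.refl _)) v)) : φ = ψ := by
  refine mod_hom_ext fun p => free_ext fun f v => ?_
  have hf : tm p f v = modAct (freeMod P n V) n p f (tm n (P.perm (Equiv.refl _)) v) := by
    rw [modAct_tm, P.id_comp]
  rw [hf, homAt_modAct, homAt_modAct, h v]

/-- By the Yoneda lemma a morphism out of the free module is a linear map from V to the value in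
degree n, and linear maps of vector spaces lift along surjections. -/
instance : Projective (freeMod P n V) where
  factors {E X} f e _ := by
    have hs := homAt_surjective_of_epi e n
    obtain ⟨φ, hφ⟩ := Module.projective_lifting_property (homAt n e)
      (homAt n f ∘ₗ (tm n (P.perm (Equiv.refl _)) : V →ₗ[K] _)) hs
    refine ⟨freeHom E φ, freeMod_hom_ext fun v => ?_⟩
    rw [homAt_comp, homAt_freeHom_tm, modAct_id]
    exact LinearMap.congr_fun hφ v

/-- The kernel of a morphism of modules. -/
def kerMod {M N : P.Mod} (φ : M ⟶ N) : P.Mod :=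
  mkMod (fun p => LinearMap.ker (homAt p φ))
    (fun p q =>
      { toFun := fun f => (modAct M p q f).restrict fun x hx => by
          rw [LinearMap.mem_ker] at hx ⊢
          rw [homAt_modAct, hx, map_zero]
        map_add' := fun f g => by
          ext x
          simp
        map_smul' := fun a f => by
          ext x
          simp })
    (fun p x => Subtype.ext (modAct_id M _))
    (fun p q r f g x => Subtype.ext (modAct_comp M f g _))

/-- The inclusion of the kernel. -/
def kerι {M N : P.Mod} (φ : M ⟶ N) : kerMod φ ⟶ M :=
  mkHom (M := kerMod φ) (fun p => Submodule.subtype (LinearMap.ker (homAt p φ))) fun _ _ _ _ => rfl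

/-- The elements of the kernel. -/
def kerMk {M N : P.Mod} (φ : M ⟶ N) {p : ℕ} (x : M.obj.obj ⟨p⟩) (hx : homAt p φ x = 0) :
    (kerMod φ).obj.obj ⟨p⟩ :=
  (⟨x, hx⟩ : LinearMap.ker (homAt p φ))

lemma kerι_kerMk {M N : P.Mod} (φ : M ⟶ N) {p : ℕ} (x : M.obj.obj ⟨p⟩) (hx : homAt p φ x = 0) :
    homAt p (kerι φ) (kerMk φ x hx) = x := rfl

lemma homAt_kerι {M N : P.Mod} (φ : M ⟶ N) {p : ℕ} (x : (kerMod φ).obj.obj ⟨p⟩) :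
    homAt p φ (homAt p (kerι φ) x) = 0 :=
  Subtype.property (p := fun x => homAt p φ x = 0) x

lemma kerι_injective {M N : P.Mod} (φ : M ⟶ N) {p : ℕ} : Function.Injective (homAt p (kerι φ)) :=
  Subtype.val_injective

lemma exists_kerMk {M N : P.Mod} (φ : M ⟶ N) {p : ℕ} (x : (kerMod φ).obj.obj ⟨p⟩) :
    ∃ y hy, x = kerMk φ y hy := ⟨_, homAt_kerι φ x, rfl⟩

lemma modAct_kerMk {M N : P.Mod} (φ : M ⟶ N) {p q : ℕ} (f : P.Hom p q) (x : M.obj.obj ⟨p⟩) (hx) :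
    modAct (kerMod φ) p q f (kerMk φ x hx) = kerMk φ (modAct M p q f x)
      (by rw [homAt_modAct, hx, map_zero]) := rfl

instance {M N : P.Mod} (φ : M ⟶ N) : Mono (kerι φ) :=
  mono_of_homAt_injective _ fun _ => kerι_injective φ

lemma kerι_comp {M N : P.Mod} (φ : M ⟶ N) : kerι φ ≫ φ = 0 :=
  mod_hom_ext fun _ => LinearMap.ext fun x => homAt_kerι φ x

/-- The kernel of `φ` is a kernel in the categorical sense. -/
def kerIsLimit {M N : P.Mod} (φ : M ⟶ N) :
    Limits.IsLimit (Limits.KernelFork.ofι (kerι φ) (kerι_comp φ)) :=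
  Limits.KernelFork.IsLimit.ofι' _ _ fun {L} ψ hψ =>
    ⟨mkHom (N := kerMod φ) (fun p => (homAt p ψ).codRestrict (LinearMap.ker (homAt p φ)) fun x => by
        rw [LinearMap.mem_ker, ← homAt_comp, hψ]
        rfl) (fun p q f x => Subtype.ext (homAt_modAct ψ f x)), rfl⟩

lemma ker_shortExact {M N : P.Mod} (φ : M ⟶ N) [Epi φ] :
    (ShortComplex.mk (kerι φ) φ (kerι_comp φ)).ShortExact where
  exact := ShortComplex.exact_of_f_is_kernel _ (kerIsLimit φ)
  mono_f := inferInstanceAs (Mono (kerι φ))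
  epi_g := inferInstanceAs (Epi φ)

end Free

/-! ## Words in a presented PROP -/

section Words

variable {G : ℕ → ℕ → Type} {R : ∀ m n : ℕ, Term K G m n → Term K G m n → Prop}

variable (R) in
/-- The class of a formal expression, as a morphism of the presented PROP. -/
def presMk {m n : ℕ} (t : Term K G m n) : (presented R).Hom m n := PresHom.mk R t

lemma presMk_ind {m n : ℕ} {p : (presented R).Hom m n → Prop} (h : ∀ t, p (presMk R t))
    (f : (presented R).Hom m n) : p f := PresHom.ind h f

variable (R) in
/-- A generator tensored with an identity on the left. -/
def padGen {a b : ℕ} (k : ℕ) (x : G a b) : (presented R).Hom (k + a) (k + b) :=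
  (presented R).tensor ((presented R).perm (Equiv.refl (Fin k))) (presMk R (.gen x))

variable (R) in
/-- Composites of permutations and of generators tensored with identities. -/
inductive IsWord : ∀ {m n : ℕ}, (presented R).Hom m n → Prop
  | perm {m n : ℕ} (e : Fin m ≃ Fin n) : IsWord ((presented R).perm e)
  | step {m k a b n : ℕ} (w : (presented R).Hom m (k + a)) (x : G a b) (e : Fin (k + b) ≃ Fin n) :
      IsWord w → IsWord ((presented R).comp ((presented R).comp w (padGen R k x))
        ((presented R).perm e))

lemma IsWord.comp_perm {m n p : ℕ} {f : (presented R).Hom m n} (hf : IsWord R f)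
    (e : Fin n ≃ Fin p) : IsWord R ((presented R).comp f ((presented R).perm e)) := by
  cases hf with
  | perm e' =>
    rw [LinearPROP.perm_comp]
    exact .perm _
  | step w x e' hw =>
    rw [LinearPROP.assoc, LinearPROP.perm_comp]
    exact .step _ _ _ hw

lemma IsWord.comp {m n p : ℕ} {f : (presented R).Hom m n} {g : (presented R).Hom n p}
    (hf : IsWord R f) (hg : IsWord R g) : IsWord R ((presented R).comp f g) := by
  induction hg with
  | perm e => exact hf.comp_perm e
  | step w x e _ ih =>
    rw [← LinearPROP.assoc, ← LinearPROP.assoc]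
    exact .step _ _ _ ih

lemma isWord_padGen {a b : ℕ} (k : ℕ) (x : G a b) : IsWord R (padGen R k x) := by
  have := IsWord.step _ x (Equiv.refl _) (IsWord.perm (R := R) (Equiv.refl (Fin (k + a))))
  rwa [LinearPROP.comp_id, LinearPROP.id_comp] at this

lemma isWord_gen {a b : ℕ} (x : G a b) : IsWord R (presMk R (.gen x)) := by
  have h := (presented R).unit_tensor (presMk R (.gen x))
  have h2 : (presented R).comp ((presented R).perm (finCongr (zero_add a)).symm)
      ((presented R).comp (padGen R 0 x) ((presented R).perm (finCongr (zero_add b)))) =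
        presMk R (.gen x) := by
    rw [padGen, h, ← LinearPROP.assoc, LinearPROP.perm_comp, Equiv.symm_trans_self,
      LinearPROP.id_comp]
  rw [← h2]
  exact (IsWord.perm _).comp ((isWord_padGen 0 x).comp_perm _)

/-- Strict associativity turns id_j ⊗ (id_k ⊗ x) into id_{j+k} ⊗ x up to transport along equalities
of degrees, which are permutations. -/
lemma IsWord.id_tensor {m n : ℕ} {f : (presented R).Hom m n} (hf : IsWord R f) (j : ℕ) :
    IsWord R ((presented R).tensor ((presented R).perm (Equiv.refl (Fin j))) f) := by
  induction hf with
  | perm e =>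
    rw [LinearPROP.perm_tensor]
    exact .perm _
  | @step k a b n w x e _ ih =>
    -- The identity is written as a threefold composite so that interchange distributes it over the
    -- three factors of a word.
    have h1 : (presented R).perm (Equiv.refl (Fin j)) =
        (presented R).comp ((presented R).comp ((presented R).perm (Equiv.refl (Fin j)))
          ((presented R).perm (Equiv.refl (Fin j)))) ((presented R).perm (Equiv.refl (Fin j))) := by
      rw [LinearPROP.comp_id, LinearPROP.comp_id]
    rw [h1, LinearPROP.interchange, LinearPROP.interchange, LinearPROP.perm_tensor]
    refine (ih.comp ?_).comp_perm _
    have h2 := (presented R).tensor_assoc ((presented R).perm (Equiv.refl (Fin j)))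
      ((presented R).perm (Equiv.refl (Fin k))) (presMk R (.gen x))
    have h3 : (presented R).tensor ((presented R).perm (Equiv.refl (Fin j))) (padGen R k x) =
        (presented R).comp ((presented R).perm (finCongr (add_assoc j k a)).symm)
          ((presented R).comp (padGen R (j + k) x)
            ((presented R).perm (finCongr (add_assoc j k b)))) := by
      have hj : juxt (Equiv.refl (Fin j)) (Equiv.refl (Fin k)) = Equiv.refl _ := by simp [juxt]
      rw [LinearPROP.perm_tensor, hj] at h2
      rw [padGen, padGen, h2, ← LinearPROP.assoc, LinearPROP.perm_comp, Equiv.symm_trans_self,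
        LinearPROP.id_comp]
    rw [h3]
    exact (IsWord.perm _).comp ((isWord_padGen _ x).comp_perm _)

/-- The block transposition moves the identity to the other side. -/
lemma IsWord.tensor_id {m n : ℕ} {f : (presented R).Hom m n} (hf : IsWord R f) (j : ℕ) :
    IsWord R ((presented R).tensor f ((presented R).perm (Equiv.refl (Fin j)))) := by
  have h := (presented R).symmetry f ((presented R).perm (Equiv.refl (Fin j)))
  have h2 : (presented R).tensor f ((presented R).perm (Equiv.refl (Fin j))) =
      (presented R).comp ((presented R).comp ((presented R).perm finAddFlip)
        ((presented R).tensor ((presented R).perm (Equiv.refl (Fin j))) f))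
        ((presented R).perm finAddFlip.symm) := by
    rw [← h, LinearPROP.assoc, LinearPROP.perm_comp, Equiv.self_trans_symm, LinearPROP.comp_id]
  rw [h2]
  exact ((IsWord.perm _).comp (hf.id_tensor j)).comp_perm _

lemma IsWord.tensor {m n m' n' : ℕ} {f : (presented R).Hom m n} {g : (presented R).Hom m' n'}
    (hf : IsWord R f) (hg : IsWord R g) : IsWord R ((presented R).tensor f g) := by
  have h : (presented R).tensor f g =
      (presented R).comp ((presented R).tensor f ((presented R).perm (Equiv.refl _)))
        ((presented R).tensor ((presented R).perm (Equiv.refl _)) g) := by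
    rw [← LinearPROP.interchange, LinearPROP.comp_id, LinearPROP.id_comp]
  rw [h]
  exact (hf.tensor_id _).comp (hg.id_tensor _)

/-- The morphisms of a presented PROP are linear combinations of words. -/
lemma mem_span_isWord {m n : ℕ} (f : (presented R).Hom m n) :
    f ∈ Submodule.span K {g : (presented R).Hom m n | IsWord R g} := by
  induction f using presMk_ind with | h t => ?_
  induction t with
  | gen x => exact Submodule.subset_span (isWord_gen x)
  | perm e => exact Submodule.subset_span (.perm e)
  | comp f g hf hg =>
    exact LinearMap.BilinMap.apply_apply_mem_of_mem_span _ _ _ (presented R).comp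
      (fun a ha b hb => Submodule.subset_span (IsWord.comp ha hb)) _ _ hf hg
  | tensor f g hf hg =>
    exact LinearMap.BilinMap.apply_apply_mem_of_mem_span _ _ _ (presented R).tensor
      (fun a ha b hb => Submodule.subset_span (IsWord.tensor ha hb)) _ _ hf hg
  | zero => exact Submodule.zero_mem _
  | add f g hf hg => exact Submodule.add_mem _ hf hg
  | smul a f hf => exact Submodule.smul_mem _ a hf

/-- Morphisms out of a presented PROP are determined by the images of the generators. -/
lemma presented_hom_ext {Q : LinearPROP K} (φ ψ : PROPHom (presented R) Q)
    (h : ∀ {a b : ℕ} (x : G a b), φ.map (presMk R (.gen x)) = ψ.map (presMk R (.gen x)))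
    {m n : ℕ} (f : (presented R).Hom m n) : φ.map f = ψ.map f := by
  induction f using presMk_ind with | h t => ?_
  induction t with
  | gen x => exact h x
  | perm e => exact (φ.map_perm e).trans (ψ.map_perm e).symm
  | comp f g hf hg =>
    exact (φ.map_comp (presMk R f) (presMk R g)).trans
      ((by rw [hf, hg] : _ = _).trans (ψ.map_comp (presMk R f) (presMk R g)).symm)
  | tensor f g hf hg =>
    exact (φ.map_tensor (presMk R f) (presMk R g)).trans
      ((by rw [hf, hg] : _ = _).trans (ψ.map_tensor (presMk R f) (presMk R g)).symm)
  | zero => exact (map_zero φ.map).trans (map_zero ψ.map).symm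
  | add f g hf hg =>
    exact (map_add φ.map (presMk R f) (presMk R g)).trans
      ((by rw [hf, hg] : _ = _).trans (map_add ψ.map (presMk R f) (presMk R g)).symm)
  | smul a f hf =>
    exact (map_smul φ.map a (presMk R f)).trans
      ((by rw [hf] : _ = _).trans (map_smul ψ.map a (presMk R f)).symm)

end Words

/-- The composition of morphisms of PROPs. -/
def PROPHom.comp {P Q S : LinearPROP K} (φ : PROPHom P Q) (ψ : PROPHom Q S) : PROPHom P S where
  map := ψ.map ∘ₗ φ.map
  map_perm e := by simp [φ.map_perm, ψ.map_perm]
  map_comp f g := by simp [φ.map_comp, ψ.map_comp]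
  map_tensor f g := by simp [φ.map_tensor, ψ.map_tensor]

/-! ## The PROP of matrices -/

section MatrixPROP

variable {X : Type} [Fintype X] [DecidableEq X] {A : Type u} [CommRing A] [Algebra K A]

variable (X A) in
/-- The matrix of a bijection, acting on tensor powers by permutation of the factors. -/
def permMat {m n : ℕ} (e : Fin m ≃ Fin n) : Matrix (Fin m → X) (Fin n → X) A :=
  fun x y => if x = y ∘ e then 1 else 0

lemma mul_permMat {m n p : ℕ} (M : Matrix (Fin m → X) (Fin n → X) A) (e : Fin n ≃ Fin p)
    (x : Fin m → X) (y : Fin p → X) : (M * permMat X A e) x y = M x (y ∘ e) := by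
  simp [Matrix.mul_apply, permMat]

lemma permMat_mul {m n p : ℕ} (M : Matrix (Fin n → X) (Fin p → X) A) (e : Fin m ≃ Fin n)
    (x : Fin m → X) (y : Fin p → X) : (permMat X A e * M) x y = M (x ∘ e.symm) y := by
  have h (z : Fin n → X) : x = z ∘ e ↔ z = x ∘ e.symm := by
    rw [← Equiv.comp_symm_eq, eq_comm]
  simp [Matrix.mul_apply, permMat, h]

/-- The external product of matrices. -/
def tensorMat {m n m' n' : ℕ} (M : Matrix (Fin m → X) (Fin n → X) A)
    (N : Matrix (Fin m' → X) (Fin n' → X) A) :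
    Matrix (Fin (m + m') → X) (Fin (n + n') → X) A :=
  fun x y => M (x ∘ Fin.castAdd m') (y ∘ Fin.castAdd n') * N (x ∘ Fin.natAdd m) (y ∘ Fin.natAdd n)

lemma tensorMat_mul {m n p m' n' p' : ℕ} (f : Matrix (Fin m → X) (Fin n → X) A)
    (g : Matrix (Fin n → X) (Fin p → X) A) (f' : Matrix (Fin m' → X) (Fin n' → X) A)
    (g' : Matrix (Fin n' → X) (Fin p' → X) A) :
    tensorMat (f * g) (f' * g') = tensorMat f f' * tensorMat g g' := by
  ext x y
  simp only [tensorMat, Matrix.mul_apply]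
  rw [← (Fin.appendEquiv n n').sum_comp, Fintype.sum_prod_type, Finset.sum_mul_sum]
  refine Finset.sum_congr rfl fun z _ => Finset.sum_congr rfl fun z' _ => ?_
  have h1 : Fin.appendEquiv n n' (z, z') ∘ Fin.castAdd n' = z := by
    ext i
    simp [Fin.appendEquiv]
  have h2 : Fin.appendEquiv n n' (z, z') ∘ Fin.natAdd n = z' := by
    ext i
    simp [Fin.appendEquiv]
  rw [h1, h2]
  ring

lemma tensorMat_permMat {m n m' n' : ℕ} (e : Fin m ≃ Fin n) (e' : Fin m' ≃ Fin n') :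
    tensorMat (permMat X A e) (permMat X A e') = permMat X A (juxt e e') := by
  ext x y
  simp only [tensorMat, permMat, ← ite_and, mul_ite, mul_one, mul_zero]
  congr 1
  simp only [eq_iff_iff, funext_iff, Function.comp_apply]
  constructor
  · rintro ⟨h1, h2⟩ i
    induction i using Fin.addCases with
    | left i => rw [h2, juxt_castAdd]
    | right i => rw [h1, juxt_natAdd]
  · intro h
    exact ⟨fun i => by rw [h, juxt_natAdd], fun i => by rw [h, juxt_castAdd]⟩

lemma permMat_zero (x y : Fin 0 → X) : permMat X A (Equiv.refl (Fin 0)) x y = 1 :=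
  if_pos (Subsingleton.elim _ _)

variable (K X A) in
/-- The PROP of matrices indexed by the powers of a finite set, with entries in an algebra. -/
def matPROP : LinearPROP K where
  Hom m n := Matrix (Fin m → X) (Fin n → X) A
  perm e := permMat X A e
  comp := LinearMap.mk₂ K (fun f g => f * g) Matrix.add_mul Matrix.smul_mul Matrix.mul_add
    (fun a f g => Matrix.mul_smul f a g)
  tensor := LinearMap.mk₂ K tensorMat
    (fun f f' g => by ext x y; simp [tensorMat, add_mul])
    (fun a f g => by ext x y; simp [tensorMat])
    (fun f g g' => by ext x y; simp [tensorMat, mul_add])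
    (fun a f g => by ext x y; simp [tensorMat])
  id_comp f := by ext x y; exact permMat_mul f _ x y
  comp_id f := by ext x y; exact mul_permMat f _ x y
  assoc f g h := Matrix.mul_assoc f g h
  perm_comp e e' := by ext x y; exact mul_permMat _ e' x y
  perm_tensor e e' := tensorMat_permMat e e'
  interchange f g f' g' := tensorMat_mul f g f' g'
  tensor_assoc f g h := by
    ext x y
    refine (mul_permMat _ _ x y).trans (Eq.trans ?_ (permMat_mul _ _ x y).symm)
    refine (mul_assoc _ _ _).trans ?_
    congr 1
    congr 1
    simp only [Function.comp_assoc]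
    congr 1 <;> congr 1 <;> funext i <;> ext <;> simp [add_assoc]
  unit_tensor f := by
    ext x y
    refine (mul_permMat _ _ x y).trans (Eq.trans ?_ (permMat_mul _ _ x y).symm)
    change permMat X A (Equiv.refl (Fin 0)) _ _ * f _ _ = _
    rw [permMat_zero, one_mul]
    congr 1
    · funext i; exact congrArg x (by ext; simp)
    · funext i; exact congrArg y (by ext; simp)
  tensor_unit f := by
    ext x y
    refine (mul_permMat _ _ x y).trans (Eq.trans ?_ (permMat_mul _ _ x y).symm)
    change f _ _ * permMat X A (Equiv.refl (Fin 0)) _ _ = _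
    rw [permMat_zero, mul_one]
    rfl
  symmetry {m n m' n'} f g := by
    ext x y
    refine (mul_permMat _ _ x y).trans (Eq.trans ?_ (permMat_mul _ _ x y).symm)
    refine (mul_comm _ _).trans ?_
    have h1 (i : Fin m') : finAddFlip.symm (Fin.castAdd m i) = Fin.natAdd m i := by
      rw [Equiv.symm_apply_eq, finAddFlip_apply_natAdd]
    have h2 (i : Fin m) : finAddFlip.symm (Fin.natAdd m' i) = Fin.castAdd m' i := by
      rw [Equiv.symm_apply_eq, finAddFlip_apply_castAdd]
    congr 1 <;> congr 1 <;> funext i <;> simp [h1, h2]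

end MatrixPROP

/-! ## Representations of finite groups -/

section Isotypic

variable {Γ H : Type} [Group Γ] [Group H] {U : Type u} [AddCommGroup U] [Module K U]

/-- The subspace on which a subgroup acts through a given character. -/
def isotypic (ρ : Representation K Γ U) (ι : H →* Γ) (χ : H →* K) : Submodule K U where
  carrier := {u | ∀ h, ρ (ι h) u = χ h • u}
  add_mem' hu hv h := by rw [map_add, hu h, hv h, smul_add]
  zero_mem' h := by rw [map_zero, smul_zero]
  smul_mem' a u hu h := by rw [map_smul, hu h, smul_comm]

lemma mem_isotypic {ρ : Representation K Γ U} {ι : H →* Γ} {χ : H →* K} {u : U} :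
    u ∈ isotypic ρ ι χ ↔ ∀ h, ρ (ι h) u = χ h • u := Iff.rfl

/-- A representation restricted along a homomorphism and twisted by the inverse of a character. -/
def twist (ρ : Representation K Γ U) (ι : H →* Γ) (χ : H →* K) : Representation K H U where
  toFun h := χ h⁻¹ • ρ (ι h)
  map_one' := by simp
  map_mul' g h := by
    rw [map_mul, map_mul, mul_inv_rev, map_mul, smul_mul_smul_comm, mul_comm (χ h⁻¹)]

lemma char_mul_inv (χ : H →* K) (h : H) : χ h * χ h⁻¹ = 1 := by
  rw [← map_mul, mul_inv_cancel, map_one]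

lemma isotypic_eq_invariants (ρ : Representation K Γ U) (ι : H →* Γ) (χ : H →* K) :
    isotypic ρ ι χ = (twist ρ ι χ).invariants := by
  ext u
  refine forall_congr' fun h => ?_
  change _ ↔ χ h⁻¹ • ρ (ι h) u = u
  constructor
  · intro hu
    rw [hu, smul_smul, mul_comm, char_mul_inv, one_smul]
  · intro hu
    conv_rhs => rw [← hu]
    rw [smul_smul, char_mul_inv, one_smul]

/-- The isotypic part is the space of invariants of the twisted representation, whose dimension is
the average of the character. The group order stays on the left so that dimensions can later be
compared by cancellation. -/
lemma card_mul_finrank_isotypic [CharZero K] [FiniteDimensional K U] [Fintype H]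
    (ρ : Representation K Γ U) (ι : H →* Γ) (χ : H →* K) :
    (Fintype.card H : K) * Module.finrank K (isotypic ρ ι χ) =
      ∑ h, χ h⁻¹ * ρ.character (ι h) := by
  have hc : (Nat.card H : K) ≠ 0 := by simp
  let : Invertible (Nat.card H : K) := invertibleOfNonzero hc
  have h := (twist ρ ι χ).card_inv_mul_sum_char_eq_finrank
  rw [isotypic_eq_invariants, ← h, ← Nat.card_eq_fintype_card, mul_inv_cancel_left₀ hc]
  refine Finset.sum_congr rfl fun h _ => ?_
  simp [Representation.character, twist]

end Isotypic

/-! ### Characters and dimensions of spaces of equivariant maps -/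

section Characters

variable {G : Type} [Group G] [Fintype G] [CharZero K] {V W : Type u} [AddCommGroup V] [Module K V]
  [FiniteDimensional K V] [AddCommGroup W] [Module K W] [FiniteDimensional K W]

lemma card_mul_finrank_intertwiningMap (ρ : Representation K G V) (σ : Representation K G W) :
    (Fintype.card G : K) * Module.finrank K (ρ.IntertwiningMap σ) =
      ∑ g, σ.character g * ρ.character g⁻¹ := by
  have hc : (Nat.card G : K) ≠ 0 := by simp
  let : Invertible (Nat.card G : K) := invertibleOfNonzero hc
  rw [← Representation.card_inv_mul_sum_char_mul_char_eq_finrank, ← Nat.card_eq_fintype_card,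
    mul_inv_cancel_left₀ hc]

/-- The substitution g ↦ g⁻¹ exchanges the two character sums. -/
lemma finrank_intertwiningMap_symm (ρ : Representation K G V) (σ : Representation K G W) :
    Module.finrank K (ρ.IntertwiningMap σ) = Module.finrank K (σ.IntertwiningMap ρ) := by
  have hc : (Fintype.card G : K) ≠ 0 := by simp
  have h : (Fintype.card G : K) * Module.finrank K (ρ.IntertwiningMap σ) =
      (Fintype.card G : K) * Module.finrank K (σ.IntertwiningMap ρ) := by
    rw [card_mul_finrank_intertwiningMap, card_mul_finrank_intertwiningMap,
      ← Equiv.sum_comp (Equiv.inv G)]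
    simp [mul_comm]
  exact_mod_cast mul_left_cancel₀ hc h

/-- A permutation and its inverse have the same cycle type. This makes passage to duals invisible to
characters, and so lets Hom(V, W) be compared with the dual of W ⊗ V. -/
lemma char_perm_inv {n : ℕ} (ρ : Representation K (Equiv.Perm (Fin n)) V)
    (g : Equiv.Perm (Fin n)) : ρ.character g⁻¹ = ρ.character g := by
  have h : IsConj g g⁻¹ := by
    rw [Equiv.Perm.isConj_iff_cycleType_eq, Equiv.Perm.cycleType_inv]
  obtain ⟨c, hc⟩ := isConj_iff.1 h
  rw [← hc, Representation.char_conj]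

end Characters

/-! ## Frobenius reciprocity -/

section Frobenius

variable {G H : Type} [Group G] [Group H] {V W : Type u} [AddCommGroup V] [Module K V]
  [AddCommGroup W] [Module K W]

open Representation in
/-- Frobenius reciprocity for the induced representation. -/
def frobenius (φ : G →* H) (ρ : Representation K G V) (σ : Representation K H W) :
    IntertwiningMap (ind φ ρ) σ ≃ₗ[K] IntertwiningMap ρ (σ.comp φ) :=
  (Rep.homLinearEquiv (Rep.of (ind φ ρ)) (Rep.of σ)).symm ≪≫ₗ
    (Rep.indResHomEquiv φ (Rep.of ρ) (Rep.of σ)) ≪≫ₗ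
      Rep.homLinearEquiv (Rep.of ρ) (Rep.of (σ.comp φ))

-- Reciprocity describes maps out of the induced representation, while multiplicities are defined by
-- maps into it; symmetry of the dimension reconciles the two.
open Representation in
lemma finrank_intertwiningMap_ind [Fintype G] [Fintype H] [CharZero K] [FiniteDimensional K V]
    [FiniteDimensional K W] (φ : G →* H) (ρ : Representation K G V) (σ : Representation K H W) :
    (Fintype.card G : K) * Module.finrank K (IntertwiningMap σ (ind φ ρ)) =
      ∑ g, σ.character (φ g) * ρ.character g⁻¹ := by
  have : Module.Finite K (MonoidAlgebra K H) :=
    Module.Finite.equiv (MonoidAlgebra.coeffLinearEquiv K).symm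
  rw [finrank_intertwiningMap_symm, (frobenius φ ρ σ).finrank_eq,
    card_mul_finrank_intertwiningMap]
  rfl

end Frobenius

/-! ## Cyclic representations -/

section Cyclic

variable {Γ H : Type} [Group Γ] [Group H] {B U : Type u} [AddCommGroup B] [Module K B]
  [AddCommGroup U] [Module K U]

/-- A vector of a representation on which a subgroup acts by a character, and which is detected by
a linear form vanishing on the translates of the vector by the other elements of the group. -/
structure Detected (L : Representation K Γ B) (ι : H →* Γ) (χ : H →* K) (b : B) (ℓ : B →ₗ[K] K) :
    Prop where
  injective : Function.Injective ι
  mem : b ∈ isotypic L ι χ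
  self : ℓ b = 1
  off : ∀ γ, γ ∉ Set.range ι → ℓ (L γ b) = 0

variable [Fintype Γ] (L : Representation K Γ B) (ρ : Representation K Γ U)

/-- The equivariant map determined by averaging a linear form. -/
def averaged (ℓ : B →ₗ[K] K) (u : U) : Representation.IntertwiningMap L ρ where
  toLinearMap := ∑ γ, (LinearMap.toSpanSingleton K U (ρ γ⁻¹ u)) ∘ₗ ℓ ∘ₗ L γ
  isIntertwining' g := by
    ext x
    simp only [LinearMap.comp_apply, LinearMap.sum_apply, LinearMap.toSpanSingleton_apply, map_sum,
      map_smul]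
    rw [← Equiv.sum_comp (Equiv.mulRight g⁻¹)]
    refine Finset.sum_congr rfl fun γ _ => ?_
    simp [← Module.End.mul_apply, ← map_mul]

lemma averaged_apply (ℓ : B →ₗ[K] K) (u : U) (x : B) :
    averaged L ρ ℓ u x = ∑ γ, ℓ (L γ x) • ρ γ⁻¹ u := by
  change (∑ γ, (LinearMap.toSpanSingleton K U (ρ γ⁻¹ u)) ∘ₗ ℓ ∘ₗ L γ) x = _
  simp [LinearMap.sum_apply]

/-- Terms outside the subgroup vanish by the choice of `ℓ`. Inside it the scalar χ(h) coming from b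
cancels the scalar χ(h⁻¹) coming from u, so each term equals u. -/
lemma averaged_detected [Fintype H] {ι : H →* Γ} {χ : H →* K} {b : B} {ℓ : B →ₗ[K] K}
    (h : Detected L ι χ b ℓ) {u : U} (hu : u ∈ isotypic ρ ι χ) :
    averaged L ρ ℓ u b = (Fintype.card H : K) • u := by
  classical
  have h1 (x : H) : ℓ (L (ι x) b) • ρ (ι x)⁻¹ u = u := by
    rw [h.mem x, map_smul, h.self, ← map_inv, hu, smul_smul, smul_eq_mul, mul_one, char_mul_inv,
      one_smul]
  rw [averaged_apply, ← Finset.sum_subset (Finset.subset_univ (Finset.univ.image ι)),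
    Finset.sum_image h.injective.injOn]
  · simp [h1, Nat.cast_smul_eq_nsmul]
  · intro γ _ hγ
    rw [h.off γ (by simpa using hγ), zero_smul]

variable {L} in
/-- The value of an equivariant map at a vector on which a subgroup acts by a character. -/
def evalAt {ι : H →* Γ} {χ : H →* K} {b : B} (hb : b ∈ isotypic L ι χ) :
    Representation.IntertwiningMap L ρ →ₗ[K] isotypic ρ ι χ where
  toFun f := ⟨f b, fun x => by
    rw [← Representation.IntertwiningMap.isIntertwining, hb x, map_smul]⟩
  map_add' _ _ := rfl
  map_smul' _ _ := rfl

/-- The averaged form takes b to a nonzero multiple of any prescribed isotypic vector. The linear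
form replaces an explicit basis of the cyclic representation. -/
lemma evalAt_surjective [Fintype H] [CharZero K] {ι : H →* Γ} {χ : H →* K} {b : B}
    {ℓ : B →ₗ[K] K} (h : Detected L ι χ b ℓ) : Function.Surjective (evalAt ρ h.mem) := by
  rintro ⟨u, hu⟩
  refine ⟨(Fintype.card H : K)⁻¹ • averaged L ρ ℓ u, Subtype.ext ?_⟩
  change (Fintype.card H : K)⁻¹ • averaged L ρ ℓ u b = u
  rw [averaged_detected L ρ h hu, smul_smul, inv_mul_cancel₀ (by simp), one_smul]

lemma evalAt_injective {ι : H →* Γ} {χ : H →* K} {b : B} (hb : b ∈ isotypic L ι χ)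
    (hspan : Submodule.span K (Set.range fun γ => L γ b) = ⊤) :
    Function.Injective (evalAt ρ hb) := by
  rw [injective_iff_map_eq_zero]
  intro f hf
  have hf' : f b = 0 := Subtype.ext_iff.1 hf
  apply Representation.IntertwiningMap.ext
  refine LinearMap.ext_on_range hspan fun γ => ?_
  change f (L γ b) = 0
  rw [Representation.IntertwiningMap.isIntertwining, hf', map_zero]

/-- Equivariant maps out of a cyclic representation are determined by the image of the generator. -/
def cyclicEquiv [Fintype H] [CharZero K] {ι : H →* Γ} {χ : H →* K} {b : B} {ℓ : B →ₗ[K] K}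
    (h : Detected L ι χ b ℓ) (hspan : Submodule.span K (Set.range fun γ => L γ b) = ⊤) :
    Representation.IntertwiningMap L ρ ≃ₗ[K] isotypic ρ ι χ :=
  LinearEquiv.ofBijective (evalAt ρ h.mem)
    ⟨evalAt_injective L ρ h.mem hspan, evalAt_surjective L ρ h⟩

end Cyclic

/-! ## The PROP of permutations is initial -/

lemma sym_hom_ext {m n : ℕ} {W : Type*} [AddCommGroup W] [Module K W]
    {φ ψ : (symPROP K).Hom m n →ₗ[K] W}
    (h : ∀ e : Fin m ≃ Fin n, φ ((symPROP K).perm e) = ψ ((symPROP K).perm e)) : φ = ψ :=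
  Finsupp.lhom_ext' (M := K) fun e => LinearMap.ext_ring (h e)

/-- The linear extension of the symmetry of a PROP. -/
def LinearPROP.permLin (P : LinearPROP K) (m n : ℕ) : (symPROP K).Hom m n →ₗ[K] P.Hom m n :=
  Finsupp.linearCombination K P.perm

lemma LinearPROP.permLin_perm (P : LinearPROP K) {m n : ℕ} (e : Fin m ≃ Fin n) :
    P.permLin m n ((symPROP K).perm e) = P.perm e :=
  (Finsupp.linearCombination_single K (1 : K) e).trans (one_smul K _)

/-- The morphism from the PROP of permutations to another PROP. -/
def unitHom (P : LinearPROP K) : PROPHom (symPROP K) P where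
  map := P.permLin _ _
  map_perm e := P.permLin_perm e
  map_comp {m n p} f g := by
    refine LinearMap.congr_fun₂ (f := (symPROP K).comp.compr₂ (P.permLin m p))
      (g := P.comp.compl₁₂ (P.permLin m n) (P.permLin n p))
      (sym_hom_ext fun e => sym_hom_ext fun e' => ?_) f g
    simp only [LinearMap.compr₂_apply, LinearMap.compl₁₂_apply, LinearPROP.permLin_perm,
      LinearPROP.perm_comp]
  map_tensor {m n m' n'} f g := by
    refine LinearMap.congr_fun₂ (f := (symPROP K).tensor.compr₂ (P.permLin (m + m') (n + n')))
      (g := P.tensor.compl₁₂ (P.permLin m n) (P.permLin m' n'))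
      (sym_hom_ext fun e => sym_hom_ext fun e' => ?_) f g
    simp only [LinearMap.compr₂_apply, LinearMap.compl₁₂_apply, LinearPROP.permLin_perm,
      LinearPROP.perm_tensor]

/-! ## The augmentation of the PROP for Casimir Lie algebras -/

variable (K) in
/-- The projection of the PROP for Casimir Lie algebras onto the PROP of permutations. -/
def aug : PROPHom (catLieC K) (symPROP K) := (projLie K).comp (lieToSym K)

variable (K) in
/-- The relations of the PROP for Casimir Lie algebras. -/
abbrev casimirRel : ∀ m n : ℕ, Term K CasimirGen m n → Term K CasimirGen m n → Prop :=
  fun m n f g => IsLieRel (K := K) (.gen CasimirGen.bracket) m n f g ∨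
      IsCasimirRel (K := K) (.gen CasimirGen.bracket) (.gen CasimirGen.casimir) m n f g

variable (K) in
/-- The generators of the PROP for Casimir Lie algebras. -/
def casGen {a b : ℕ} (x : CasimirGen a b) : (catLieC K).Hom a b := presMk (casimirRel K) (.gen x)

lemma aug_casGen {a b : ℕ} (x : CasimirGen a b) : (aug K).map (casGen K x) = 0 := by
  cases x <;> rfl

variable (K) in
/-- A generator of the PROP for Casimir Lie algebras tensored with an identity. -/
def casPad {a b : ℕ} (k : ℕ) (x : CasimirGen a b) : (catLieC K).Hom (k + a) (k + b) :=
  (catLieC K).tensor ((catLieC K).perm (Equiv.refl (Fin k))) (casGen K x)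

lemma aug_casPad {a b : ℕ} (k : ℕ) (x : CasimirGen a b) : (aug K).map (casPad K k x) = 0 := by
  rw [casPad, (aug K).map_tensor, aug_casGen, map_zero]

lemma aug_unitHom {m n : ℕ} (f : (symPROP K).Hom m n) :
    (aug K).map ((unitHom (catLieC K)).map f) = f := by
  refine LinearMap.congr_fun (f := (aug K).map ∘ₗ (unitHom (catLieC K)).map)
    (g := LinearMap.id) (sym_hom_ext fun e => ?_) f
  rw [LinearMap.comp_apply, PROPHom.map_perm, PROPHom.map_perm, LinearMap.id_apply]

/-- There are no permutations between different degrees, so every degree-changing morphism lies in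
the augmentation ideal. -/
lemma aug_eq_zero_of_ne {m n : ℕ} (h : m ≠ n) (f : (catLieC K).Hom m n) : (aug K).map f = 0 := by
  have : IsEmpty (Fin m ≃ Fin n) := ⟨fun e => h (Fin.equiv_iff_eq.1 ⟨e⟩)⟩
  exact Subsingleton.elim (α := (Fin m ≃ Fin n) →₀ K) _ _

/-! ## Representations on spaces of morphisms -/

section Bimodule

open MulOpposite

variable {G H : Type} [Group G] [Group H] {B : Type u} [AddCommGroup B] [Module K B]

/-- The representation of a product of groups on a bimodule. -/
def bimodRep (L : Representation K G B) (R : Representation K Hᵐᵒᵖ B)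
    (hLR : ∀ g h b, L g (R h b) = R h (L g b)) : Representation K (G × H) B where
  toFun x := L x.1 ∘ₗ R (op x.2⁻¹)
  map_one' := by ext; simp
  map_mul' x y := by
    ext b
    simp [← hLR]

lemma bimodRep_apply (L : Representation K G B) (R : Representation K Hᵐᵒᵖ B)
    (hLR : ∀ g h b, L g (R h b) = R h (L g b)) (x : G × H) (b : B) :
    bimodRep L R hLR x b = L x.1 (R (op x.2⁻¹) b) := rfl

/-- The representation of a product of symmetric groups on the morphisms of a PROP. -/
def LinearPROP.homRep (P : LinearPROP K) (n m : ℕ) :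
    Representation K (Equiv.Perm (Fin m) × Equiv.Perm (Fin n)) (P.Hom n m) :=
  bimodRep (P.leftAct n m) (P.rightAct n m) fun g h b => by
    change P.comp (P.comp (P.perm h.unop) b) (P.perm g) = _
    rw [P.assoc]
    rfl

lemma LinearPROP.homRep_apply (P : LinearPROP K) {n m : ℕ}
    (x : Equiv.Perm (Fin m) × Equiv.Perm (Fin n)) (f : P.Hom n m) :
    P.homRep n m x f = P.comp (P.comp (P.perm x.2⁻¹) f) (P.perm x.1) := rfl

end Bimodule

/-! ## The stabilizer of a generator -/

section Stabilizer

open Equiv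

/-- The subgroup of pairs of permutations fixing, up to sign, a generator tensored with the
identity of `k`. -/
def stabHom (k a b : ℕ) :
    Perm (Fin k) × Perm (Fin a) × Perm (Fin b) →* Perm (Fin (k + b)) × Perm (Fin (k + a)) :=
  ((youngSubgroup rfl).comp ((MonoidHom.fst _ _).prod
    ((MonoidHom.snd _ _).comp (MonoidHom.snd _ _)))).prod
    ((youngSubgroup rfl).comp ((MonoidHom.fst _ _).prod
      ((MonoidHom.fst _ _).comp (MonoidHom.snd _ _))))

lemma stabHom_apply {k a b : ℕ} (x : Perm (Fin k) × Perm (Fin a) × Perm (Fin b)) :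
    stabHom k a b x = (juxt x.1 x.2.2, juxt x.1 x.2.1) := rfl

variable (K) in
/-- The sign of the permutation of the source of the generator. -/
def stabChar (k a b : ℕ) : Perm (Fin k) × Perm (Fin a) × Perm (Fin b) →* K :=
  ((Int.castRingHom K : ℤ →* K).comp ((Units.coeHom ℤ).comp Perm.sign)).comp
    ((MonoidHom.fst _ _).comp (MonoidHom.snd _ _))

lemma stabChar_apply {k a b : ℕ} (x : Perm (Fin k) × Perm (Fin a) × Perm (Fin b)) :
    stabChar K k a b x = ((Perm.sign x.2.1 : ℤ) : K) := rfl

lemma juxt_inv {k a : ℕ} (σ : Perm (Fin k)) (α : Perm (Fin a)) :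
    (juxt σ α : Perm (Fin (k + a)))⁻¹ = juxt σ⁻¹ α⁻¹ := rfl

lemma juxt_injective {k a : ℕ} {σ σ' : Perm (Fin k)} {α α' : Perm (Fin a)}
    (h : juxt σ α = juxt σ' α') : σ = σ' ∧ α = α' := by
  constructor
  · ext i
    have := Equiv.congr_fun h (Fin.castAdd a i)
    rw [juxt_castAdd, juxt_castAdd] at this
    exact congrArg Fin.val (Fin.castAdd_injective _ _ this)
  · ext i
    have := Equiv.congr_fun h (Fin.natAdd k i)
    rw [juxt_natAdd, juxt_natAdd] at this
    exact congrArg Fin.val (Fin.natAdd_injective _ _ this)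

lemma stabHom_injective (k a b : ℕ) : Function.Injective (stabHom k a b) := by
  rintro ⟨σ, α, β⟩ ⟨σ', α', β'⟩ h
  obtain ⟨h1, h2⟩ := Prod.ext_iff.1 h
  obtain ⟨rfl, rfl⟩ := juxt_injective h1
  obtain ⟨_, rfl⟩ := juxt_injective h2
  rfl

/-- An injective self-map of the finite second block is onto, so the first block has nowhere to go
but to itself. -/
lemma exists_juxt {k a : ℕ} (s : Perm (Fin (k + a)))
    (h : ∀ i, ∃ j, s (Fin.natAdd k i) = Fin.natAdd k j) : ∃ σ α, s = juxt σ α := by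
  let s' : Perm (Fin k ⊕ Fin a) := finSumFinEquiv.trans (s.trans finSumFinEquiv.symm)
  have hs : s = finSumFinEquiv.symm.trans (s'.trans finSumFinEquiv) := by
    ext x
    simp [s']
  have h1 (i : Fin a) : ∃ j, s' (Sum.inr i) = Sum.inr j := by
    obtain ⟨j, hj⟩ := h i
    exact ⟨j, by simp [s', hj]⟩
  choose α hα using h1
  have hinj : Function.Injective α := fun i j hij => by
    have : s' (Sum.inr i) = s' (Sum.inr j) := by rw [hα, hα, hij]
    simpa using this
  have hsurj := Finite.surjective_of_injective hinj
  have h2 : s' ∈ (Perm.sumCongrHom (Fin k) (Fin a)).range := by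
    apply Perm.mem_sumCongrHom_range_of_perm_mapsTo_inl
    rintro _ ⟨i, rfl⟩
    rcases hi : s' (Sum.inl i) with j | j
    · exact ⟨j, rfl⟩
    · obtain ⟨i', rfl⟩ := hsurj j
      rw [← hα, EmbeddingLike.apply_eq_iff_eq] at hi
      cases hi
  obtain ⟨⟨σ, α'⟩, h3⟩ := h2
  refine ⟨σ, α', ?_⟩
  rw [hs, ← h3]
  rfl

end Stabilizer

/-! ## Infinitesimal deformations of the PROP of matrices -/

section Infinitesimal

open Equiv TrivSqZeroExt

variable {X : Type} [Fintype X] [DecidableEq X]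

variable (K X) in
/-- The reduction of the infinitesimal parameter. -/
def reduceHom : PROPHom (matPROP K X (DualNumber K)) (matPROP K X K) where
  map {m n} := ((TrivSqZeroExt.fstHom K K K).toLinearMap).mapMatrix
  map_perm e := Matrix.ext fun x y => by
    change TrivSqZeroExt.fst (permMat X (DualNumber K) e x y) = permMat X K e x y
    simp only [permMat]
    split_ifs <;> simp
  map_comp f g := Matrix.map_mul (f := (TrivSqZeroExt.fstHom K K K))
  map_tensor f g := Matrix.ext fun x y => TrivSqZeroExt.fst_mul _ _

/-- A matrix multiplied by the infinitesimal parameter. -/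
def epsMat {m n : ℕ} (M : Matrix (Fin m → X) (Fin n → X) K) :
    (matPROP K X (DualNumber K)).Hom m n :=
  fun x y => TrivSqZeroExt.inr (M x y)

lemma reduceHom_epsMat {m n : ℕ} (M : Matrix (Fin m → X) (Fin n → X) K) :
    (reduceHom K X).map (epsMat M) = 0 := rfl

/-- Both factors have entries in the ideal (ε), and ε² = 0. -/
lemma comp_eq_zero_of_reduce {m n p : ℕ} {f : (matPROP K X (DualNumber K)).Hom m n}
    {g : (matPROP K X (DualNumber K)).Hom n p} (hf : (reduceHom K X).map f = 0)
    (hg : (reduceHom K X).map g = 0) : (matPROP K X (DualNumber K)).comp f g = 0 := by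
  refine Matrix.ext fun x y => ?_
  change ∑ z, f x z * g z y = 0
  refine Finset.sum_eq_zero fun z _ => ?_
  have h1 : TrivSqZeroExt.fst (f x z) = 0 := congrFun (congrFun hf x) z
  have h2 : TrivSqZeroExt.fst (g z y) = 0 := congrFun (congrFun hg z) y
  ext <;> simp [h1, h2]

lemma reduce_tensor_left {m n m' n' : ℕ} {f : (matPROP K X (DualNumber K)).Hom m n}
    (hf : (reduceHom K X).map f = 0) (g : (matPROP K X (DualNumber K)).Hom m' n') :
    (reduceHom K X).map ((matPROP K X (DualNumber K)).tensor f g) = 0 := by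
  rw [PROPHom.map_tensor, hf, map_zero, LinearMap.zero_apply]

lemma reduce_tensor_right {m n m' n' : ℕ} (f : (matPROP K X (DualNumber K)).Hom m n)
    {g : (matPROP K X (DualNumber K)).Hom m' n'} (hg : (reduceHom K X).map g = 0) :
    (reduceHom K X).map ((matPROP K X (DualNumber K)).tensor f g) = 0 := by
  rw [PROPHom.map_tensor, hg, map_zero]

/-- The values of the generators in an infinitesimal deformation of the PROP of matrices. -/
def epsVal (β : Matrix (Fin 2 → X) (Fin 1 → X) K) (γ : Matrix (Fin 0 → X) (Fin 2 → X) K) :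
    ∀ {m n : ℕ}, CasimirGen m n → (matPROP K X (DualNumber K)).Hom m n
  | _, _, .bracket => epsMat β
  | _, _, .casimir => epsMat γ

/-- The infinitesimal deformation determined by an antisymmetric bracket and a symmetric Casimir
element. -/
def epsHom (β : Matrix (Fin 2 → X) (Fin 1 → X) K) (γ : Matrix (Fin 0 → X) (Fin 2 → X) K)
    (hβ : ∀ x y, β x y + β (x ∘ (Equiv.swap 0 1).symm) y = 0)
    (hγ : ∀ x y, γ x (y ∘ Equiv.swap 0 1) = γ x y) :
    PROPHom (catLieC K) (matPROP K X (DualNumber K)) :=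
  presentedLift _ (matPROP K X (DualNumber K)) (epsVal β γ) (by
    intro m n f g h
    rcases h with h | h
    · cases h
      · refine Matrix.ext fun x y => ?_
        refine (congrArg (epsMat β x y + ·) (permMat_mul (epsMat β) (Equiv.swap 0 1) x y)).trans ?_
        change TrivSqZeroExt.inr (β x y) + TrivSqZeroExt.inr (β _ y) = (0 : DualNumber K)
        rw [← TrivSqZeroExt.inr_add, hβ, TrivSqZeroExt.inr_zero]
      · simp only [Term.eval, epsVal]
        -- Every term of the Jacobi relation contains two brackets, so it vanishes without any
        -- hypothesis on `β`.
        have h0 : (matPROP K X (DualNumber K)).comp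
            ((matPROP K X (DualNumber K)).tensor (epsMat β) ((matPROP K X (DualNumber K)).perm
              (Equiv.refl (Fin 1)))) (epsMat β) = 0 :=
          comp_eq_zero_of_reduce (reduce_tensor_left (reduceHom_epsMat β) _) (reduceHom_epsMat β)
        refine (congrArg₂ _ h0 (congrArg₂ _ (congrArg _ h0) (congrArg _ h0))).trans ?_
        simp
    · cases h
      · refine Matrix.ext fun x y => ?_
        refine (mul_permMat _ _ x y).trans ?_
        exact congrArg TrivSqZeroExt.inr (hγ x y)
      · simp only [Term.eval, epsVal]
        -- Each side of the invariance relation contains one bracket and one Casimir element, so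
        -- both are zero.
        exact (comp_eq_zero_of_reduce
          (reduce_tensor_right (m := 1) (n := 1) (m' := 0) (n' := 2) _ (reduceHom_epsMat γ))
          (reduce_tensor_left (m := 2) (n := 1) (m' := 1) (n' := 1) (reduceHom_epsMat β) _)).trans
            (comp_eq_zero_of_reduce
              (reduce_tensor_left (m := 0) (n := 2) (m' := 1) (n' := 1) (reduceHom_epsMat γ) _)
              (reduce_tensor_right (m := 1) (n := 1) (m' := 2) (n' := 1) _
                (reduceHom_epsMat β))).symm)

variable {β : Matrix (Fin 2 → X) (Fin 1 → X) K} {γ : Matrix (Fin 0 → X) (Fin 2 → X) K}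
    {hβ : ∀ x y, β x y + β (x ∘ (Equiv.swap 0 1).symm) y = 0}
    {hγ : ∀ x y, γ x (y ∘ Equiv.swap 0 1) = γ x y}

/-- Modulo ε both generators die, so the two morphisms of PROPs agree on generators. -/
lemma reduceHom_epsHom {m n : ℕ} (f : (catLieC K).Hom m n) :
    (reduceHom K X).map ((epsHom β γ hβ hγ).map f) =
      (unitHom (matPROP K X K)).map ((aug K).map f) := by
  refine presented_hom_ext ((epsHom β γ hβ hγ).comp (reduceHom K X))
    ((aug K).comp (unitHom (matPROP K X K))) (fun {a b} x => ?_) f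
  refine Eq.trans ?_ (Eq.trans (map_zero (unitHom (matPROP K X K)).map).symm
    (congrArg _ (aug_casGen x).symm))
  cases x <;> rfl

/-- The deformation kills the square of the augmentation ideal: its matrix coefficients see only
indecomposables. -/
lemma epsHom_comp_eq_zero {m n p : ℕ} {f : (catLieC K).Hom m n} {g : (catLieC K).Hom n p}
    (hf : (aug K).map f = 0) (hg : (aug K).map g = 0) :
    (epsHom β γ hβ hγ).map ((catLieC K).comp f g) = 0 := by
  rw [PROPHom.map_comp]
  apply comp_eq_zero_of_reduce
  · rw [reduceHom_epsHom, hf, map_zero]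
  · rw [reduceHom_epsHom, hg, map_zero]

lemma epsHom_homRep {m n : ℕ} (f : (catLieC K).Hom n m)
    (t : Perm (Fin m)) (s : Perm (Fin n)) (x y) :
    (epsHom β γ hβ hγ).map ((catLieC K).homRep n m (t, s) f) x y =
      (epsHom β γ hβ hγ).map f (x ∘ s) (y ∘ t) := by
  rw [LinearPROP.homRep_apply, PROPHom.map_comp, PROPHom.map_comp, PROPHom.map_perm,
    PROPHom.map_perm]
  exact (mul_permMat _ _ x y).trans (permMat_mul _ _ x _)

end Infinitesimal

/-! ## Detection of the generators -/

section Detection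

open Equiv

lemma perm_fin_two (α : Perm (Fin 2)) : α = 1 ∨ α = Equiv.swap 0 1 := by
  revert α
  decide

lemma bracket_antisymm : casGen K .bracket + (catLieC K).comp
    ((catLieC K).perm (Equiv.swap (0 : Fin 2) 1)) (casGen K .bracket) = 0 :=
  PresHom.sound (R := casimirRel K) (Cong.rel (.inl IsLieRel.antisymm))

lemma casimir_symm : (catLieC K).comp (casGen K .casimir)
    ((catLieC K).perm (Equiv.swap (0 : Fin 2) 1)) = casGen K .casimir :=
  PresHom.sound (R := casimirRel K) (Cong.rel (.inr IsCasimirRel.symm))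

/-- One formula covers both generators: the bracket has a single output and is antisymmetric in its
inputs, while the Casimir element has no inputs and is symmetric in its outputs. -/
lemma casGen_symm {a b : ℕ} (x : CasimirGen a b) (α : Perm (Fin a)) (β : Perm (Fin b)) :
    (catLieC K).comp ((catLieC K).comp ((catLieC K).perm α⁻¹) (casGen K x)) ((catLieC K).perm β) =
      ((Perm.sign α : ℤ) : K) • casGen K x := by
  cases x with
  | bracket =>
    obtain rfl : β = Equiv.refl _ := Subsingleton.elim _ _
    rw [LinearPROP.comp_id]
    rcases perm_fin_two α with rfl | rfl
    · rw [inv_one, Perm.sign_one, Units.val_one, Int.cast_one, one_smul]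
      exact (catLieC K).id_comp _
    · rw [Perm.sign_swap (by decide), swap_inv, eq_neg_of_add_eq_zero_right bracket_antisymm]
      simp
  | casimir =>
    obtain rfl : α = 1 := Subsingleton.elim _ _
    rw [inv_one, Perm.sign_one, Units.val_one, Int.cast_one, one_smul]
    have h := (catLieC K).id_comp (casGen K .casimir)
    refine (congrArg (fun f => (catLieC K).comp f _) h).trans ?_
    rcases perm_fin_two β with rfl | rfl
    · exact (catLieC K).comp_id _
    · exact casimir_symm

/-- The permutation of the first k letters passes through the identity and cancels its inverse,
leaving only the sign produced by the generator. -/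
lemma casPad_mem_isotypic {a b : ℕ} (k : ℕ) (x : CasimirGen a b) :
    casPad K k x ∈ isotypic ((catLieC K).homRep (k + a) (k + b)) (stabHom k a b)
      (stabChar K k a b) := by
  rintro ⟨σ, α, β⟩
  rw [LinearPROP.homRep_apply, stabHom_apply, stabChar_apply, juxt_inv, casPad,
    ← LinearPROP.perm_tensor, ← LinearPROP.perm_tensor, ← LinearPROP.interchange,
    ← LinearPROP.interchange, casGen_symm, LinearPROP.comp_id, LinearPROP.perm_comp, map_smul]
  rw [show (σ⁻¹).trans σ = Equiv.refl _ by ext; simp]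

variable (K) in
/-- The matrix of an antisymmetric operation with values in tensor powers of a line. -/
def genMat (k a b : ℕ) :
    Matrix (Fin a → Option (Fin (k + a))) (Fin b → Option (Fin (k + a))) K := fun x y =>
  if y = fun _ => none then
    ∑ α : Perm (Fin a), if x = fun i => some (Fin.natAdd k (α i)) then ((Perm.sign α : ℤ) : K) else 0
  else 0

/-- Reindexing the sum over α by right translation produces the sign. The cases (2, 1) and (0, 2)
give the hypotheses needed for the deformation. -/
lemma genMat_comp {k a b : ℕ} (γ : Perm (Fin a)) (δ : Perm (Fin b)) (x y) :
    genMat K k a b (x ∘ γ) (y ∘ δ) = ((Perm.sign γ : ℤ) : K) * genMat K k a b x y := by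
  have h1 : (y ∘ δ = fun _ => none) ↔ y = fun _ => none := by
    constructor
    · intro h
      ext1 i
      have := congrFun h (δ.symm i)
      simpa using this
    · rintro rfl
      rfl
  have h2 (α : Perm (Fin a)) : (x ∘ γ = fun i => some (Fin.natAdd k ((α * γ) i))) ↔
      x = fun i => some (Fin.natAdd k (α i)) := by
    constructor
    · intro h
      ext1 i
      have := congrFun h (γ.symm i)
      simpa using this
    · rintro rfl
      rfl
  simp only [genMat, h1]
  split_ifs
  · rw [← Equiv.sum_comp (Equiv.mulRight γ), Finset.mul_sum]
    refine Finset.sum_congr rfl fun α _ => ?_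
    simp only [Equiv.coe_mulRight, h2, mul_ite, mul_zero, Perm.sign_mul, Units.val_mul,
      Int.cast_mul]
    simp only [mul_comm]
  · rw [mul_zero]

lemma genMat_none_some (k a b : ℕ) :
    genMat K k a b (fun i => some (Fin.natAdd k i)) (fun _ => none) = 1 := by
  rw [genMat, if_pos rfl, Finset.sum_eq_single 1]
  · simp
  · intro α _ hα
    rw [if_neg]
    intro h
    refine hα (Equiv.ext fun i => ?_)
    have := congrFun h i
    simpa [eq_comm] using this
  · simp

lemma genMat_ne_zero {k a b : ℕ} {x y} (h : genMat K k a b x y ≠ 0) :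
    (∀ j, y j = none) ∧ ∀ i, ∃ j, x i = some (Fin.natAdd k j) := by
  rw [genMat] at h
  split_ifs at h with hy
  · obtain ⟨α, _, hα⟩ := Finset.exists_ne_zero_of_sum_ne_zero h
    have hx : x = fun i => some (Fin.natAdd k (α i)) := by
      by_contra hx
      exact hα (if_neg hx)
    exact ⟨congrFun hy, fun i => ⟨α i, congrFun hx i⟩⟩
  · exact absurd rfl h

lemma genMat_antisymm (k : ℕ) (x y) :
    genMat K k 2 1 x y + genMat K k 2 1 (x ∘ (Equiv.swap 0 1).symm) y = 0 := by
  have h := genMat_comp (K := K) (k := k) (Equiv.swap (0 : Fin 2) 1) (1 : Perm (Fin 1)) x y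
  rw [Perm.sign_swap (by decide)] at h
  rw [Equiv.symm_swap]
  exact add_eq_zero_iff_neg_eq.2 (by simpa [eq_comm] using h.symm)

lemma genMat_symm (k : ℕ) (x y) : genMat K k 0 2 x (y ∘ Equiv.swap 0 1) = genMat K k 0 2 x y := by
  have h := genMat_comp (K := K) (k := k) (1 : Perm (Fin 0)) (Equiv.swap (0 : Fin 2) 1) x y
  simpa using h

variable (K) in
/-- The infinitesimal deformation of the PROP of matrices which detects a generator. -/
def deform {a b : ℕ} (k : ℕ) : CasimirGen a b →
    PROPHom (catLieC K) (matPROP K (Option (Fin (k + a))) (DualNumber K))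
  | .bracket => epsHom (genMat K k 2 1) 0 (genMat_antisymm k) (fun _ _ => rfl)
  | .casimir => epsHom 0 (genMat K k 0 2) (fun _ _ => add_zero 0) (genMat_symm k)

lemma deform_casGen {a b : ℕ} (k : ℕ) (x : CasimirGen a b) :
    (deform K k x).map (casGen K x) = epsMat (genMat K k a b) := by
  cases x <;> rfl

lemma deform_comp_eq_zero {a b k : ℕ} (x : CasimirGen a b) {m n p : ℕ} {f : (catLieC K).Hom m n}
    {g : (catLieC K).Hom n p} (hf : (aug K).map f = 0) (hg : (aug K).map g = 0) :
    (deform K k x).map ((catLieC K).comp f g) = 0 := by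
  cases x
  · exact epsHom_comp_eq_zero (hβ := genMat_antisymm k) (hγ := fun _ _ => rfl) hf hg
  · exact epsHom_comp_eq_zero (hβ := fun _ _ => add_zero 0) (hγ := genMat_symm k) hf hg

lemma deform_homRep {a b k : ℕ} (x : CasimirGen a b) {m n : ℕ} (f : (catLieC K).Hom n m)
    (t : Perm (Fin m)) (s : Perm (Fin n)) (y z) :
    (deform K k x).map ((catLieC K).homRep n m (t, s) f) y z =
      (deform K k x).map f (y ∘ s) (z ∘ t) := by
  cases x
  · exact epsHom_homRep (hβ := genMat_antisymm k) (hγ := fun _ _ => rfl) f t s y z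
  · exact epsHom_homRep (hβ := fun _ _ => add_zero 0) (hγ := genMat_symm k) f t s y z

variable (K) in
/-- The linear form detecting a generator tensored with the identity of `k`. -/
def detect {a b : ℕ} (k : ℕ) (x : CasimirGen a b) : (catLieC K).Hom (k + a) (k + b) →ₗ[K] K where
  -- The coefficient has k + a distinct input letters; its output repeats the first k of them and
  -- fills the last b places with the extra letter `none`. Keeping the letters distinct is what
  -- makes the source and target permutations recoverable.
  toFun f := TrivSqZeroExt.snd
    ((deform K k x).map f some (Fin.append (fun i => some (Fin.castAdd a i)) fun _ => none))
  map_add' f g := by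
    rw [map_add]
    rfl
  map_smul' c f := by
    rw [map_smul]
    rfl

lemma detect_homRep {a b k : ℕ} (x : CasimirGen a b) (t : Perm (Fin (k + b)))
    (s : Perm (Fin (k + a))) (f : (catLieC K).Hom (k + a) (k + b)) :
    detect K k x ((catLieC K).homRep (k + a) (k + b) (t, s) f) =
      TrivSqZeroExt.snd ((deform K k x).map f (some ∘ s)
        (Fin.append (fun i => some (Fin.castAdd a i)) (fun _ => none) ∘ t)) :=
  congrArg TrivSqZeroExt.snd (deform_homRep x f t s _ _)

lemma deform_casPad {a b k : ℕ} (x : CasimirGen a b) (y z) :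
    TrivSqZeroExt.snd ((deform K k x).map (casPad K k x) y z) =
      (if y ∘ Fin.castAdd a = z ∘ Fin.castAdd b then 1 else 0) *
        genMat K k a b (y ∘ Fin.natAdd k) (z ∘ Fin.natAdd k) := by
  rw [casPad, PROPHom.map_tensor, PROPHom.map_perm, deform_casGen]
  change TrivSqZeroExt.snd (permMat _ (DualNumber K) (Equiv.refl (Fin k)) _ _ *
    TrivSqZeroExt.inr _) = _
  simp only [permMat]
  split_ifs with h1 h2 h2
  · simp
  · exact absurd h1 h2
  · exact absurd h2 h1
  · simp

/-- A nonzero coefficient at a translate forces the inputs of the generator to be the last a letters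
and its outputs to be `none`, so both permutations preserve the blocks. The identity factor then
forces them to agree on the first k letters, which puts the pair in the stabilizer. -/
lemma detected_casPad {a b : ℕ} (k : ℕ) (x : CasimirGen a b) :
    Detected ((catLieC K).homRep (k + a) (k + b)) (stabHom k a b) (stabChar K k a b)
      (casPad K k x) (detect K k x) where
  injective := stabHom_injective k a b
  mem := casPad_mem_isotypic k x
  self := by
    refine (deform_casPad x _ _).trans ?_
    rw [if_pos (by ext1 i; simp), one_mul]
    refine Eq.trans ?_ (genMat_none_some k a b)
    congr 1
    ext1 i
    simp
  off := by
    rintro ⟨t, s⟩ h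
    rw [detect_homRep, deform_casPad]
    by_contra h0
    obtain ⟨h1, h2⟩ := mul_ne_zero_iff.1 h0
    have h1' : (some ∘ s) ∘ Fin.castAdd a =
        (Fin.append (fun i => some (Fin.castAdd a i)) (fun _ => none) ∘ t) ∘ Fin.castAdd b := by
      by_contra h3
      exact h1 (if_neg h3)
    obtain ⟨h3, h4⟩ := genMat_ne_zero h2
    obtain ⟨σ, α, rfl⟩ := exists_juxt s fun i => by
      obtain ⟨j, hj⟩ := h4 i
      exact ⟨j, by simpa using hj⟩
    obtain ⟨σ', β, rfl⟩ := exists_juxt t fun i => by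
      have h5 := h3 i
      simp only [Function.comp_apply] at h5
      induction hj : t (Fin.natAdd k i) using Fin.addCases with
      | left j =>
        rw [hj, Fin.append_left] at h5
        exact absurd h5 (by simp)
      | right j => exact ⟨j, rfl⟩
    -- The first k inputs are distinct letters transmitted unchanged.
    have h6 : σ = σ' := by
      ext i
      have := congrFun h1' i
      simp only [Function.comp_apply, juxt_castAdd, Fin.append_left, Option.some.injEq] at this
      exact congrArg Fin.val (Fin.castAdd_injective _ _ this)
    subst h6
    exact h ⟨(σ, α, β), rfl⟩

end Detection

/-! ## Modules concentrated in one degree -/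

section Trivial

open Equiv

variable {n : ℕ} {V : Type u} [AddCommGroup V] [Module K V] (ρ : Representation K (Perm (Fin n)) V)

/-- A representation of the symmetric group as a module concentrated in one degree on which the
bracket and the Casimir element act by zero. -/
def trivMod : (catLieC K).Mod :=
  (trivialCasimir K).obj ((lieToSym K).restrict.obj (concentrated ρ))

/-- The underlying vector of an element of a concentrated module. -/
def tcoe (p : ℕ) : (trivMod ρ).obj.obj ⟨p⟩ →ₗ[K] V := (concentratedValue K n V p).subtype

lemma tcoe_injective (p : ℕ) : Function.Injective (tcoe ρ p) := Subtype.val_injective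

/-- The elements of a concentrated module. -/
def tmk : V →ₗ[K] (trivMod ρ).obj.obj ⟨n⟩ :=
  LinearMap.codRestrict (concentratedValue K n V n) LinearMap.id fun v => by
    simp [concentratedValue]

lemma tcoe_tmk (v : V) : tcoe ρ n (tmk ρ v) = v := rfl

lemma tmk_tcoe (x : (trivMod ρ).obj.obj ⟨n⟩) : tmk ρ (tcoe ρ n x) = x := rfl

lemma subsingleton_trivMod {p : ℕ} (h : p ≠ n) : Subsingleton ((trivMod ρ).obj.obj ⟨p⟩) := by
  have h0 : concentratedValue K n V p = ⊥ := if_neg h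
  change Subsingleton (concentratedValue K n V p)
  rw [h0]
  infer_instance

/-- The action of the PROP of permutations on a representation. -/
def symAct (p q : ℕ) : (symPROP K).Hom p q →ₗ[K] V →ₗ[K] V :=
  Finsupp.linearCombination K (permAct ρ : (Fin p ≃ Fin q) → _)

lemma symAct_perm {p q : ℕ} (e : Fin p ≃ Fin q) :
    symAct ρ p q ((symPROP K).perm e) = permAct ρ e :=
  (Finsupp.linearCombination_single K (1 : K) e).trans (one_smul K _)

lemma symAct_perm_self (e : Perm (Fin n)) : symAct ρ n n ((symPROP K).perm e) = ρ e := by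
  rw [symAct_perm, permAct, dif_pos ⟨rfl, rfl⟩]
  rfl

/-- The action factors through the augmentation, so all computations in a concentrated module reduce
to the given representation. -/
lemma tcoe_modAct {p q : ℕ} (f : (catLieC K).Hom p q) (x : (trivMod ρ).obj.obj ⟨p⟩) :
    tcoe ρ q (modAct (trivMod ρ) p q f x) = symAct ρ p q ((aug K).map f) (tcoe ρ p x) := by
  change (concentratedMap ρ p q ((aug K).map f) (x : concentratedValue K n V p) : V) = _
  generalize (aug K).map f = g
  let F : (symPROP K).Hom p q →ₗ[K] V :=
    ((concentratedValue K n V q).subtype ∘ₗ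
      (LinearMap.applyₗ (R := K) (x : concentratedValue K n V p))) ∘ₗ concentratedMap ρ p q
  refine LinearMap.congr_fun (f := F) (g := (symAct ρ p q).flip (tcoe ρ p x))
    (sym_hom_ext fun e => ?_) g
  rw [LinearMap.flip_apply, symAct_perm]
  exact (concentratedMap_single ρ e 1 x).trans (one_smul K _)

lemma modAct_trivMod_of_aug {p q : ℕ} {f : (catLieC K).Hom p q} (hf : (aug K).map f = 0)
    (x : (trivMod ρ).obj.obj ⟨p⟩) : modAct (trivMod ρ) p q f x = 0 := by
  apply tcoe_injective
  rw [tcoe_modAct, hf, map_zero, map_zero]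
  rfl

lemma modAct_trivMod_perm (e : Perm (Fin n)) (v : V) :
    modAct (trivMod ρ) n n ((catLieC K).perm e) (tmk ρ v) = tmk ρ (ρ e v) := by
  apply tcoe_injective
  rw [tcoe_modAct, (aug K).map_perm, symAct_perm_self]
  rfl

/-! ## The free presentation of a concentrated module -/

/-- The projection from the free module. -/
def freeProj : freeMod (catLieC K) n V ⟶ trivMod ρ := freeHom (trivMod ρ) (tmk ρ)

lemma homAt_freeProj {p : ℕ} (f : (catLieC K).Hom n p) (v : V) :
    homAt p (freeProj ρ) (tm p f v) = modAct (trivMod ρ) n p f (tmk ρ v) := rfl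

instance : Epi (freeProj ρ) := by
  refine epi_of_homAt_surjective _ fun p x => ?_
  by_cases h : p = n
  · subst h
    exact ⟨tm p ((catLieC K).perm (Equiv.refl _)) (tcoe ρ p x), modAct_id _ _⟩
  · have := subsingleton_trivMod ρ h
    exact ⟨0, Subsingleton.elim _ _⟩

lemma freeProj_tm_of_aug {p : ℕ} {f : (catLieC K).Hom n p} (hf : (aug K).map f = 0) (v : V) :
    homAt p (freeProj ρ) (tm p f v) = 0 := modAct_trivMod_of_aug ρ hf _

lemma freeProj_eq_zero {p : ℕ} (hp : p ≠ n) (x) : homAt p (freeProj ρ) x = 0 := by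
  have := subsingleton_trivMod ρ hp
  exact Subsingleton.elim _ _

variable {m : ℕ} {W : Type u} [AddCommGroup W] [Module K W]
  (σ : Representation K (Perm (Fin m)) W)

-- If f lies in the augmentation ideal then f ⊗ v is already in the kernel, so the composite is g
-- acting on a kernel element, and g acts by zero on the target.
variable {ρ σ} in
lemma ker_hom_decomposable (ψ : kerMod (freeProj ρ) ⟶ trivMod σ) {p q : ℕ}
    {f : (catLieC K).Hom n p} {g : (catLieC K).Hom p q} (hf : (aug K).map f = 0)
    (hg : (aug K).map g = 0) (v : V) (h) :
    homAt q ψ (kerMk (freeProj ρ) (tm q ((catLieC K).comp f g) v) h) = 0 := by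
  have h1 : kerMk (freeProj ρ) (tm q ((catLieC K).comp f g) v) h =
      modAct (kerMod (freeProj ρ)) p q g (kerMk (freeProj ρ) (tm p f v)
        (freeProj_tm_of_aug ρ hf v)) := rfl
  rw [h1, homAt_modAct, modAct_trivMod_of_aug σ hg]

-- The difference is f applied to e ⊗ v - 1 ⊗ ev. This is a kernel element because the tensor
-- product is over K, and f kills its image in the target.
variable {ρ σ} in
lemma ker_hom_perm_left (ψ : kerMod (freeProj ρ) ⟶ trivMod σ) {q : ℕ} (e : Perm (Fin n))
    {f : (catLieC K).Hom n q} (hf : (aug K).map f = 0) (v : V) (h h') :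
    homAt q ψ (kerMk (freeProj ρ) (tm q ((catLieC K).comp ((catLieC K).perm e) f) v) h) =
      homAt q ψ (kerMk (freeProj ρ) (tm q f (ρ e v)) h') := by
  have h0 : homAt n (freeProj ρ) (tm n ((catLieC K).perm e) v -
      tm n ((catLieC K).perm (Equiv.refl _)) (ρ e v)) = 0 := by
    rw [map_sub, homAt_freeProj, homAt_freeProj, modAct_id, modAct_trivMod_perm, sub_self]
  have h1 : kerMk (freeProj ρ) (tm q ((catLieC K).comp ((catLieC K).perm e) f) v) h -
      kerMk (freeProj ρ) (tm q f (ρ e v)) h' =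
      modAct (kerMod (freeProj ρ)) n q f (kerMk (freeProj ρ) _ h0) := by
    apply kerι_injective
    rw [map_sub, modAct_kerMk, kerι_kerMk, kerι_kerMk, kerι_kerMk, map_sub, modAct_tm, modAct_tm,
      LinearPROP.id_comp]
  rw [← sub_eq_zero, ← map_sub, h1, homAt_modAct, modAct_trivMod_of_aug σ hf]

lemma aug_word {p q k a b : ℕ} (w : (catLieC K).Hom p (k + a)) (x : CasimirGen a b)
    (e : Fin (k + b) ≃ Fin q) : (aug K).map ((catLieC K).comp ((catLieC K).comp w (casPad K k x))
      ((catLieC K).perm e)) = 0 := by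
  rw [PROPHom.map_comp, PROPHom.map_comp, aug_casPad, map_zero, map_zero, LinearMap.zero_apply]

lemma isWord_aug {p q : ℕ} {f : (catLieC K).Hom p q} (hf : IsWord (casimirRel K) f) :
    (∃ e, f = (catLieC K).perm e) ∨ (aug K).map f = 0 := by
  cases hf with
  | perm e => exact .inl ⟨e, rfl⟩
  | @step k a b _ w x e hw =>
    exact .inr (aug_word w x e)

/-- Modulo permutations and products of two elements of the augmentation ideal, only words with
exactly one generator remain. -/
lemma isWord_cases {p q : ℕ} {f : (catLieC K).Hom p q} (hf : IsWord (casimirRel K) f) :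
    (∃ e, f = (catLieC K).perm e) ∨
    (∃ (r : ℕ) (g : (catLieC K).Hom p r) (h : (catLieC K).Hom r q),
      (aug K).map g = 0 ∧ (aug K).map h = 0 ∧ f = (catLieC K).comp g h) ∨
    ∃ (k a b : ℕ) (x : CasimirGen a b) (e : Fin p ≃ Fin (k + a)) (e' : Fin (k + b) ≃ Fin q),
      f = (catLieC K).comp ((catLieC K).perm e)
        ((catLieC K).comp (casPad K k x) ((catLieC K).perm e')) := by
  cases hf with
  | perm e => exact .inl ⟨e, rfl⟩
  | @step k a b _ w x e hw =>
    right
    have hw' := isWord_aug hw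
    have hx : (presented (casimirRel K)).comp ((presented (casimirRel K)).comp w
        (padGen (casimirRel K) k x)) ((presented (casimirRel K)).perm e) =
        (catLieC K).comp w ((catLieC K).comp (casPad K k x) ((catLieC K).perm e)) :=
      (catLieC K).assoc _ _ _
    -- If the part of the word before its last generator is a permutation, there is one generator in
    -- all; otherwise that part is in the augmentation ideal and the word is decomposable.
    rcases hw' with ⟨e', rfl⟩ | hw'
    · exact .inr ⟨k, a, b, x, e', e, hx⟩
    · refine .inl ⟨k + a, w, _, hw', ?_, hx⟩
      rw [PROPHom.map_comp, aug_casPad, map_zero, LinearMap.zero_apply]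

/-- The projection onto the augmentation ideal along the permutations. -/
def augPart (p q : ℕ) : (catLieC K).Hom p q →ₗ[K] (catLieC K).Hom p q :=
  LinearMap.id - (unitHom (catLieC K)).map ∘ₗ (aug K).map

lemma aug_augPart {p q : ℕ} (f : (catLieC K).Hom p q) : (aug K).map (augPart p q f) = 0 := by
  change (aug K).map (f - (unitHom (catLieC K)).map ((aug K).map f)) = 0
  rw [map_sub, aug_unitHom, sub_self]

lemma augPart_of_aug {p q : ℕ} {f : (catLieC K).Hom p q} (hf : (aug K).map f = 0) :
    augPart p q f = f := by
  change f - (unitHom (catLieC K)).map ((aug K).map f) = f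
  rw [hf, map_zero, sub_zero]

lemma augPart_perm {p q : ℕ} (e : Fin p ≃ Fin q) : augPart p q ((catLieC K).perm e) = 0 := by
  change _ - (unitHom (catLieC K)).map ((aug K).map _) = 0
  rw [PROPHom.map_perm, PROPHom.map_perm]
  exact sub_self _

lemma eq_unit_add_augPart {p q : ℕ} (f : (catLieC K).Hom p q) :
    f = (unitHom (catLieC K)).map ((aug K).map f) + augPart p q f :=
  (add_sub_cancel _ _).symm

variable {ρ σ} in
/-- A morphism out of the kernel of the free presentation into a concentrated module vanishes on the
augmentation ideal as soon as it vanishes on the generators. -/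
lemma ker_hom_eq_zero (ψ : kerMod (freeProj ρ) ⟶ trivMod σ)
    (hψ : ∀ (k a b : ℕ) (x : CasimirGen a b) (hn : n = k + a) (hm : k + b = m) (v : V) (h),
      homAt m ψ (kerMk (freeProj ρ) (tm m ((catLieC K).comp ((catLieC K).perm (finCongr hn))
        ((catLieC K).comp (casPad K k x) ((catLieC K).perm (finCongr hm)))) v) h) = 0)
    {p : ℕ} {f : (catLieC K).Hom n p} (hf : (aug K).map f = 0) (v : V) (h) :
    homAt p ψ (kerMk (freeProj ρ) (tm p f v) h) = 0 := by
  by_cases hp : p = m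
  swap
  · have := subsingleton_trivMod σ hp
    exact Subsingleton.elim _ _
  subst hp
  -- The morphism `ψ` is defined only on the kernel; precomposing with the projection onto the
  -- augmentation ideal gives a linear map on all morphisms, which can be tested on words.
  let F : (catLieC K).Hom n p →ₗ[K] (trivMod σ).obj.obj ⟨p⟩ :=
    homAt p ψ ∘ₗ
      { toFun := fun f => kerMk (freeProj ρ) (tm p (augPart n p f) v)
          (freeProj_tm_of_aug ρ (aug_augPart f) v)
        map_add' := fun f g => by
          apply kerι_injective
          simp [kerι_kerMk]
        map_smul' := fun c f => by
          apply kerι_injective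
          simp [kerι_kerMk] }
  have key (f : (catLieC K).Hom n p) (hf : IsWord (casimirRel K) f) : F f = 0 := by
    rcases isWord_cases hf with ⟨e, rfl⟩ | ⟨r, g, g', hg, hg', rfl⟩ | ⟨k, a, b, x, e, e', rfl⟩
    · have h0 : kerMk (freeProj ρ) (tm p (augPart n p ((catLieC K).perm e)) v)
          (freeProj_tm_of_aug ρ (aug_augPart _) v) = 0 := by
        apply kerι_injective
        rw [kerι_kerMk, augPart_perm, map_zero, map_zero, LinearMap.zero_apply]
      exact (congrArg (homAt p ψ) h0).trans (map_zero _)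
    · have h0 : augPart n p ((catLieC K).comp g g') = (catLieC K).comp g g' :=
        augPart_of_aug (by rw [PROPHom.map_comp, hg, map_zero, LinearMap.zero_apply])
      change homAt p ψ (kerMk (freeProj ρ) (tm p (augPart n p _) v) _) = 0
      simp only [h0]
      exact ker_hom_decomposable ψ hg hg' v _
    · obtain hn : n = k + a := Fin.equiv_iff_eq.1 ⟨e⟩
      obtain hm : k + b = p := Fin.equiv_iff_eq.1 ⟨e'⟩
      have h1 : (aug K).map ((catLieC K).comp (casPad K k x) ((catLieC K).perm e')) = 0 := by
        rw [PROPHom.map_comp, aug_casPad, map_zero, LinearMap.zero_apply]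
      have h1' (e'' : Fin n ≃ Fin (k + a)) : (aug K).map ((catLieC K).comp ((catLieC K).perm e'')
          ((catLieC K).comp (casPad K k x) ((catLieC K).perm (finCongr hm)))) = 0 := by
        rw [PROPHom.map_comp, PROPHom.map_comp, aug_casPad, map_zero, LinearMap.zero_apply,
          map_zero]
      -- The outer permutations are separated from the transports along `hn` and `hm`, so that the
      -- two equivariances reduce the word to the form covered by `hψ`.
      have h2 : augPart n p ((catLieC K).comp ((catLieC K).perm e)
          ((catLieC K).comp (casPad K k x) ((catLieC K).perm e'))) =
          (catLieC K).comp ((catLieC K).comp ((catLieC K).perm (e.trans (finCongr hn).symm))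
            ((catLieC K).comp ((catLieC K).perm (finCongr hn))
              ((catLieC K).comp (casPad K k x) ((catLieC K).perm (finCongr hm)))))
              ((catLieC K).perm ((finCongr hm).symm.trans e')) := by
        rw [augPart_of_aug (by rw [PROPHom.map_comp, h1, map_zero])]
        have he : e = (e.trans (finCongr hn).symm).trans (finCongr hn) := by ext; simp
        have he' : e' = (finCongr hm).trans ((finCongr hm).symm.trans e') := by ext; simp
        have hX (X) : (catLieC K).comp ((catLieC K).perm (e.trans (finCongr hn).symm))
            ((catLieC K).comp ((catLieC K).perm (finCongr hn)) X) =
            (catLieC K).comp (n := k + a) (p := p) ((catLieC K).perm e) X := by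
          rw [← LinearPROP.assoc, LinearPROP.perm_comp, ← he]
        simp only [LinearPROP.assoc, LinearPROP.perm_comp]
        rw [hX, ← he']
      change homAt p ψ (kerMk (freeProj ρ) (tm p (augPart n p _) v) _) = 0
      simp only [h2]
      have h3 := h1' (finCongr hn)
      have h4 (h5) : homAt p ψ (kerMk (freeProj ρ) (tm p ((catLieC K).comp
          ((catLieC K).perm (e.trans (finCongr hn).symm)) ((catLieC K).comp
            ((catLieC K).perm (finCongr hn)) ((catLieC K).comp (casPad K k x)
              ((catLieC K).perm (finCongr hm))))) v) h5) = 0 := by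
        rw [ker_hom_perm_left ψ _ h3 v _ (freeProj_tm_of_aug ρ h3 _)]
        exact hψ k a b x hn hm _ _
      have h6 : (aug K).map ((catLieC K).comp
          ((catLieC K).perm (e.trans (finCongr hn).symm)) ((catLieC K).comp
            ((catLieC K).perm (finCongr hn)) ((catLieC K).comp (casPad K k x)
              ((catLieC K).perm (finCongr hm))))) = 0 := by
        rw [PROPHom.map_comp, h3, map_zero]
      have h7 := homAt_modAct ψ ((catLieC K).perm ((finCongr hm).symm.trans e'))
        (kerMk (freeProj ρ) _ (freeProj_tm_of_aug ρ h6 v))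
      rw [h4, map_zero] at h7
      exact h7
  have hspan : Submodule.span K {f : (presented (casimirRel K)).Hom n p | IsWord (casimirRel K) f}
      ≤ LinearMap.ker F := Submodule.span_le.2 key
  have h1 : F f = 0 := hspan (mem_span_isWord f)
  rw [← h1]
  change _ = homAt p ψ (kerMk (freeProj ρ) (tm p (augPart n p f) v) _)
  simp only [augPart_of_aug hf]

end Trivial

/-! ## Morphisms out of the kernel of the free presentation -/

section KernelHom

open Equiv

variable {n m : ℕ} {V W : Type u} [AddCommGroup V] [Module K V] [AddCommGroup W] [Module K W]
  (ρ : Representation K (Perm (Fin n)) V) (σ : Representation K (Perm (Fin m)) W)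

/-- The elements of the kernel of the free presentation given by an element of the augmentation
ideal. -/
def kerTm {p : ℕ} (f : (catLieC K).Hom n p) (hf : (aug K).map f = 0) :
    V →ₗ[K] (kerMod (freeProj ρ)).obj.obj ⟨p⟩ where
  toFun v := kerMk (freeProj ρ) (tm p f v) (freeProj_tm_of_aug ρ hf v)
  map_add' v w := by
    apply kerι_injective
    simp [kerι_kerMk]
  map_smul' c v := by
    apply kerι_injective
    simp [kerι_kerMk]

/-- The evaluation of a morphism out of the kernel at an element of the augmentation ideal. -/
def kerEval (f : (catLieC K).Hom n m) (hf : (aug K).map f = 0) :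
    (kerMod (freeProj ρ) ⟶ trivMod σ) →ₗ[K] (V →ₗ[K] W) where
  toFun ψ := tcoe σ m ∘ₗ homAt m ψ ∘ₗ kerTm ρ f hf
  map_add' ψ φ := by
    rw [map_add, LinearMap.add_comp, LinearMap.comp_add]
  map_smul' c ψ := by
    rw [map_smul, LinearMap.smul_comp, LinearMap.comp_smul]
    rfl

lemma kerEval_apply (f : (catLieC K).Hom n m) (hf : (aug K).map f = 0)
    (ψ : kerMod (freeProj ρ) ⟶ trivMod σ) (v : V) :
    kerEval ρ σ f hf ψ v =
      tcoe σ m (homAt m ψ (kerMk (freeProj ρ) (tm m f v) (freeProj_tm_of_aug ρ hf v))) := rfl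

/-- The representation on the linear maps between two representations of symmetric groups. -/
abbrev outerHom : Representation K (Perm (Fin m) × Perm (Fin n)) (V →ₗ[K] W) :=
  Representation.linHom (ρ.comp (MonoidHom.snd _ _)) (σ.comp (MonoidHom.fst _ _))

lemma outerHom_apply (t : Perm (Fin m)) (s : Perm (Fin n)) (φ : V →ₗ[K] W) (v : V) :
    outerHom ρ σ (t, s) φ v = σ t (φ (ρ s⁻¹ v)) := rfl

lemma kerEval_homRep (t : Perm (Fin m)) (s : Perm (Fin n)) (f : (catLieC K).Hom n m)
    (hf : (aug K).map f = 0) (hf' : (aug K).map ((catLieC K).homRep n m (t, s) f) = 0)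
    (ψ : kerMod (freeProj ρ) ⟶ trivMod σ) :
    kerEval ρ σ ((catLieC K).homRep n m (t, s) f) hf' ψ =
      outerHom ρ σ (t, s) (kerEval ρ σ f hf ψ) := by
  have h1 : (aug K).map ((catLieC K).comp ((catLieC K).perm s⁻¹) f) = 0 := by
    rw [PROPHom.map_comp, hf, map_zero]
  ext v
  rw [outerHom_apply, kerEval_apply, kerEval_apply,
    ← ker_hom_perm_left ψ s⁻¹ hf v (freeProj_tm_of_aug ρ h1 v), ← symAct_perm_self,
    ← (aug K).map_perm, ← tcoe_modAct, ← homAt_modAct]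
  rfl

variable {ρ}

/-- The extension of a bilinear map to a family of linear maps out of the free module. -/
def extendAt (Ψ : (catLieC K).Hom n m →ₗ[K] V →ₗ[K] W)
    (p : ℕ) : (freeMod (catLieC K) n V).obj.obj ⟨p⟩ →ₗ[K] (trivMod σ).obj.obj ⟨p⟩ :=
  if h : p = m then by
    subst h
    exact tmk σ ∘ₗ freeLift Ψ
  else 0

lemma extendAt_self (Ψ : (catLieC K).Hom n m →ₗ[K] V →ₗ[K] W) :
    extendAt σ Ψ m = tmk σ ∘ₗ freeLift Ψ := dif_pos rfl

variable {σ}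

/-- A morphism out of the kernel of the free presentation is given by an equivariant map which
vanishes on the decomposable morphisms. -/
lemma exists_ker_hom (hnm : n ≠ m)
    (Ψ : Representation.IntertwiningMap ((catLieC K).homRep n m) (outerHom ρ σ))
    (hΨ : ∀ {p : ℕ} (f : (catLieC K).Hom n p) (g : (catLieC K).Hom p m), (aug K).map f = 0 →
      (aug K).map g = 0 → Ψ ((catLieC K).comp f g) = 0) :
    ∃ ψ : kerMod (freeProj ρ) ⟶ trivMod σ, ∀ f hf, kerEval ρ σ f hf ψ = Ψ f := by
  -- The two one-sided equivariances, from the pairs (1, s⁻¹) and (t, 1).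
  have hΨl (s : Perm (Fin n)) (f : (catLieC K).Hom n m) (v : V) :
      Ψ ((catLieC K).comp ((catLieC K).perm s) f) v = Ψ f (ρ s v) := by
    have h := LinearMap.congr_fun (Representation.IntertwiningMap.isIntertwining _ _ Ψ (1, s⁻¹) f) v
    rw [LinearPROP.homRep_apply, outerHom_apply, map_one, inv_inv] at h
    refine Eq.trans ?_ h
    exact congrArg (fun x => Ψ x v) ((catLieC K).comp_id _).symm
  have hΨr (t : Perm (Fin m)) (f : (catLieC K).Hom n m) (v : V) :
      Ψ ((catLieC K).comp f ((catLieC K).perm t)) v = σ t (Ψ f v) := by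
    have h := LinearMap.congr_fun (Representation.IntertwiningMap.isIntertwining _ _ Ψ (t, 1) f) v
    rw [LinearPROP.homRep_apply, outerHom_apply, inv_one, map_one] at h
    refine Eq.trans ?_ h
    exact congrArg (fun x => Ψ ((catLieC K).comp x ((catLieC K).perm t)) v)
      ((catLieC K).id_comp _).symm
  -- Starting in degree n, split the first factor into permutations and an element of the
  -- augmentation ideal. As n ≠ m, g is in the ideal, so the second part is decomposable and only
  -- the permutations contribute.
  have hn (g : (catLieC K).Hom n m) (x : (freeMod (catLieC K) n V).obj.obj ⟨n⟩) :
      freeLift Ψ.toLinearMap (modAct (freeMod (catLieC K) n V) n m g x) =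
        Ψ g (tcoe ρ n (homAt n (freeProj ρ) x)) := by
    refine LinearMap.congr_fun (f := freeLift Ψ.toLinearMap ∘ₗ modAct _ n m g)
      (g := Ψ g ∘ₗ tcoe ρ n ∘ₗ homAt n (freeProj ρ)) (free_ext fun f v => ?_) x
    simp only [LinearMap.comp_apply]
    rw [modAct_tm, freeLift_tm, homAt_freeProj, tcoe_modAct]
    change Ψ _ v = Ψ g (_)
    rw [eq_unit_add_augPart f, map_add, map_add, LinearMap.add_apply, map_add, LinearMap.add_apply,
      hΨ _ g (aug_augPart f) (aug_eq_zero_of_ne hnm g), aug_augPart, add_zero, aug_unitHom,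
      LinearMap.zero_apply, add_zero]
    generalize (aug K).map f = f
    refine LinearMap.congr_fun (f := LinearMap.applyₗ v ∘ₗ Ψ.toLinearMap ∘ₗ
      (catLieC K).comp.flip g ∘ₗ (unitHom (catLieC K)).map)
      (g := Ψ g ∘ₗ (symAct ρ n n).flip v) (sym_hom_ext fun e => ?_) f
    simp only [LinearMap.comp_apply, LinearMap.flip_apply, PROPHom.map_perm, symAct_perm_self]
    exact hΨl e g v
  -- Through a third degree both factors change the degree, so the composite is decomposable.
  have hp (p : ℕ) (hpn : p ≠ n) (hpm : p ≠ m) (g : (catLieC K).Hom p m)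
      (x : (freeMod (catLieC K) n V).obj.obj ⟨p⟩) :
      freeLift Ψ.toLinearMap (modAct (freeMod (catLieC K) n V) p m g x) = 0 := by
    refine LinearMap.congr_fun (f := freeLift Ψ.toLinearMap ∘ₗ modAct _ p m g)
      (g := 0) (free_ext fun f v => ?_) x
    simp only [LinearMap.comp_apply]
    rw [modAct_tm, freeLift_tm]
    change Ψ _ v = _
    rw [hΨ f g (aug_eq_zero_of_ne (Ne.symm hpn) f) (aug_eq_zero_of_ne hpm g)]
    rfl
  -- In degree m it is the first factor that changes the degree; of the second only its permutation
  -- part survives.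
  have hm (g : (catLieC K).Hom m m) (x : (freeMod (catLieC K) n V).obj.obj ⟨m⟩) :
      freeLift Ψ.toLinearMap (modAct (freeMod (catLieC K) n V) m m g x) =
        symAct σ m m ((aug K).map g) (freeLift Ψ.toLinearMap x) := by
    refine LinearMap.congr_fun (f := freeLift Ψ.toLinearMap ∘ₗ modAct _ m m g)
      (g := symAct σ m m ((aug K).map g) ∘ₗ freeLift Ψ.toLinearMap)
      (free_ext fun f v => ?_) x
    simp only [LinearMap.comp_apply]
    rw [modAct_tm, freeLift_tm, freeLift_tm]
    change Ψ _ v = symAct σ m m _ (Ψ f v)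
    conv_lhs => rw [eq_unit_add_augPart g, map_add, map_add, LinearMap.add_apply,
      hΨ f _ (aug_eq_zero_of_ne hnm f) (aug_augPart g)]
    rw [LinearMap.zero_apply, add_zero]
    generalize (aug K).map g = g
    refine LinearMap.congr_fun (f := LinearMap.applyₗ v ∘ₗ Ψ.toLinearMap ∘ₗ
      (catLieC K).comp f ∘ₗ (unitHom (catLieC K)).map)
      (g := (symAct σ m m).flip (Ψ f v)) (sym_hom_ext fun e => ?_) g
    simp only [LinearMap.comp_apply, LinearMap.flip_apply, PROPHom.map_perm, symAct_perm_self]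
    exact hΨr e f v
  let ψ : kerMod (freeProj ρ) ⟶ trivMod σ :=
    mkHom (fun p => extendAt σ Ψ.toLinearMap p ∘ₗ homAt p (kerι (freeProj ρ))) fun p q f x => by
      by_cases hq : q = m
      swap
      · have := subsingleton_trivMod σ hq
        exact Subsingleton.elim _ _
      obtain rfl : m = q := hq.symm
      apply tcoe_injective
      simp only [LinearMap.comp_apply]
      rw [homAt_modAct, extendAt_self, LinearMap.comp_apply, tcoe_tmk]
      -- Only here does the restriction to the kernel matter: by `hn` the value depends only on the
      -- image in the concentrated module, which is zero.
      by_cases hpn : p = n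
      · subst hpn
        rw [hn, homAt_kerι, map_zero, map_zero]
        have := subsingleton_trivMod σ hnm
        rw [Subsingleton.elim (extendAt σ Ψ.toLinearMap p _) 0, map_zero, map_zero]
      by_cases hpm : p = m
      · obtain rfl : m = p := hpm.symm
        rw [hm, tcoe_modAct, extendAt_self]
        rfl
      · rw [hp p hpn hpm]
        have := subsingleton_trivMod σ hpm
        rw [Subsingleton.elim (extendAt σ Ψ.toLinearMap p _) 0, map_zero, map_zero]
  refine ⟨ψ, fun f hf => ?_⟩
  ext v
  rw [kerEval_apply]
  change tcoe σ m (extendAt σ Ψ.toLinearMap m (tm m f v)) = _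
  rw [extendAt_self, LinearMap.comp_apply, freeLift_tm, tcoe_tmk]
  rfl

lemma aug_homRep {f : (catLieC K).Hom n m} (hf : (aug K).map f = 0)
    (x : Perm (Fin m) × Perm (Fin n)) : (aug K).map ((catLieC K).homRep n m x f) = 0 := by
  rw [LinearPROP.homRep_apply, PROPHom.map_comp, PROPHom.map_comp, hf, map_zero, map_zero,
    LinearMap.zero_apply]

end KernelHom

/-! ### Evaluation at a generator -/

section Generators

open Equiv

variable {k a b : ℕ} {V W : Type u} [AddCommGroup V] [Module K V] [AddCommGroup W] [Module K W]
  (ρ : Representation K (Perm (Fin (k + a))) V) (σ : Representation K (Perm (Fin (k + b))) W)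

/-- The evaluation of a morphism out of the kernel of the free presentation at a generator. -/
def genEval (x : CasimirGen a b) : (kerMod (freeProj ρ) ⟶ trivMod σ) →ₗ[K]
    isotypic (outerHom ρ σ) (stabHom k a b) (stabChar K k a b) :=
  LinearMap.codRestrict _ (kerEval ρ σ (casPad K k x) (aug_casPad k x)) fun ψ => by
    rw [mem_isotypic]
    intro h
    have h1 := kerEval_homRep ρ σ (stabHom k a b h).1 (stabHom k a b h).2 (casPad K k x)
      (aug_casPad k x) (aug_homRep (aug_casPad k x) _) ψ
    refine h1.symm.trans ?_
    have h2 := mem_isotypic.1 (casPad_mem_isotypic (K := K) k x) h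
    ext v
    simp only [kerEval_apply, h2, map_smul, LinearMap.smul_apply]
    have h3 (h4 h5) : kerMk (freeProj ρ) (stabChar K k a b h • tm (k + b) (casPad K k x) v) h4 =
        stabChar K k a b h • kerMk (freeProj ρ) (tm (k + b) (casPad K k x) v) h5 := by
      apply kerι_injective
      rw [map_smul, kerι_kerMk, kerι_kerMk]
    rw [h3 _ (freeProj_tm_of_aug ρ (aug_casPad k x) v), map_smul, map_smul]

/-- The bracket lowers the degree by one and the Casimir element raises it by two, so source and
target determine the generator and its padding. -/
lemma CasimirGen.eq_of_add_eq {k a b : ℕ} (x : CasimirGen a b) {k' a' b' : ℕ}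
    (x' : CasimirGen a' b') (h : k + a = k' + a') (h' : k' + b' = k + b) : k' = k ∧ HEq x' x := by
  cases x <;> cases x'
  · exact ⟨by omega, HEq.rfl⟩
  · omega
  · omega
  · exact ⟨by omega, HEq.rfl⟩

lemma CasimirGen.arity {a b : ℕ} (x : CasimirGen a b) : a = 2 ∧ b = 1 ∨ a = 0 ∧ b = 2 := by
  cases x <;> simp

/-- Only one padded generator has the right degrees, so vanishing there means vanishing on all
generators and hence on the augmentation ideal. In the target degree, different from k + a, this
ideal accounts for the whole kernel. -/
lemma genEval_injective (x : CasimirGen a b) : Function.Injective (genEval ρ σ x) := by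
  rw [injective_iff_map_eq_zero]
  intro ψ hψ
  have h0 : kerEval ρ σ (casPad K k x) (aug_casPad k x) ψ = 0 := congrArg Subtype.val hψ
  have hab : k + a ≠ k + b := by
    have := x.arity
    omega
  have key (k' a' b' : ℕ) (x' : CasimirGen a' b') (hn : k + a = k' + a') (hm : k' + b' = k + b)
      (v : V) (h) : homAt (k + b) ψ (kerMk (freeProj ρ) (tm (k + b)
        ((catLieC K).comp ((catLieC K).perm (finCongr hn))
        ((catLieC K).comp (casPad K k' x') ((catLieC K).perm (finCongr hm)))) v) h) = 0 := by
    obtain ⟨rfl, hx⟩ := CasimirGen.eq_of_add_eq x x' hn hm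
    obtain rfl : a' = a := by omega
    obtain rfl : b' = b := by omega
    obtain rfl := eq_of_heq hx
    apply tcoe_injective
    refine Eq.trans ?_ (LinearMap.congr_fun h0 v)
    have h1 : (catLieC K).comp ((catLieC K).perm (finCongr hn))
        ((catLieC K).comp (casPad K k' x') ((catLieC K).perm (finCongr hm))) = casPad K k' x' := by
      refine ((catLieC K).id_comp _).trans ((catLieC K).comp_id _)
    simp only [h1]
    rfl
  refine mod_hom_ext fun p => LinearMap.ext fun y => ?_
  obtain ⟨y, hy, rfl⟩ := exists_kerMk _ y
  by_cases hp : p = k + b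
  swap
  · have := subsingleton_trivMod σ hp
    exact Subsingleton.elim _ _
  subst hp
  -- The concentrated module is zero in degree k + b, so there the kernel is the entire free module
  -- and pure tensors can be used.
  let F : (freeMod (catLieC K) (k + a) V).obj.obj ⟨k + b⟩ →ₗ[K] (trivMod σ).obj.obj ⟨k + b⟩ :=
    { toFun := fun y => homAt (k + b) ψ (kerMk (freeProj ρ) y (freeProj_eq_zero ρ hab.symm y))
      map_add' := fun y z => by
        rw [← map_add]
        rfl
      map_smul' := fun c y => by
        rw [RingHom.id_apply, ← map_smul]
        rfl }
  have hF : F = 0 := free_ext fun f v =>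
    ker_hom_eq_zero ψ key (aug_eq_zero_of_ne hab f) v _
  exact LinearMap.congr_fun hF y

lemma detect_homRep_decomposable (x : CasimirGen a b) {p : ℕ} {f : (catLieC K).Hom (k + a) p}
    {g : (catLieC K).Hom p (k + b)} (hf : (aug K).map f = 0) (hg : (aug K).map g = 0)
    (y : Perm (Fin (k + b)) × Perm (Fin (k + a))) :
    detect K k x ((catLieC K).homRep _ _ y ((catLieC K).comp f g)) = 0 := by
  rw [detect_homRep, deform_comp_eq_zero x hf hg]
  rfl

/-- The detecting form, averaged against `φ`, is equivariant and vanishes on decomposables, so it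
comes from a morphism on the kernel. Its value at the generator is the order of the stabilizer times
`φ`, hence the rescaling. -/
lemma genEval_surjective [CharZero K] (x : CasimirGen a b) :
    Function.Surjective (genEval ρ σ x) := by
  intro φ
  have hab : k + a ≠ k + b := by
    have := x.arity
    omega
  let c : K := (Fintype.card (Perm (Fin k) × Perm (Fin a) × Perm (Fin b)) : K)
  have hc : c ≠ 0 := Nat.cast_ne_zero.2 Fintype.card_ne_zero
  obtain ⟨ψ, hψ⟩ := exists_ker_hom (ρ := ρ) (σ := σ) hab
    (averaged ((catLieC K).homRep (k + a) (k + b)) (outerHom ρ σ) (detect K k x) φ.1)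
    fun f g hf hg => by
      rw [averaged_apply]
      exact Finset.sum_eq_zero fun y _ => by
        rw [detect_homRep_decomposable x hf hg, zero_smul]
  refine ⟨c⁻¹ • ψ, Subtype.ext ?_⟩
  rw [map_smul]
  change c⁻¹ • kerEval ρ σ (casPad K k x) (aug_casPad k x) ψ = φ.1
  rw [hψ, averaged_detected _ _ (detected_casPad k x) φ.2, smul_smul, inv_mul_cancel₀ hc, one_smul]

end Generators

/-! ## The first Ext-group between concentrated modules -/

section ExtOne

open Equiv

variable {n m : ℕ} {V W : Type u} [AddCommGroup V] [Module K V] [AddCommGroup W] [Module K W]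
  (ρ : Representation K (Perm (Fin n)) V) (σ : Representation K (Perm (Fin m)) W)

/-- The connecting homomorphism of the free presentation of a concentrated module. -/
def extOfKer : (kerMod (freeProj ρ) ⟶ trivMod σ) →ₗ[K]
    Abelian.Ext.{u + 1} (trivMod ρ) (trivMod σ) 1 :=
  connecting (ker_shortExact (freeProj ρ)) (trivMod σ)

lemma extOfKer_surjective : Function.Surjective (extOfKer ρ σ) :=
  have : Projective (ShortComplex.mk (kerι (freeProj ρ)) (freeProj ρ) (kerι_comp _)).X₂ :=
    inferInstanceAs (Projective (freeMod (catLieC K) n V))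
  connecting_surjective _ _

lemma extOfKer_eq_zero_iff (ψ : kerMod (freeProj ρ) ⟶ trivMod σ) :
    extOfKer ρ σ ψ = 0 ↔ ∃ g, kerι (freeProj ρ) ≫ g = ψ :=
  connecting_eq_zero_iff _ _

/-- A morphism from the free module to the target is determined in degree n, where the target is
zero; so no nonzero morphism on the kernel extends. -/
lemma extOfKer_bijective (h : n ≠ m) : Function.Bijective (extOfKer ρ σ) := by
  refine ⟨(injective_iff_map_eq_zero _).2 fun ψ hψ => ?_, extOfKer_surjective ρ σ⟩
  obtain ⟨g, rfl⟩ := (extOfKer_eq_zero_iff ρ σ ψ).1 hψ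
  have hg : g = 0 := freeMod_hom_ext fun v => by
    have := subsingleton_trivMod σ h
    exact Subsingleton.elim _ _
  rw [hg, Limits.comp_zero]

/-- The first Ext-group between concentrated modules whose degrees are related by a generator. -/
def extEquiv [CharZero K] {k a b : ℕ} (x : CasimirGen a b)
    (ρ : Representation K (Perm (Fin (k + a))) V) (σ : Representation K (Perm (Fin (k + b))) W) :
    Abelian.Ext.{u + 1} (trivMod ρ) (trivMod σ) 1 ≃ₗ[K]
      isotypic (outerHom ρ σ) (stabHom k a b) (stabChar K k a b) :=
  (LinearEquiv.ofBijective (extOfKer ρ σ) (extOfKer_bijective ρ σ (by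
    have := x.arity
    omega))).symm.trans
  (LinearEquiv.ofBijective (genEval ρ σ x) ⟨genEval_injective ρ σ x, genEval_surjective ρ σ x⟩)

lemma ker_hom_eq_zero_of_no_generator
    (h : ∀ k a b, CasimirGen a b → n = k + a → k + b = m → False)
    (ψ : kerMod (freeProj ρ) ⟶ trivMod σ) {f : (catLieC K).Hom n m} (hf : (aug K).map f = 0)
    (v : V) (h') : homAt m ψ (kerMk (freeProj ρ) (tm m f v) h') = 0 :=
  ker_hom_eq_zero ψ (fun k a b x hn hm _ _ => (h k a b x hn hm).elim) hf v _

/-- There are no extensions between concentrated modules of different degrees which are not related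
by a generator. -/
lemma subsingleton_ext_of_ne (hnm : n ≠ m)
    (h : ∀ k a b, CasimirGen a b → n = k + a → k + b = m → False) :
    Subsingleton (Abelian.Ext.{u + 1} (trivMod ρ) (trivMod σ) 1) := by
  refine subsingleton_of_forall_eq 0 fun y => ?_
  obtain ⟨ψ, rfl⟩ := extOfKer_surjective ρ σ y
  have hψ : ψ = 0 := by
    refine mod_hom_ext fun p => LinearMap.ext fun y => ?_
    obtain ⟨y, hy, rfl⟩ := exists_kerMk _ y
    by_cases hp : p = m
    swap
    · have := subsingleton_trivMod σ hp
      exact Subsingleton.elim _ _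
    subst hp
    let F : (freeMod (catLieC K) n V).obj.obj ⟨p⟩ →ₗ[K] (trivMod σ).obj.obj ⟨p⟩ :=
      { toFun := fun y => homAt p ψ (kerMk (freeProj ρ) y (freeProj_eq_zero ρ hnm.symm y))
        map_add' := fun y z => by
          rw [← map_add]
          rfl
        map_smul' := fun c y => by
          rw [RingHom.id_apply, ← map_smul]
          rfl }
    have hF : F = 0 := free_ext fun f v =>
      ker_hom_eq_zero_of_no_generator ρ σ h ψ (aug_eq_zero_of_ne hnm f) v _
    exact LinearMap.congr_fun hF y
  rw [hψ, map_zero]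

end ExtOne

/-! ### Extensions within one degree -/

section ExtSame

open Equiv

variable {n : ℕ} {V W : Type u} [AddCommGroup V] [Module K V] [AddCommGroup W] [Module K W]
  (ρ : Representation K (Perm (Fin n)) V) (σ : Representation K (Perm (Fin n)) W)

/-- The projection of the free module onto the kernel of the free presentation. -/
def toKer : (freeMod (catLieC K) n V).obj.obj ⟨n⟩ →ₗ[K] (kerMod (freeProj ρ)).obj.obj ⟨n⟩ where
  toFun y := kerMk (freeProj ρ)
    (y - tm n ((catLieC K).perm (Equiv.refl _)) (tcoe ρ n (homAt n (freeProj ρ) y))) (by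
      rw [map_sub, homAt_freeProj, modAct_id, tmk_tcoe, sub_self])
  map_add' y z := by
    apply kerι_injective
    simp only [map_add, kerι_kerMk]
    abel
  map_smul' c y := by
    apply kerι_injective
    simp only [map_smul, kerι_kerMk, RingHom.id_apply, smul_sub]

lemma kerι_toKer (y : (freeMod (catLieC K) n V).obj.obj ⟨n⟩) :
    homAt n (kerι (freeProj ρ)) (toKer ρ y) =
      y - tm n ((catLieC K).perm (Equiv.refl _)) (tcoe ρ n (homAt n (freeProj ρ) y)) :=
  kerι_kerMk _ _ _

lemma toKer_kerι (y : (kerMod (freeProj ρ)).obj.obj ⟨n⟩) :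
    toKer ρ (homAt n (kerι (freeProj ρ)) y) = y := by
  apply kerι_injective
  rw [kerι_toKer, homAt_kerι, map_zero, map_zero, sub_zero]

lemma tcoe_freeProj_perm (e : Perm (Fin n)) (v : V) :
    tcoe ρ n (homAt n (freeProj ρ) (tm n ((catLieC K).perm e) v)) = ρ e v := by
  rw [homAt_freeProj, modAct_trivMod_perm, tcoe_tmk]

variable {ρ σ} in
/-- The cocycle of a morphism out of the kernel of the free presentation. -/
def cocycle (ψ : kerMod (freeProj ρ) ⟶ trivMod σ) (e : Perm (Fin n)) : V →ₗ[K] W :=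
  tcoe σ n ∘ₗ homAt n ψ ∘ₗ toKer ρ ∘ₗ tm n ((catLieC K).perm e)

-- The cocycle identity comes from es ⊗ v - 1 ⊗ esv = e(s ⊗ v - 1 ⊗ sv) + (e ⊗ sv - 1 ⊗ esv).
variable {ρ σ} in
lemma cocycle_mul (ψ : kerMod (freeProj ρ) ⟶ trivMod σ) (e s : Perm (Fin n)) (v : V) :
    cocycle ψ (e * s) v = σ e (cocycle ψ s v) + cocycle ψ e (ρ s v) := by
  have h : toKer ρ (tm n ((catLieC K).perm (e * s)) v) =
      modAct (kerMod (freeProj ρ)) n n ((catLieC K).perm e)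
        (toKer ρ (tm n ((catLieC K).perm s) v)) +
      toKer ρ (tm n ((catLieC K).perm e) (ρ s v)) := by
    apply kerι_injective
    rw [map_add, homAt_modAct, kerι_toKer, kerι_toKer, kerι_toKer, map_sub, modAct_tm, modAct_tm,
      tcoe_freeProj_perm, tcoe_freeProj_perm, tcoe_freeProj_perm, LinearPROP.perm_comp,
      LinearPROP.perm_comp, map_mul]
    exact (sub_add_sub_cancel _ _ _).symm
  change tcoe σ n (homAt n ψ (toKer ρ (tm n _ v))) = _
  rw [h, map_add, map_add, homAt_modAct, tcoe_modAct, (aug K).map_perm, symAct_perm_self]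
  rfl

/-- There are no extensions between modules concentrated in the same degree. -/
lemma subsingleton_ext_self [CharZero K] :
    Subsingleton (Abelian.Ext.{u + 1} (trivMod ρ) (trivMod σ) 1) := by
  refine subsingleton_of_forall_eq 0 fun y => ?_
  obtain ⟨ψ, rfl⟩ := extOfKer_surjective ρ σ y
  rw [extOfKer_eq_zero_iff]
  let c : K := (Fintype.card (Perm (Fin n)) : K)
  have hc : c ≠ 0 := Nat.cast_ne_zero.2 Fintype.card_ne_zero
  -- The averaging of Maschke's theorem: `θ` is the primitive of which the cocycle is the
  -- coboundary.
  let θ : V →ₗ[K] W := -(c⁻¹ • ∑ s : Perm (Fin n), cocycle ψ s ∘ₗ ρ s⁻¹)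
  have hθ (v : V) : θ v = -(c⁻¹ • ∑ s : Perm (Fin n), cocycle ψ s (ρ s⁻¹ v)) := by
    simp [θ]
  have key (e : Perm (Fin n)) (v : V) : cocycle ψ e v = σ e (θ v) - θ (ρ e v) := by
    have h1 (s : Perm (Fin n)) : σ e (cocycle ψ s (ρ s⁻¹ v)) =
        cocycle ψ (e * s) (ρ s⁻¹ v) - cocycle ψ e v := by
      rw [cocycle_mul, ← Module.End.mul_apply, ← map_mul, mul_inv_cancel, map_one,
        Module.End.one_apply, add_sub_cancel_right]
    have h2 : ∑ s : Perm (Fin n), cocycle ψ (e * s) (ρ s⁻¹ v) =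
        ∑ s : Perm (Fin n), cocycle ψ s (ρ s⁻¹ (ρ e v)) := by
      rw [← Equiv.sum_comp (Equiv.mulLeft e) fun s => cocycle ψ s (ρ s⁻¹ (ρ e v))]
      refine Finset.sum_congr rfl fun s _ => ?_
      rw [← Module.End.mul_apply, ← map_mul, Equiv.coe_mulLeft, mul_inv_rev,
        inv_mul_cancel_right]
    have h3 : (Finset.univ : Finset (Perm (Fin n))).card • cocycle ψ e v = c • cocycle ψ e v :=
      (Nat.cast_smul_eq_nsmul K _ _).symm
    rw [hθ, hθ, map_neg, map_smul, map_sum, Finset.sum_congr rfl fun s _ => h1 s,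
      Finset.sum_sub_distrib, h2, Finset.sum_const, h3, smul_sub, smul_smul, inv_mul_cancel₀ hc,
      one_smul]
    abel
  refine ⟨freeHom (trivMod σ) (tmk σ ∘ₗ θ), mod_hom_ext fun p => LinearMap.ext fun y => ?_⟩
  by_cases hp : p = n
  swap
  · have := subsingleton_trivMod σ hp
    exact Subsingleton.elim _ _
  subst hp
  apply tcoe_injective
  have hno (k a b : ℕ) (x : CasimirGen a b) (h1 : p = k + a) (h2 : k + b = p) : False := by
    have := x.arity
    omega
  let G := freeHom (P := catLieC K) (n := p) (trivMod σ) (tmk σ ∘ₗ θ)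
  have hG (f : (catLieC K).Hom p p) (v : V) : tcoe σ p (homAt p G (tm p f v)) =
      symAct σ p p ((aug K).map f) (θ v) := by
    rw [homAt_freeHom_tm, tcoe_modAct]
    rfl
  -- Since `toKer` is a retraction onto the kernel, it is enough to compare after composing with it,
  -- where pure tensors are available.
  have hF : tcoe σ p ∘ₗ homAt p G ∘ₗ homAt p (kerι (freeProj ρ)) ∘ₗ toKer ρ =
      tcoe σ p ∘ₗ homAt p ψ ∘ₗ toKer ρ := by
    refine free_ext fun f v => ?_
    have h4 (f' : (catLieC K).Hom p p) (hf' : (aug K).map f' = 0) :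
        toKer ρ (tm p f' v) = kerTm ρ f' hf' v := by
      apply kerι_injective
      rw [kerι_toKer, freeProj_tm_of_aug ρ hf', map_zero, map_zero, sub_zero]
      exact (kerι_kerMk _ _ _).symm
    have h5 : tm p f v = tm p ((unitHom (catLieC K)).map ((aug K).map f)) v +
        tm p (augPart p p f) v := by
      rw [← LinearMap.add_apply, ← map_add, ← eq_unit_add_augPart]
    rw [h5, map_add, map_add]
    -- On permutations the comparison is `key`; on the augmentation ideal both sides vanish, because
    -- no generator preserves the degree.
    congr 1
    · generalize (aug K).map f = f
      let A (X : (freeMod (catLieC K) p V).obj.obj ⟨p⟩ →ₗ[K] W) : (symPROP K).Hom p p →ₗ[K] W :=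
        X ∘ₗ (tm p).flip v ∘ₗ (unitHom (catLieC K)).map
      refine LinearMap.congr_fun (f := A (tcoe σ p ∘ₗ homAt p G ∘ₗ homAt p (kerι (freeProj ρ)) ∘ₗ toKer ρ))
        (g := A (tcoe σ p ∘ₗ homAt p ψ ∘ₗ toKer ρ)) (sym_hom_ext fun e => ?_) f
      simp only [A, LinearMap.comp_apply, LinearMap.flip_apply, PROPHom.map_perm]
      rw [kerι_toKer, map_sub, map_sub, hG, hG, tcoe_freeProj_perm, (aug K).map_perm,
        (aug K).map_perm, symAct_perm_self, symAct_perm_self]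
      refine Eq.trans ?_ (key e v).symm
      rw [← Perm.one_def, map_one]
      rfl
    · simp only [LinearMap.comp_apply]
      rw [h4 _ (aug_augPart f)]
      have h6 : homAt p ψ (kerTm ρ _ (aug_augPart f) v) = 0 :=
        ker_hom_eq_zero_of_no_generator ρ σ hno ψ (aug_augPart f) v _
      rw [h6]
      have h7 : homAt p (kerι (freeProj ρ)) (kerTm ρ _ (aug_augPart f) v) =
        tm p (augPart p p f) v := kerι_kerMk _ _ _
      rw [h7, hG, aug_augPart, map_zero, map_zero]
      rfl
  have h8 := LinearMap.congr_fun hF (homAt p (kerι (freeProj ρ)) y)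
  simp only [LinearMap.comp_apply, toKer_kerι] at h8
  rw [homAt_comp]
  exact h8

/-- There are no extensions between concentrated modules unless their degrees are related by a
generator. -/
lemma subsingleton_ext [CharZero K] {m : ℕ} (σ : Representation K (Perm (Fin m)) W)
    (h : ∀ k a b, CasimirGen a b → n = k + a → k + b = m → False) :
    Subsingleton (Abelian.Ext.{u + 1} (trivMod ρ) (trivMod σ) 1) := by
  by_cases hnm : n = m
  · subst hnm
    exact subsingleton_ext_self ρ σ
  · exact subsingleton_ext_of_ne ρ σ hnm h

end ExtSame

/-! ## Counting in tableaux -/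

section Counting

variable {ι : Type} [Fintype ι] {r r' c : ι → ℕ}

open Finset

/-- Within a column r takes distinct values, so at most k of them are below k. If some r' reaches k,
downward closure makes r' take all the values below k; otherwise the right side counts the whole
column. -/
lemma card_column_le (h : ∀ i j, r i = r j → c i = c j → i = j)
    (hdown : ∀ i, ∀ a < r' i, ∃ j, c j = c i ∧ r' j = a) (k b : ℕ) :
    #{i | c i = b ∧ r i < k} ≤ #{i | c i = b ∧ r' i < k} := by
  classical
  by_cases hb : ∀ i, c i = b → r' i < k
  · refine card_le_card fun i hi => ?_
    simp only [mem_filter_univ] at hi ⊢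
    exact ⟨hi.1, hb i hi.1⟩
  push Not at hb
  obtain ⟨i₀, h1, h2⟩ := hb
  calc #{i | c i = b ∧ r i < k} ≤ #(range k) := by
        refine card_le_card_of_injOn r (fun i hi => ?_) fun i hi j hj hij => ?_
        · simp only [coe_filter, Set.mem_ofPred_eq, mem_univ, true_and] at hi
          simpa using hi.2
        · simp only [coe_filter, Set.mem_ofPred_eq, mem_univ, true_and] at hi hj
          exact h i j hij (hi.1.trans hj.1.symm)
    _ ≤ #(({i | c i = b ∧ r' i < k} : Finset ι).image r') := by
        refine card_le_card fun a ha => ?_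
        obtain ⟨j, hj, rfl⟩ := hdown i₀ a ((mem_range.1 ha).trans_le h2)
        exact mem_image_of_mem _ (by simpa [hj, h1] using ha)
    _ ≤ _ := card_image_le

lemma card_lt_eq_sum (c : ι → ℕ) (p : ι → Prop) [DecidablePred p] :
    #{i | p i} = ∑ b ∈ univ.image c, #{i | c i = b ∧ p i} := by
  rw [card_eq_sum_card_fiberwise (f := c) (t := univ.image c) fun i _ => by simp]
  refine sum_congr rfl fun b _ => ?_
  rw [filter_filter]
  simp only [and_comm]

lemma card_rows_le (h : ∀ i j, r i = r j → c i = c j → i = j)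
    (hdown : ∀ i, ∀ a < r' i, ∃ j, c j = c i ∧ r' j = a) (k : ℕ) :
    #{i | r i < k} ≤ #{i | r' i < k} := by
  rw [card_lt_eq_sum c, card_lt_eq_sum c fun i => r' i < k]
  exact sum_le_sum fun b _ => card_column_le h hdown k b

/-- Equality of the totals forces equality in every column, since each column satisfies the
inequality. Comparing the thresholds r i and r i + 1 then shows that the value r i is taken by r' in
the column of i. -/
lemma exists_same_position (h : ∀ i j, r i = r j → c i = c j → i = j)
    (hdown : ∀ i, ∀ a < r' i, ∃ j, c j = c i ∧ r' j = a)
    (heq : ∀ k, #{i | r i < k} = #{i | r' i < k}) (i : ι) : ∃ j, r' j = r i ∧ c j = c i := by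
  classical
  have hk (k : ℕ) : #{j | c j = c i ∧ r j < k} = #{j | c j = c i ∧ r' j < k} := by
    have h1 := heq k
    rw [card_lt_eq_sum c, card_lt_eq_sum c fun i => r' i < k] at h1
    exact (sum_eq_sum_iff_of_le fun b _ => card_column_le h hdown k b).1 h1 _ (by simp)
  by_contra! hne
  have h1 : univ.filter (fun j => c j = c i ∧ r' j < r i + 1) =
      univ.filter fun j => c j = c i ∧ r' j < r i := by
    ext j
    simp only [mem_filter_univ]
    refine ⟨fun hj => ⟨hj.1, ?_⟩, fun hj => ⟨hj.1, by omega⟩⟩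
    have h2 : r' j ≠ r i := fun h' => hne j h' hj.1
    have h3 := hj.2
    omega
  have h2 : #{j | c j = c i ∧ r j < r i} < #{j | c j = c i ∧ r j < r i + 1} := by
    refine card_lt_card (ssubset_iff_of_subset (fun j hj => ?_) |>.2 ⟨i, by simp, by simp⟩)
    simp only [mem_filter_univ] at hj ⊢
    exact ⟨hj.1, by omega⟩
  rw [hk, hk, h1] at h2
  exact lt_irrefl _ h2

end Counting

/-! ## The canonical tableau -/

section Tableau

variable {n : ℕ} (lam : n.Partition)

lemma canonical_injective {i j : Fin n} (hr : rowIndex lam i = rowIndex lam j)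
    (hc : colIndex lam i = colIndex lam j) : i = j := by
  have h1 : (rows lam).index i = (rows lam).index j := Fin.ext hr
  rw [colIndex, colIndex, Composition.coe_invEmbedding, Composition.coe_invEmbedding, h1] at hc
  have hi := (rows lam).sizeUpTo_index_le i
  have hj := (rows lam).sizeUpTo_index_le j
  rw [h1] at hi
  exact Fin.ext (by omega)

/-- Rows higher up are at least as long, so a column has no gaps above any of its cells. -/
lemma canonical_down (i : Fin n) (a : ℕ) (ha : a < rowIndex lam i) :
    ∃ j, colIndex lam j = colIndex lam i ∧ rowIndex lam j = a := by
  have ha' : a < (rows lam).length := ha.trans ((rows lam).index i).2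
  have hs : (rows lam).blocks.Pairwise (· ≥ ·) := Multiset.pairwise_sort _ _
  have hle : (rows lam).blocksFun ((rows lam).index i) ≤ (rows lam).blocksFun ⟨a, ha'⟩ :=
    List.pairwise_iff_get.1 hs ⟨a, ha'⟩ ((rows lam).index i) ha
  have hlt : colIndex lam i < (rows lam).blocksFun ⟨a, ha'⟩ :=
    ((rows lam).invEmbedding i).2.trans_le hle
  refine ⟨(rows lam).embedding ⟨a, ha'⟩ ⟨colIndex lam i, hlt⟩, ?_, ?_⟩
  · exact (rows lam).invEmbedding_comp _ _
  · rw [rowIndex, (rows lam).index_embedding]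

open Finset in
lemma card_rowIndex_lt (k : ℕ) : #{i | rowIndex lam i < k} = (rows lam).sizeUpTo k := by
  have h (i : Fin n) : rowIndex lam i < k ↔ (i : ℕ) < (rows lam).sizeUpTo k := by
    constructor
    · intro h
      exact ((rows lam).lt_sizeUpTo_index_succ i).trans_le ((rows lam).monotone_sizeUpTo h)
    · intro h
      by_contra! h'
      exact absurd (((rows lam).monotone_sizeUpTo h').trans ((rows lam).sizeUpTo_index_le i))
        (not_le.2 h)
  simp only [h]
  rw [Fin.card_filter_val_lt, min_eq_right ((rows lam).sizeUpTo_le k)]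

lemma list_eq_of_sum_take : ∀ {l l' : List ℕ}, (∀ x ∈ l, 0 < x) → (∀ x ∈ l', 0 < x) →
    (∀ k, (l.take k).sum = (l'.take k).sum) → l = l'
  | [], [], _, _, _ => rfl
  | [], y :: l', _, h', h => by
    have := h 1
    have := h' y (by simp)
    simp_all
  | x :: l, [], h', _, h => by
    have := h 1
    have := h' x (by simp)
    simp_all
  | x :: l, y :: l', h1, h2, h => by
    obtain rfl : x = y := by simpa using h 1
    congr 1
    refine list_eq_of_sum_take (fun z hz => h1 z (by simp [hz])) (fun z hz => h2 z (by simp [hz]))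
      fun k => ?_
    simpa using h (k + 1)

/-- The dominance order on partitions. -/
def Dominated (lam mu : n.Partition) : Prop :=
  ∀ k, (rows lam).sizeUpTo k ≤ (rows mu).sizeUpTo k

lemma Dominated.antisymm {lam mu : n.Partition} (h : Dominated lam mu) (h' : Dominated mu lam) :
    lam = mu := by
  have h1 : (rows lam).blocks = (rows mu).blocks :=
    list_eq_of_sum_take (fun _ => (rows lam).blocks_pos) (fun _ => (rows mu).blocks_pos)
      fun k => (h k).antisymm (h' k)
  refine Nat.Partition.ext ?_
  rw [← lam.parts.sort_eq (· ≥ ·), ← mu.parts.sort_eq (· ≥ ·)]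
  exact congrArg _ h1

open Equiv

/-- The letters in the first k rows of the first tableau occupy at most k cells of each column of
the second, so there are no more of them than cells in the first k rows of the second diagram. -/
lemma dominated_of_injective {lam mu : n.Partition} (σ : Perm (Fin n))
    (h : ∀ i j, rowIndex lam i = rowIndex lam j → colIndex mu (σ i) = colIndex mu (σ j) → i = j) :
    Dominated lam mu := by
  intro k
  have h1 := card_rows_le (r := rowIndex lam) (r' := rowIndex mu ∘ σ) (c := colIndex mu ∘ σ) h
    (fun i a ha => by
      obtain ⟨j, h2, h3⟩ := canonical_down mu (σ i) a ha
      exact ⟨σ⁻¹ j, by simpa using h2, by simpa using h3⟩) k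
  rw [card_rowIndex_lt] at h1
  refine h1.trans_eq ?_
  rw [← card_rowIndex_lt]
  exact Finset.card_equiv σ fun i => by simp

-- For equal shapes the count is an equality. The row permutation p moves each i, within its row, to
-- the column of σ i; what remains of σ preserves columns.
variable {lam} in
lemma exists_row_column_perm (σ : Perm (Fin n))
    (h : ∀ i j, rowIndex lam i = rowIndex lam j → colIndex lam (σ i) = colIndex lam (σ j) → i = j) :
    ∃ p q : Perm (Fin n), (∀ i, rowIndex lam (p i) = rowIndex lam i) ∧
      (∀ i, colIndex lam (q i) = colIndex lam i) ∧ σ = q * p := by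
  have h1 := exists_same_position (r := rowIndex lam) (r' := rowIndex lam ∘ σ)
    (c := colIndex lam ∘ σ) h
    (fun i a ha => by
      obtain ⟨j, h2, h3⟩ := canonical_down lam (σ i) a ha
      exact ⟨σ⁻¹ j, by simpa using h2, by simpa using h3⟩)
    fun k => Finset.card_equiv σ⁻¹ fun i => by simp
  choose f hr hc using h1
  have hf : Function.Injective (σ ∘ f) := fun i j hij => by
    have hij' : σ (f i) = σ (f j) := hij
    refine h i j ?_ ?_
    · rw [← hr i, ← hr j]
      exact congrArg (rowIndex lam) hij'
    · exact (hc i).symm.trans ((congrArg (colIndex lam) hij').trans (hc j))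
  let p : Perm (Fin n) := Equiv.ofBijective _ (Finite.injective_iff_bijective.1 hf)
  refine ⟨p, σ * p⁻¹, hr, fun i => ?_, by simp⟩
  have h2 := hc (p⁻¹ i)
  have h3 : σ (f (p⁻¹ i)) = i := p.apply_symm_apply i
  change colIndex lam (σ (f (p⁻¹ i))) = colIndex lam (σ (p⁻¹ i)) at h2
  rw [h3] at h2
  exact h2.symm

end Tableau

/-! ## Young symmetrizers -/

section Young

open Equiv

variable {n : ℕ} (lam mu : n.Partition)

variable (K) in
open Classical in
/-- The sum of the row stabilizer of the canonical tableau. -/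
def rowSum : MonoidAlgebra K (Perm (Fin n)) :=
  ∑ σ : Perm (Fin n) with ∀ i, rowIndex lam (σ i) = rowIndex lam i, MonoidAlgebra.single σ 1

variable (K) in
open Classical in
/-- The signed sum of the column stabilizer of the canonical tableau. -/
def colSum : MonoidAlgebra K (Perm (Fin n)) :=
  ∑ τ : Perm (Fin n) with ∀ i, colIndex lam (τ i) = colIndex lam i,
    MonoidAlgebra.single τ ((Perm.sign τ : ℤ) : K)

lemma youngSymmetrizer_eq : youngSymmetrizer K lam = rowSum K lam * colSum K lam := rfl

lemma rowSum_mul_single {p : Perm (Fin n)} (hp : ∀ i, rowIndex lam (p i) = rowIndex lam i) :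
    rowSum K lam * MonoidAlgebra.single p 1 = rowSum K lam := by
  rw [rowSum, Finset.sum_mul]
  simp only [MonoidAlgebra.single_mul_single, mul_one]
  refine Finset.sum_equiv (Equiv.mulRight p) (fun σ => ?_) fun σ _ => rfl
  simp only [Finset.mem_filter_univ, Equiv.coe_mulRight, Perm.mul_apply]
  refine ⟨fun h i => (h _).trans (hp i), fun h i => ?_⟩
  have h1 := h (p⁻¹ i)
  have h2 := hp (p⁻¹ i)
  rw [show p (p⁻¹ i) = i from p.apply_symm_apply i] at h1 h2
  exact h1.trans h2.symm

lemma single_mul_rowSum {p : Perm (Fin n)} (hp : ∀ i, rowIndex lam (p i) = rowIndex lam i) :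
    MonoidAlgebra.single p 1 * rowSum K lam = rowSum K lam := by
  rw [rowSum, Finset.mul_sum]
  simp only [MonoidAlgebra.single_mul_single, mul_one]
  refine Finset.sum_equiv (Equiv.mulLeft p) (fun σ => ?_) fun σ _ => rfl
  simp only [Finset.mem_filter_univ, Equiv.coe_mulLeft, Perm.mul_apply, hp]

lemma single_mul_colSum {q : Perm (Fin n)} (hq : ∀ i, colIndex lam (q i) = colIndex lam i) :
    MonoidAlgebra.single q 1 * colSum K lam = ((Perm.sign q : ℤ) : K) • colSum K lam := by
  rw [colSum, Finset.mul_sum, Finset.smul_sum]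
  simp only [MonoidAlgebra.single_mul_single, one_mul, MonoidAlgebra.smul_single, smul_eq_mul]
  refine Finset.sum_equiv (Equiv.mulLeft q) (fun σ => ?_) fun σ _ => ?_
  · simp only [Finset.mem_filter_univ, Equiv.coe_mulLeft, Perm.mul_apply, hq]
  · have h : ((Perm.sign q : ℤ) : K) * ((Perm.sign (q * σ) : ℤ) : K) = ((Perm.sign σ : ℤ) : K) := by
      rw [Perm.sign_mul, Units.val_mul, Int.cast_mul, ← mul_assoc, ← Int.cast_mul, ← Units.val_mul,
        Int.units_mul_self]
      simp
    rw [Equiv.coe_mulLeft, h]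

variable {lam mu}

/-- The transposition of i and j is absorbed by the row sum. Moved past σ⁻¹, it becomes the
transposition of σ i and σ j, which changes the sign of the column sum, so the product is its own
negative. -/
lemma rowSum_single_colSum_eq_zero [CharZero K] {σ : Perm (Fin n)} {i j : Fin n} (hij : i ≠ j)
    (hr : rowIndex lam i = rowIndex lam j) (hc : colIndex mu (σ i) = colIndex mu (σ j)) :
    rowSum K lam * MonoidAlgebra.single σ⁻¹ 1 * colSum K mu = 0 := by
  have h1 : rowSum K lam * MonoidAlgebra.single (swap i j) 1 = rowSum K lam :=
    rowSum_mul_single lam fun x => by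
      by_cases hi : x = i
      · rw [hi, swap_apply_left, hr]
      by_cases hj : x = j
      · rw [hj, swap_apply_right, hr]
      rw [swap_apply_of_ne_of_ne hi hj]
  have h2 : MonoidAlgebra.single (swap (σ i) (σ j)) 1 * colSum K mu = -colSum K mu := by
    rw [single_mul_colSum mu fun x => ?_]
    · rw [Perm.sign_swap (σ.injective.ne hij)]
      simp
    by_cases hi : x = σ i
    · rw [hi, swap_apply_left, hc]
    by_cases hj : x = σ j
    · rw [hj, swap_apply_right, hc]
    rw [swap_apply_of_ne_of_ne hi hj]
  have h3 : swap i j * σ⁻¹ = σ⁻¹ * swap (σ i) (σ j) := by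
    rw [Equiv.swap_apply_apply]
    simp [mul_assoc]
  have h4 : rowSum K lam * MonoidAlgebra.single σ⁻¹ 1 * colSum K mu =
      -(rowSum K lam * MonoidAlgebra.single σ⁻¹ 1 * colSum K mu) := by
    have h5 : MonoidAlgebra.single (swap i j) (1 : K) * MonoidAlgebra.single σ⁻¹ 1 =
        MonoidAlgebra.single σ⁻¹ 1 * MonoidAlgebra.single (swap (σ i) (σ j)) 1 := by
      rw [MonoidAlgebra.single_mul_single, MonoidAlgebra.single_mul_single, h3]
    conv_lhs => rw [← h1, mul_assoc (rowSum K lam), h5, mul_assoc, mul_assoc, h2]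
    simp [mul_assoc]
  have h6 : (2 : K) • (rowSum K lam * MonoidAlgebra.single σ⁻¹ 1 * colSum K mu) = 0 := by
    rw [two_smul]
    nth_rewrite 1 [h4]
    exact neg_add_cancel _
  exact (smul_eq_zero.1 h6).resolve_left two_ne_zero

lemma single_eq_smul {G : Type} (g : G) (c : K) :
    MonoidAlgebra.single g c = c • MonoidAlgebra.single g (1 : K) := by
  rw [MonoidAlgebra.smul_single, smul_eq_mul, mul_one]

/-- Without dominance, every relative position of the two tableaux has two letters sharing a row of
the first and a column of the second. -/
lemma rowSum_mul_mul_colSum_eq_zero [CharZero K] (h : ¬ Dominated lam mu)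
    (x : MonoidAlgebra K (Perm (Fin n))) : rowSum K lam * x * colSum K mu = 0 := by
  induction x using MonoidAlgebra.induction_linear with
  | zero => rw [mul_zero, zero_mul]
  | add x y hx hy => rw [mul_add, add_mul, hx, hy, add_zero]
  | single σ c =>
    by_cases h1 : ∀ i j, rowIndex lam i = rowIndex lam j →
        colIndex mu (σ⁻¹ i) = colIndex mu (σ⁻¹ j) → i = j
    · exact absurd (dominated_of_injective σ⁻¹ h1) h
    · push Not at h1
      obtain ⟨i, j, hr, hc, hij⟩ := h1
      have h2 := rowSum_single_colSum_eq_zero (K := K) hij hr hc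
      rw [inv_inv] at h2
      rw [single_eq_smul, mul_smul_comm, smul_mul_assoc, h2, smul_zero]

/-- For each group element either two letters share a row and a column, giving zero, or the element
is a row permutation times a column permutation, and these are absorbed up to sign. -/
lemma rowSum_mul_mul_colSum [CharZero K] (x : MonoidAlgebra K (Perm (Fin n))) :
    ∃ c : K, rowSum K lam * x * colSum K lam = c • youngSymmetrizer K lam := by
  induction x using MonoidAlgebra.induction_linear with
  | zero => exact ⟨0, by rw [mul_zero, zero_mul, zero_smul]⟩
  | add x y hx hy =>
    obtain ⟨a, ha⟩ := hx
    obtain ⟨b, hb⟩ := hy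
    exact ⟨a + b, by rw [mul_add, add_mul, ha, hb, add_smul]⟩
  | single σ c =>
    suffices h : ∃ d : K, rowSum K lam * MonoidAlgebra.single σ 1 * colSum K lam =
        d • youngSymmetrizer K lam by
      obtain ⟨d, hd⟩ := h
      exact ⟨c * d, by
        rw [mul_smul, ← hd, ← smul_mul_assoc, ← mul_smul_comm, ← single_eq_smul]⟩
    by_cases h1 : ∀ i j, rowIndex lam i = rowIndex lam j →
        colIndex lam (σ⁻¹ i) = colIndex lam (σ⁻¹ j) → i = j
    · obtain ⟨p, q, hp, hq, h2⟩ := exists_row_column_perm σ⁻¹ h1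
      have hp' (i) : rowIndex lam (p⁻¹ i) = rowIndex lam i := by
        exact (hp (p⁻¹ i)).symm.trans (congrArg _ (p.apply_symm_apply i))
      have hq' (i) : colIndex lam (q⁻¹ i) = colIndex lam i := by
        exact (hq (q⁻¹ i)).symm.trans (congrArg _ (q.apply_symm_apply i))
      have h3 : MonoidAlgebra.single σ (1 : K) =
          MonoidAlgebra.single p⁻¹ 1 * MonoidAlgebra.single q⁻¹ 1 := by
        rw [MonoidAlgebra.single_mul_single, ← mul_inv_rev, ← h2, inv_inv, mul_one]
      exact ⟨_, by rw [h3, ← mul_assoc, rowSum_mul_single lam hp', mul_assoc,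
        single_mul_colSum lam hq', mul_smul_comm, youngSymmetrizer_eq]⟩
    · push Not at h1
      obtain ⟨i, j, hr, hc, hij⟩ := h1
      have h2 := rowSum_single_colSum_eq_zero (K := K) hij hr hc
      rw [inv_inv] at h2
      exact ⟨0, by rw [h2, zero_smul]⟩

variable (lam)

/-- A row permutation and a column permutation that are inverse to each other fix both coordinates
of every cell, so the identity arises only once. -/
lemma coeff_youngSymmetrizer_one : (youngSymmetrizer K lam).coeff 1 = 1 := by
  classical
  rw [youngSymmetrizer_eq, rowSum, colSum, Finset.sum_mul_sum, MonoidAlgebra.coeff_sum,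
    Finsupp.finsetSum_apply, Finset.sum_eq_single 1]
  · rw [MonoidAlgebra.coeff_sum, Finsupp.finsetSum_apply, Finset.sum_eq_single 1]
    · simp [MonoidAlgebra.single_mul_single]
    · intro τ _ hτ
      simp [MonoidAlgebra.single_mul_single, hτ]
    · simp
  · intro σ hσ h1
    rw [MonoidAlgebra.coeff_sum, Finsupp.finsetSum_apply]
    refine Finset.sum_eq_zero fun τ hτ => ?_
    rw [MonoidAlgebra.single_mul_single, MonoidAlgebra.coeff_single, Finsupp.single_apply, if_neg]
    intro h2
    apply h1
    obtain rfl : τ = σ⁻¹ := (inv_eq_of_mul_eq_one_right h2).symm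
    simp only [Finset.mem_filter_univ] at hσ hτ
    ext i
    have h3 := hτ (σ i)
    rw [show σ⁻¹ (σ i) = i from σ.symm_apply_apply i] at h3
    rw [Perm.one_apply, canonical_injective lam (hσ i) h3.symm]
  · simp

lemma youngSymmetrizer_ne_zero : youngSymmetrizer K lam ≠ 0 := fun h => by
  have := coeff_youngSymmetrizer_one (K := K) lam
  rw [h] at this
  simp at this

lemma trace_mulRight {G : Type} [Group G] [Fintype G] (c : MonoidAlgebra K G) :
    LinearMap.trace K _ (LinearMap.mulRight K c) = Fintype.card G * c.coeff 1 := by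
  classical
  rw [LinearMap.trace_eq_matrix_trace K (MonoidAlgebra.basis G K), Matrix.trace]
  have h (g : G) : (LinearMap.toMatrix (MonoidAlgebra.basis G K) (MonoidAlgebra.basis G K)
      (LinearMap.mulRight K c)).diag g = c.coeff 1 := by
    rw [Matrix.diag_apply, LinearMap.toMatrix_apply, MonoidAlgebra.basis_apply]
    change (MonoidAlgebra.single g 1 * c).coeff g = _
    simp
  rw [Finset.sum_congr rfl fun g _ => h g]
  simp

lemma exists_youngSymmetrizer_mul_mul [CharZero K] (x : MonoidAlgebra K (Perm (Fin n))) :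
    ∃ a : K, youngSymmetrizer K lam * x * youngSymmetrizer K lam = a • youngSymmetrizer K lam := by
  obtain ⟨a, ha⟩ := rowSum_mul_mul_colSum (lam := lam) (colSum K lam * x * rowSum K lam)
  exact ⟨a, by simpa [youngSymmetrizer_eq, mul_assoc] using ha⟩

lemma youngSymmetrizer_mul_mul_eq_zero [CharZero K] (h : ¬ Dominated lam mu)
    (x : MonoidAlgebra K (Perm (Fin n))) :
    youngSymmetrizer K lam * x * youngSymmetrizer K mu = 0 := by
  have := rowSum_mul_mul_colSum_eq_zero (K := K) h (colSum K lam * x * rowSum K mu)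
  simpa [youngSymmetrizer_eq, mul_assoc] using this

/-- If the square were zero, right multiplication by the symmetrizer would be nilpotent. Its trace
is n! times the coefficient of the identity, that is n!, which is nonzero in characteristic zero. -/
lemma youngSymmetrizer_mul_self [CharZero K] :
    ∃ a : K, a ≠ 0 ∧ youngSymmetrizer K lam * youngSymmetrizer K lam =
      a • youngSymmetrizer K lam := by
  obtain ⟨a, ha⟩ := exists_youngSymmetrizer_mul_mul (K := K) lam 1
  rw [mul_one] at ha
  refine ⟨a, ?_, ha⟩
  rintro rfl
  rw [zero_smul] at ha
  have h1 : IsNilpotent (LinearMap.mulRight K (youngSymmetrizer K lam)) := by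
    refine ⟨2, LinearMap.ext fun x => ?_⟩
    simp [pow_two, mul_assoc, ha]
  have : Module.Finite K (MonoidAlgebra K (Perm (Fin n))) :=
    Module.Finite.of_basis (MonoidAlgebra.basis _ _)
  have h2 := (LinearMap.isNilpotent_trace_of_isNilpotent h1).eq_zero
  rw [trace_mulRight, coeff_youngSymmetrizer_one, mul_one] at h2
  exact Fintype.card_ne_zero (Nat.cast_eq_zero.1 h2)

end Young

/-! ## Specht modules -/

section SpechtModules

open Equiv

variable {n : ℕ} (lam mu : n.Partition)

instance : Module.Finite K (MonoidAlgebra K (Perm (Fin n))) :=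
  Module.Finite.of_basis (MonoidAlgebra.basis _ _)

instance : FiniteDimensional K (Specht K lam) :=
  Module.Finite.of_injective
    ((Ideal.span {youngSymmetrizer K lam}).subtype.restrictScalars K) Subtype.val_injective

variable (K) in
/-- The Young symmetrizer as an element of the Specht module. -/
def spechtGen : Specht K lam := ⟨youngSymmetrizer K lam, Ideal.subset_span rfl⟩

variable {lam mu}

lemma exists_smul_spechtGen (s : Specht K lam) :
    ∃ x : MonoidAlgebra K (Perm (Fin n)), s = x • spechtGen K lam := by
  obtain ⟨x, hx⟩ := Ideal.mem_span_singleton'.1 s.2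
  exact ⟨x, Subtype.ext hx.symm⟩

lemma intertwining_smul (φ : (spechtRep K lam).IntertwiningMap (spechtRep K mu))
    (x : MonoidAlgebra K (Perm (Fin n))) (s : Specht K lam) : φ (x • s) = x • φ s := by
  induction x using MonoidAlgebra.induction_linear with
  | zero => rw [zero_smul, zero_smul, map_zero]
  | add x y hx hy => rw [add_smul, add_smul, map_add, hx, hy]
  | single g c =>
    rw [single_eq_smul, smul_assoc, smul_assoc, map_smul]
    exact congrArg _ (Representation.IntertwiningMap.isIntertwining _ _ φ g s)

lemma intertwining_ext {φ ψ : (spechtRep K lam).IntertwiningMap (spechtRep K mu)}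
    (h : φ (spechtGen K lam) = ψ (spechtGen K lam)) : φ = ψ := by
  refine Representation.IntertwiningMap.ext (LinearMap.ext fun s => ?_)
  change φ s = ψ s
  obtain ⟨x, rfl⟩ := exists_smul_spechtGen s
  rw [intertwining_smul, intertwining_smul, h]

/-- As the generator c satisfies c² = ac with a ≠ 0, its image equals a⁻¹ c times itself.
Equivariant maps are thus controlled by the products c x c'. -/
lemma intertwining_spechtGen [CharZero K]
    (φ : (spechtRep K lam).IntertwiningMap (spechtRep K mu)) :
    ∃ x, (φ (spechtGen K lam) : MonoidAlgebra K (Perm (Fin n))) =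
      youngSymmetrizer K lam * x * youngSymmetrizer K mu := by
  obtain ⟨a, ha, h⟩ := youngSymmetrizer_mul_self (K := K) lam
  obtain ⟨y, hy⟩ := exists_smul_spechtGen (φ (spechtGen K lam))
  have h1 : youngSymmetrizer K lam • spechtGen K lam = a • spechtGen K lam := Subtype.ext h
  have h2 : a • φ (spechtGen K lam) = youngSymmetrizer K lam • φ (spechtGen K lam) := by
    rw [← map_smul, ← h1, intertwining_smul]
  refine ⟨a⁻¹ • y, ?_⟩
  have h3 : φ (spechtGen K lam) = a⁻¹ • (youngSymmetrizer K lam • φ (spechtGen K lam)) := by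
    rw [← h2, smul_smul, inv_mul_cancel₀ ha, one_smul]
  rw [h3, hy]
  change a⁻¹ • (youngSymmetrizer K lam * (y * youngSymmetrizer K mu)) = _
  rw [mul_smul_comm, smul_mul_assoc, mul_assoc]

lemma finrank_intertwiningMap_self [CharZero K] :
    Module.finrank K ((spechtRep K lam).IntertwiningMap (spechtRep K lam)) = 1 := by
  let ψ := LinearMap.toSpanSingleton K _ (Representation.IntertwiningMap.id (spechtRep K lam))
  have hψ (a : K) : ψ a (spechtGen K lam) = a • spechtGen K lam := rfl
  have h1 : Function.Bijective ψ := by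
    refine ⟨fun a b hab => ?_, fun φ => ?_⟩
    · have h2 : a • spechtGen K lam = b • spechtGen K lam := by rw [← hψ, ← hψ, hab]
      have h3 : spechtGen K lam ≠ 0 := fun h0 =>
        youngSymmetrizer_ne_zero (K := K) lam (congrArg Subtype.val h0)
      exact smul_left_injective K h3 h2
    · obtain ⟨x, hx⟩ := intertwining_spechtGen φ
      obtain ⟨a, ha⟩ := exists_youngSymmetrizer_mul_mul (K := K) lam x
      exact ⟨a, intertwining_ext (Subtype.ext ((hx.trans ha).symm))⟩
  rw [← (LinearEquiv.ofBijective ψ h1).finrank_eq, Module.finrank_self]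

lemma finrank_intertwiningMap_of_not_dominated [CharZero K] (h : ¬ Dominated lam mu) :
    Module.finrank K ((spechtRep K lam).IntertwiningMap (spechtRep K mu)) = 0 := by
  have : Subsingleton ((spechtRep K lam).IntertwiningMap (spechtRep K mu)) := by
    refine subsingleton_of_forall_eq 0 fun φ => intertwining_ext (Subtype.ext ?_)
    obtain ⟨x, hx⟩ := intertwining_spechtGen φ
    rw [hx, youngSymmetrizer_mul_mul_eq_zero _ h]
    rfl
  exact Module.finrank_zero_of_subsingleton

/-- Two different partitions cannot dominate each other, and the dimension does not depend on the
direction of the maps. -/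
lemma finrank_intertwiningMap_of_ne [CharZero K] (h : lam ≠ mu) :
    Module.finrank K ((spechtRep K lam).IntertwiningMap (spechtRep K mu)) = 0 := by
  by_cases h1 : Dominated lam mu
  · rw [finrank_intertwiningMap_symm]
    exact finrank_intertwiningMap_of_not_dominated fun h2 => h (h1.antisymm h2)
  · exact finrank_intertwiningMap_of_not_dominated h1

lemma sum_char_specht [CharZero K] [DecidableEq n.Partition] :
    ∑ g, (spechtRep K lam).character g * (spechtRep K mu).character g =
      if lam = mu then (Fintype.card (Perm (Fin n)) : K) else 0 := by
  have h := card_mul_finrank_intertwiningMap (spechtRep K mu) (spechtRep K lam)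
  simp only [char_perm_inv] at h
  rw [← h]
  split_ifs with h1
  · subst h1
    rw [finrank_intertwiningMap_self, Nat.cast_one, mul_one]
  · rw [finrank_intertwiningMap_of_ne (Ne.symm h1), Nat.cast_zero, mul_zero]

/-! ## Completeness of the characters of the Specht modules -/

/-- The characters of the Specht modules span the class functions. -/
lemma exists_char_expansion [CharZero K] (A : Perm (Fin n) → K)
    (hA : ∀ g h, IsConj g h → A g = A h) :
    -- Class functions factor through the cycle type, so they are regarded as functions on
    -- partitions, extended by zero.
    ∃ α : n.Partition → K, ∀ g, A g = ∑ lam, α lam * (spechtRep K lam).character g := by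
  classical
  let T : Perm (Fin n) → (Fintype.card (Fin n)).Partition := Perm.partition
  have hT (B : Perm (Fin n) → K) (hB : ∀ g h, IsConj g h → B g = B h) :
      ∀ g, Function.extend T B 0 (T g) = B g := fun g =>
    Function.FactorsThrough.extend_apply
      (fun g h hgh => hB g h (Perm.partition_eq_of_isConj.2 hgh)) _ _
  have hchar (lam : n.Partition) (g h : Perm (Fin n)) (hgh : IsConj g h) :
      (spechtRep K lam).character g = (spechtRep K lam).character h := by
    obtain ⟨c, rfl⟩ := isConj_iff.1 hgh
    rw [Representation.char_conj]
  let x (lam : n.Partition) : (Fintype.card (Fin n)).Partition → K :=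
    Function.extend T (spechtRep K lam).character 0
  have hx (lam g) : x lam (T g) = (spechtRep K lam).character g := hT _ (hchar lam) g
  have hli : LinearIndependent K x := by
    rw [Fintype.linearIndependent_iff]
    intro a ha mu
    have h1 : ∑ g, (∑ lam, a lam * (spechtRep K lam).character g) * (spechtRep K mu).character g =
        a mu * Fintype.card (Perm (Fin n)) := by
      simp only [Finset.sum_mul, mul_assoc]
      rw [Finset.sum_comm]
      simp only [← Finset.mul_sum, sum_char_specht]
      simp
    have h2 (g : Perm (Fin n)) : ∑ lam, a lam * (spechtRep K lam).character g = 0 := by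
      have := congrFun ha (T g)
      simpa [hx] using this
    simp only [h2, zero_mul, Finset.sum_const_zero] at h1
    exact (mul_eq_zero.1 h1.symm).resolve_right (Nat.cast_ne_zero.2 Fintype.card_ne_zero)
  -- The independent characters are indexed by the partitions, and their number is the dimension of
  -- the space of functions on partitions.
  have hspan : Submodule.span K (Set.range x) = ⊤ :=
    hli.span_eq_top_of_card_eq_finrank' (by
      rw [Module.finrank_fintype_fun_eq_card]
      exact Fintype.card_congr (Equiv.cast (by rw [Fintype.card_fin])))
  obtain ⟨α, hα⟩ := (Submodule.mem_span_range_iff_exists_fun K).1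
    (hspan ▸ Submodule.mem_top : Function.extend T A 0 ∈ Submodule.span K (Set.range x))
  refine ⟨α, fun g => ?_⟩
  rw [← hT A hA g, ← hα]
  simp [hx]

/-- Completeness of the characters of the Specht modules. -/
lemma sum_char_mul_sum_char [CharZero K] (A B : Perm (Fin n) → K)
    (hA : ∀ g h, IsConj g h → A g = A h) :
    ∑ lam : n.Partition, (∑ g, A g * (spechtRep K lam).character g) *
      (∑ g, B g * (spechtRep K lam).character g) =
      Fintype.card (Perm (Fin n)) * ∑ g, A g * B g := by
  classical
  obtain ⟨α, hα⟩ := exists_char_expansion A hA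
  have h1 (mu : n.Partition) : ∑ g, A g * (spechtRep K mu).character g =
      α mu * Fintype.card (Perm (Fin n)) := by
    simp only [hα, Finset.sum_mul, mul_assoc]
    rw [Finset.sum_comm]
    simp only [← Finset.mul_sum, sum_char_specht]
    simp
  simp only [h1]
  simp only [hα, Finset.sum_mul]
  conv_rhs => rw [Finset.sum_comm, Finset.mul_sum]
  refine Finset.sum_congr rfl fun lam _ => ?_
  rw [mul_comm (α lam), mul_assoc, Finset.mul_sum]
  congr 1
  refine Finset.sum_congr rfl fun g _ => ?_
  ring

/-! ## The Specht modules of the partitions of size at most two -/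

/-- If the group acts on the generator by scalars, the Specht module is a line and its character is
that scalar. This settles the three small partitions that occur. -/
lemma char_of_scalar (χ : Perm (Fin n) → K)
    (h : ∀ g, MonoidAlgebra.single g 1 * youngSymmetrizer K lam = χ g • youngSymmetrizer K lam)
    (g : Perm (Fin n)) : (spechtRep K lam).character g = χ g := by
  have h1 (x : MonoidAlgebra K (Perm (Fin n))) : ∃ a : K,
      x * youngSymmetrizer K lam = a • youngSymmetrizer K lam := by
    induction x using MonoidAlgebra.induction_linear with
    | zero => exact ⟨0, by rw [zero_mul, zero_smul]⟩
    | add x y hx hy =>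
      obtain ⟨a, ha⟩ := hx
      obtain ⟨b, hb⟩ := hy
      exact ⟨a + b, by rw [add_mul, ha, hb, add_smul]⟩
    | single g c => exact ⟨c * χ g, by rw [single_eq_smul, smul_mul_assoc, h, smul_smul]⟩
  have h2 (s : Specht K lam) : ∃ a : K, a • spechtGen K lam = s := by
    obtain ⟨x, rfl⟩ := exists_smul_spechtGen s
    obtain ⟨a, ha⟩ := h1 x
    exact ⟨a, Subtype.ext ha.symm⟩
  have h3 : spechtGen K lam ≠ 0 := fun h0 =>
    youngSymmetrizer_ne_zero (K := K) lam (congrArg Subtype.val h0)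
  have h4 : Module.finrank K (Specht K lam) = 1 :=
    finrank_eq_one_iff'.2 ⟨spechtGen K lam, h3, h2⟩
  have h5 : spechtRep K lam g = χ g • LinearMap.id := by
    ext1 s
    obtain ⟨a, rfl⟩ := h2 s
    rw [map_smul, LinearMap.smul_apply, LinearMap.id_apply, smul_comm]
    exact congrArg _ (Subtype.ext (h g))
  rw [Representation.character, h5, map_smul, LinearMap.trace_id, h4]
  simp

lemma char_part1 [CharZero K] (g : Perm (Fin 1)) : (spechtRep K part1).character g = 1 :=
  char_of_scalar (fun _ => 1) (fun g => by
    rw [Subsingleton.elim g 1, ← MonoidAlgebra.one_def, one_mul, one_smul]) g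

lemma length_rows (lam : n.Partition) : (rows lam).length = lam.parts.card := by
  change (lam.parts.sort (· ≥ ·)).length = _
  exact Multiset.length_sort _

lemma char_part2 [CharZero K] (g : Perm (Fin 2)) : (spechtRep K part2).character g = 1 := by
  refine char_of_scalar (fun _ => 1) (fun g => ?_) g
  have h (i : Fin 2) : rowIndex part2 i = 0 := by
    have h1 := ((rows part2).index i).2
    replace h1 := h1.trans_eq (length_rows _)
    exact Nat.lt_one_iff.1 h1
  rw [youngSymmetrizer_eq, ← mul_assoc, single_mul_rowSum _ fun i => by rw [h, h], one_smul]

lemma char_part11 [CharZero K] (g : Perm (Fin 2)) :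
    (spechtRep K part11).character g = ((Perm.sign g : ℤ) : K) := by
  classical
  refine char_of_scalar (fun g => ((Perm.sign g : ℤ) : K)) (fun g => ?_) g
  have h (i : Fin 2) : colIndex part11 i = 0 := by
    have h1 := ((rows part11).invEmbedding i).2
    have h2 : (rows part11).blocksFun ((rows part11).index i) ∈ part11.parts :=
      (Multiset.mem_sort (· ≥ ·)).1 ((rows part11).blocksFun_mem_blocks _)
    have h3 : (rows part11).blocksFun ((rows part11).index i) = 1 := by
      simpa [part11] using h2
    replace h1 := h1.trans_eq h3
    exact Nat.lt_one_iff.1 h1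
  -- Both letters lie in column 0, so a permutation preserving rows fixes them.
  have h4 : rowSum K part11 = 1 := by
    rw [rowSum, Finset.sum_eq_single 1]
    · rfl
    · intro σ hσ h1
      refine absurd (Equiv.ext fun i => ?_) h1
      simp only [Finset.mem_filter_univ] at hσ
      exact canonical_injective part11 (hσ i) (by rw [h, h])
    · simp
  rw [youngSymmetrizer_eq, h4, one_mul, single_mul_colSum _ fun i => by rw [h, h]]

end SpechtModules

/-! ## The dual of a balanced tensor product -/

section BalancedDual

open MulOpposite TensorProduct

variable {G H : Type} [Group G] [Group H] {V W B : Type u} [AddCommGroup V] [Module K V]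
  [AddCommGroup W] [Module K W] [AddCommGroup B] [Module K B]
  (ρ : Representation K G V) (L : Representation K G B) (R : Representation K Hᵐᵒᵖ B)
  (σ : Representation K H W)

/-- The external tensor product of representations of two groups. -/
abbrev outerTensor : Representation K (G × H) (V ⊗[K] W) :=
  Representation.tprod (ρ.comp (MonoidHom.fst G H)) (σ.comp (MonoidHom.snd G H))

variable {ρ L R σ}

lemma balanced_mk_left (g : G) (v : V) (b : B) (w : W) :
    (balancedRel ρ L R σ).mkQ (v ⊗ₜ[K] (L g b ⊗ₜ[K] w)) =
      (balancedRel ρ L R σ).mkQ (ρ g⁻¹ v ⊗ₜ[K] (b ⊗ₜ[K] w)) :=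
  ((Submodule.Quotient.eq _).2 (Submodule.subset_span (.inl ⟨g, v, b, w, rfl⟩))).symm

lemma balanced_mk_right (h : H) (v : V) (b : B) (w : W) :
    (balancedRel ρ L R σ).mkQ (v ⊗ₜ[K] (R (op h) b ⊗ₜ[K] w)) =
      (balancedRel ρ L R σ).mkQ (v ⊗ₜ[K] (b ⊗ₜ[K] σ h w)) :=
  (Submodule.Quotient.eq _).2 (Submodule.subset_span (.inr ⟨h, v, b, w, rfl⟩))

/-- The bilinear form with values in linear forms determined by a linear form on a balanced tensor
product. -/
def balancedForm (f : Module.Dual K (Balanced ρ L R σ)) : B →ₗ[K] Module.Dual K (V ⊗[K] W) where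
  toFun b := TensorProduct.lift (LinearMap.mk₂ K
    (fun v w => f ((balancedRel ρ L R σ).mkQ (v ⊗ₜ[K] (b ⊗ₜ[K] w))))
    (fun v v' w => by simp only [add_tmul, map_add])
    (fun c v w => by simp only [← smul_tmul', map_smul])
    (fun v w w' => by simp only [tmul_add, map_add])
    (fun c v w => by simp only [tmul_smul, map_smul]))
  map_add' b b' := by
    ext v w
    change f _ = f _ + f _
    simp only [tmul_add, add_tmul, map_add]
  map_smul' c b := by
    ext v w
    change f _ = c • f _
    simp only [← smul_tmul', tmul_smul, map_smul]

variable (hLR : ∀ g h b, L g (R h b) = R h (L g b))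

variable (ρ σ) in
/-- Linear forms on a balanced tensor product are equivariant maps into the dual of an external
tensor product. -/
def balancedDual : Module.Dual K (Balanced ρ L R σ) →ₗ[K]
    (bimodRep L R hLR).IntertwiningMap (outerTensor ρ σ).dual where
  toFun f :=
    { toLinearMap := balancedForm f
      isIntertwining' := fun x => by
        ext b v w
        change f _ = f _
        rw [bimodRep_apply, balanced_mk_left, balanced_mk_right]
        rfl }
  map_add' f g := by
    apply Representation.IntertwiningMap.ext
    ext b v w
    rfl
  map_smul' c f := by
    apply Representation.IntertwiningMap.ext
    ext b v w
    rfl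

lemma balancedDual_injective : Function.Injective (balancedDual ρ σ hLR) := by
  intro f g h
  refine Submodule.linearMap_qext _ ?_
  ext v b w
  exact congrArg (fun F : (bimodRep L R hLR).IntertwiningMap (outerTensor ρ σ).dual =>
    F b (v ⊗ₜ w)) h

lemma balancedDual_surjective : Function.Surjective (balancedDual ρ σ hLR) := by
  intro F
  let f : V ⊗[K] (B ⊗[K] W) →ₗ[K] K := TensorProduct.lift
    { toFun := fun v => TensorProduct.lift (LinearMap.mk₂ K (fun b w => F b (v ⊗ₜ w))
        (fun b b' w => by rw [map_add, LinearMap.add_apply])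
        (fun c b w => by rw [map_smul, LinearMap.smul_apply])
        (fun b w w' => by rw [tmul_add, map_add])
        (fun c b w => by rw [tmul_smul, map_smul]))
      map_add' := fun v v' => by
        ext b w
        change F b _ = F b _ + F b _
        rw [add_tmul, map_add]
      map_smul' := fun c v => by
        ext b w
        change F b _ = c • F b _
        rw [← smul_tmul', map_smul] }
  have hf (v b w) : f (v ⊗ₜ (b ⊗ₜ w)) = F b (v ⊗ₜ w) := rfl
  have hF (g : G) (h : H) (b : B) (v : V) (w : W) :
      F (L g (R (op h⁻¹) b)) (v ⊗ₜ w) = F b (ρ g⁻¹ v ⊗ₜ σ h⁻¹ w) :=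
    LinearMap.congr_fun (Representation.IntertwiningMap.isIntertwining _ _ F (g, h) b) (v ⊗ₜ w)
  have hle : balancedRel ρ L R σ ≤ LinearMap.ker f := by
    refine Submodule.span_le.2 ?_
    rintro _ (⟨g, v, b, w, rfl⟩ | ⟨h, v, b, w, rfl⟩)
    · have h1 := hF g 1 b v w
      rw [inv_one, op_one, map_one, map_one] at h1
      change f _ = 0
      rw [map_sub, hf, hf, sub_eq_zero]
      exact h1.symm
    · have h1 := hF 1 h⁻¹ b v w
      rw [inv_one, map_one, map_one, inv_inv] at h1
      change f _ = 0
      rw [map_sub, hf, hf, sub_eq_zero]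
      exact h1
  refine ⟨(balancedRel ρ L R σ).liftQ f hle, ?_⟩
  apply Representation.IntertwiningMap.ext
  ext b v w
  rfl

variable [FiniteDimensional K V] [FiniteDimensional K W]

/-- Linear forms on the balanced tensor product are equivariant maps from the bimodule to the dual
of the external tensor product; the bimodule being cyclic, they form an isotypic subspace.
Finiteness is obtained for the dual first and then passes to the space itself. -/
lemma balanced_of_detected [CharZero K] [Fintype G] [Fintype H] {S : Type} [Group S] [Fintype S]
    {ι : S →* G × H} {χ : S →* K} {b : B} {ℓ : B →ₗ[K] K}
    (h : Detected (bimodRep L R hLR) ι χ b ℓ)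
    (hspan : Submodule.span K (Set.range fun γ => bimodRep L R hLR γ b) = ⊤) :
    Module.Finite K (Balanced ρ L R σ) ∧
      (Fintype.card S : K) * Module.finrank K (Balanced ρ L R σ) =
        ∑ x, χ x⁻¹ * (ρ.character (ι x).1⁻¹ * σ.character (ι x).2⁻¹) := by
  let e : Module.Dual K (Balanced ρ L R σ) ≃ₗ[K] isotypic (outerTensor ρ σ).dual ι χ :=
    (LinearEquiv.ofBijective (balancedDual ρ σ hLR)
      ⟨balancedDual_injective hLR, balancedDual_surjective hLR⟩).trans (cyclicEquiv _ _ h hspan)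
  have h1 : Module.Finite K (Module.Dual K (Balanced ρ L R σ)) := Module.Finite.equiv e.symm
  refine ⟨(Module.finite_dual_iff K).1 h1, ?_⟩
  rw [← Subspace.dual_finrank_eq, e.finrank_eq, card_mul_finrank_isotypic]
  refine Finset.sum_congr rfl fun x _ => ?_
  rw [Representation.char_dual, Representation.char_tensor]
  rfl

end BalancedDual

open Equiv MulOpposite

/-! ## The morphisms of the PROP for Lie algebras of the form `k + 2 → k + 1` -/

section LieMorphisms

variable (K) in
/-- The relations of the PROP for Lie algebras. -/
abbrev lieRel : ∀ m n : ℕ, Term K LieGen m n → Term K LieGen m n → Prop :=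
  IsLieRel (K := K) (.gen LieGen.bracket)

variable (K) in
/-- The bracket tensored with an identity. -/
def liePad (k : ℕ) : (catLie K).Hom (k + 2) (k + 1) :=
  (catLie K).tensor ((catLie K).perm (Equiv.refl (Fin k))) (catLie.bracket K)

/-- The values of the generator under the inclusion. -/
def inclVal : ∀ {m n : ℕ}, LieGen m n → (catLieC K).Hom m n
  | _, _, .bracket => casGen K .bracket

variable (K) in
/-- The inclusion of the PROP for Lie algebras into the PROP for Casimir Lie algebras. -/
def inclLie : PROPHom (catLie K) (catLieC K) :=
  presentedLift _ (catLieC K) inclVal (by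
    intro m n f g h
    cases h
    · exact PresHom.sound (R := casimirRel K) (Cong.rel (.inl IsLieRel.antisymm))
    · exact PresHom.sound (R := casimirRel K) (Cong.rel (.inl IsLieRel.jacobi)))

lemma inclLie_liePad (k : ℕ) : (inclLie K).map (liePad K k) = casPad K k .bracket := by
  rw [liePad, PROPHom.map_tensor, PROPHom.map_perm]
  rfl

lemma projLie_casPad (k : ℕ) : (projLie K).map (casPad K k .bracket) = liePad K k := by
  rw [casPad, PROPHom.map_tensor, PROPHom.map_perm]
  rfl

lemma PROPHom.map_homRep {P Q : LinearPROP K} (φ : PROPHom P Q) {n m : ℕ}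
    (x : Perm (Fin m) × Perm (Fin n)) (f : P.Hom n m) :
    φ.map (P.homRep n m x f) = Q.homRep n m x (φ.map f) := by
  rw [LinearPROP.homRep_apply, LinearPROP.homRep_apply, φ.map_comp, φ.map_comp, φ.map_perm,
    φ.map_perm]

/-- The Lie PROP is included in the Casimir Lie PROP and is also a quotient of it: the detecting
form is restricted along the inclusion, and the symmetry of the element is transported along the
projection. -/
lemma detected_liePad (k : ℕ) :
    Detected ((catLie K).homRep (k + 2) (k + 1)) (stabHom k 2 1) (stabChar K k 2 1) (liePad K k)
      (detect K k .bracket ∘ₗ (inclLie K).map) where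
  injective := stabHom_injective k 2 1
  mem := fun h => by
    rw [← projLie_casPad, ← PROPHom.map_homRep, casPad_mem_isotypic k .bracket h, map_smul]
  self := by
    rw [LinearMap.comp_apply, inclLie_liePad]
    exact (detected_casPad k .bracket).self
  off γ hγ := by
    rw [LinearMap.comp_apply, PROPHom.map_homRep, inclLie_liePad]
    exact (detected_casPad k .bracket).off γ hγ

lemma isWord_lie {p q : ℕ} {f : (catLie K).Hom p q} (hf : IsWord (lieRel K) f) :
    (∃ e, f = (catLie K).perm e) ∨
      ∃ (k : ℕ) (w : (catLie K).Hom p (k + 2)) (e : Fin (k + 1) ≃ Fin q),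
        IsWord (lieRel K) w ∧
          f = (catLie K).comp ((catLie K).comp w (liePad K k)) ((catLie K).perm e) := by
  cases hf with
  | perm e => exact .inl ⟨e, rfl⟩
  | @step k a b _ w x e hw =>
    cases x
    exact .inr ⟨k, w, e, hw, rfl⟩

lemma isWord_lie_le {p q : ℕ} {f : (presented (lieRel K)).Hom p q} (hf : IsWord (lieRel K) f) :
    q ≤ p := by
  induction hf with
  | perm e => exact (Fin.equiv_iff_eq.1 ⟨e⟩).ge
  | step w x e hw ih =>
    have h := Fin.equiv_iff_eq.1 ⟨e⟩
    cases x
    omega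

/-- Each bracket lowers the degree by one, so a word from k + 2 to k + 1 contains exactly one and is
a two-sided translate of the padded bracket. -/
lemma span_liePad (k : ℕ) :
    Submodule.span K (Set.range fun γ => (catLie K).homRep (k + 2) (k + 1) γ (liePad K k)) = ⊤ := by
  rw [eq_top_iff]
  intro f _
  refine Submodule.span_le.2 (fun g hg => ?_) (mem_span_isWord (R := lieRel K) f)
  rcases isWord_lie hg with ⟨e, rfl⟩ | ⟨k', w, e, hw, h⟩
  · have := Fin.equiv_iff_eq.1 ⟨e⟩
    omega
  · have h1 := Fin.equiv_iff_eq.1 ⟨e⟩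
    obtain rfl : k' = k := by omega
    rcases isWord_lie hw with ⟨e', rfl⟩ | ⟨k'', w', e', hw', -⟩
    · refine Submodule.subset_span ⟨(e, e'⁻¹), ?_⟩
      refine ((catLie K).homRep_apply _ _).trans ?_
      rw [inv_inv]
      exact h.symm
    · have h2 := isWord_lie_le hw'
      have h3 := Fin.equiv_iff_eq.1 ⟨e'⟩
      omega

/-- A word from 1 to 0 can neither be a permutation nor end with a bracket. This serves the boundary
case m = 0. -/
lemma subsingleton_lie_hom : Subsingleton ((catLie K).Hom 1 0) := by
  refine subsingleton_of_forall_eq 0 fun f => ?_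
  have h := Submodule.span_le (p := (⊥ : Submodule K ((presented (lieRel K)).Hom 1 0))).2
    (fun g hg => ?_) (mem_span_isWord (R := lieRel K) f)
  · exact h
  · rcases isWord_lie hg with ⟨e, rfl⟩ | ⟨k, w, e, -, -⟩
    · exact absurd (Fin.equiv_iff_eq.1 ⟨e⟩) (by omega)
    · exact absurd (Fin.equiv_iff_eq.1 ⟨e⟩) (by omega)

end LieMorphisms

/-! ## The morphisms of the upward Brauer category of the form `k → k + 2` -/

section Brauer

variable (K) in
/-- The representation of a product of symmetric groups on the morphisms of the upward Brauer
category. -/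
abbrev ubRep (n m : ℕ) : Representation K (Perm (Fin m) × Perm (Fin n)) (ub K n m) :=
  bimodRep (ubLeftAct K n m) (ubRightAct K n m) fun g h b => by
    refine LinearMap.congr_fun (f := ubLeftAct K n m g ∘ₗ ubRightAct K n m h)
      (g := ubRightAct K n m h ∘ₗ ubLeftAct K n m g) (Finsupp.lhom_ext' fun π => ?_) b
    ext1
    simp [ubLeftAct, ubRightAct, UpMatching.relabel_relabel]

lemma ubRep_single {n m : ℕ} (x : Perm (Fin m) × Perm (Fin n)) (π : UpMatching n m) :
    ubRep K n m x (Finsupp.single π 1) = Finsupp.single (π.relabel x.2 x.1) 1 := by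
  rw [bimodRep_apply]
  simp [ubLeftAct, ubRightAct, UpMatching.relabel_relabel]

/-- The map underlying the standard pairing. -/
def pairFun (k : ℕ) : Fin (k + 0) ⊕ Fin (k + 2) → Fin (k + 0) ⊕ Fin (k + 2)
  | .inl i => .inr (Fin.castAdd 2 i)
  | .inr j => Fin.addCases (motive := fun _ => Fin (k + 0) ⊕ Fin (k + 2))
      (fun i => .inl (Fin.castAdd 0 i)) (fun i => .inr (Fin.natAdd k (swap 0 1 i))) j

lemma pairFun_inl {k : ℕ} (i : Fin k) :
    pairFun k (.inl (Fin.castAdd 0 i)) = .inr (Fin.castAdd 2 i) := rfl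

lemma pairFun_castAdd {k : ℕ} (i : Fin k) :
    pairFun k (.inr (Fin.castAdd 2 i)) = .inl (Fin.castAdd 0 i) := by
  simp [pairFun]

lemma pairFun_natAdd {k : ℕ} (i : Fin 2) :
    pairFun k (.inr (Fin.natAdd k i)) = .inr (Fin.natAdd k (swap 0 1 i)) := by
  simp [pairFun]

lemma pair_cases {k : ℕ} {p : Fin (k + 0) ⊕ Fin (k + 2) → Prop}
    (h1 : ∀ i : Fin k, p (.inl (Fin.castAdd 0 i))) (h2 : ∀ i : Fin k, p (.inr (Fin.castAdd 2 i)))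
    (h3 : ∀ i, p (.inr (Fin.natAdd k i))) (x) : p x := by
  rcases x with i | j
  · exact h1 i
  · induction j using Fin.addCases with
    | left i => exact h2 i
    | right i => exact h3 i

lemma pairFun_involutive (k : ℕ) : Function.Involutive (pairFun k) := by
  refine pair_cases (fun i => ?_) (fun i => ?_) fun i => ?_
  · rw [pairFun_inl, pairFun_castAdd]
  · rw [pairFun_castAdd, pairFun_inl]
  · rw [pairFun_natAdd, pairFun_natAdd, ← Perm.mul_apply, swap_mul_self, Perm.one_apply]

/-- The involution underlying a pairing. -/
def UpMatching.toPerm {n m : ℕ} (π : UpMatching n m) : Perm (Fin n ⊕ Fin m) := π.1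

lemma UpMatching.toPerm_toPerm {n m : ℕ} (π : UpMatching n m) (x) :
    π.toPerm (π.toPerm x) = x := (π.2.1 x).1

lemma UpMatching.toPerm_ne {n m : ℕ} (π : UpMatching n m) (x) : π.toPerm x ≠ x := (π.2.1 x).2

lemma UpMatching.toPerm_inl_ne {n m : ℕ} (π : UpMatching n m) (i j : Fin n) :
    π.toPerm (.inl i) ≠ .inl j := π.2.2 i j

lemma UpMatching.ext_iff' {n m : ℕ} {π π' : UpMatching n m} :
    π = π' ↔ ∀ x, π.toPerm x = π'.toPerm x := Subtype.ext_iff.trans Equiv.ext_iff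

lemma UpMatching.toPerm_relabel {n m : ℕ} (π : UpMatching n m) (s : Perm (Fin n))
    (t : Perm (Fin m)) (x) :
    (π.relabel s t).toPerm (Sum.map s t x) = Sum.map s t (π.toPerm x) := by
  change sumCongr s t (π.1 ((sumCongr s t).symm (sumCongr s t x))) = _
  rw [Equiv.symm_apply_apply]
  rfl

lemma castAdd_ne_natAdd {k l : ℕ} (i : Fin k) (j : Fin l) : Fin.castAdd l i ≠ Fin.natAdd k j :=
  fun h => by
    have h1 := congrArg Fin.val h
    simp only [Fin.val_castAdd, Fin.val_natAdd] at h1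
    omega

/-- The standard pairing: the identity of `k` together with one pair of negative elements. -/
def stdPairing (k : ℕ) : UpMatching (k + 0) (k + 2) :=
  ⟨(pairFun_involutive k).toPerm, fun x => ⟨pairFun_involutive k x, by
    revert x
    refine pair_cases (fun i => ?_) (fun i => ?_) fun i => ?_
    · exact Sum.inr_ne_inl
    · intro h
      exact Sum.inl_ne_inr ((pairFun_castAdd i).symm.trans h)
    · intro h
      have h1 := Fin.natAdd_injective _ _ (Sum.inr_injective ((pairFun_natAdd i).symm.trans h))
      fin_cases i <;> simp at h1⟩, fun i j => Sum.inr_ne_inl⟩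

/-- Testing on relabelled elements turns conjugation of involutions into a commutation relation free
of inverses. -/
lemma relabel_eq_iff {k : ℕ} (s : Perm (Fin (k + 0))) (t : Perm (Fin (k + 2)))
    (π : UpMatching (k + 0) (k + 2)) : (stdPairing k).relabel s t = π ↔
      ∀ x, Sum.map s t (pairFun k x) = π.toPerm (Sum.map s t x) := by
  rw [UpMatching.ext_iff', ← (sumCongr s t).forall_congr_right]
  refine forall_congr' fun x => ?_
  change UpMatching.toPerm _ (Sum.map s t x) = _ ↔ _
  rw [UpMatching.toPerm_relabel]
  rfl

lemma perm_two_comm (β β' : Perm (Fin 2)) (i : Fin 2) : β (β' i) = β' (β i) := by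
  revert β β' i
  decide

lemma swap_eq_of_ne {i j : Fin 2} (h : j ≠ i) : swap 0 1 i = j := by
  revert i j
  decide

lemma relabel_stdPairing_juxt {k : ℕ} (σ : Perm (Fin k)) (α : Perm (Fin 0)) (β : Perm (Fin 2)) :
    (stdPairing k).relabel (juxt σ α) (juxt σ β) = stdPairing k := by
  rw [relabel_eq_iff]
  change ∀ x, _ = pairFun k _
  refine pair_cases (fun i => ?_) (fun i => ?_) fun i => ?_
  · simp only [pairFun_inl, Sum.map_inl, Sum.map_inr, juxt_castAdd]
  · simp only [pairFun_castAdd, Sum.map_inl, Sum.map_inr, juxt_castAdd]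
  · simp only [pairFun_natAdd, Sum.map_inr, juxt_natAdd, perm_two_comm β]

/-- The pairs joining i⁺ to i⁻ force the two permutations to agree on the first k letters, whence
the remaining two negative letters are preserved as a set. -/
lemma exists_of_relabel_eq {k : ℕ} {s : Perm (Fin (k + 0))} {t : Perm (Fin (k + 2))}
    (h : (stdPairing k).relabel s t = stdPairing k) : (t, s) ∈ Set.range (stabHom k 0 2) := by
  rw [relabel_eq_iff] at h
  change ∀ x, _ = pairFun k _ at h
  have h1 (i : Fin k) : t (Fin.castAdd 2 i) = Fin.castAdd 2 (s (Fin.castAdd 0 i)) := by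
    have h2 := h (.inl (Fin.castAdd 0 i))
    rw [pairFun_inl] at h2
    exact Sum.inr_injective h2
  have h2 (i : Fin 2) : ∃ j, t (Fin.natAdd k i) = Fin.natAdd k j := by
    have h3 (y : Fin (k + 2)) : (∃ j, y = Fin.castAdd 2 j) ∨ ∃ j, y = Fin.natAdd k j := by
      induction y using Fin.addCases with
      | left j => exact .inl ⟨j, rfl⟩
      | right j => exact .inr ⟨j, rfl⟩
    refine (h3 _).resolve_left ?_
    rintro ⟨j, hj⟩
    have h4 : t (Fin.natAdd k i) = t (Fin.castAdd 2 (s⁻¹ j)) := by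
      rw [hj, h1]
      exact congrArg _ (s.apply_symm_apply j).symm
    exact castAdd_ne_natAdd _ _ (t.injective h4).symm
  obtain ⟨σ, β, rfl⟩ := exists_juxt t h2
  refine ⟨(σ, 1, β), Prod.ext rfl (Equiv.ext fun i => ?_)⟩
  have h3 := h1 i
  rw [juxt_castAdd] at h3
  exact (juxt_castAdd σ (1 : Perm (Fin 0)) i).trans (Fin.castAdd_injective _ 2 h3)

/-- Send each i to the partner of i⁺, which is negative, and extend to a permutation of the negative
letters; the two left over can only be paired with each other. So relabelling the target alone is
transitive. -/
lemma exists_relabel_eq {k : ℕ} (π : UpMatching (k + 0) (k + 2)) :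
    ∃ t, (stdPairing k).relabel 1 t = π := by
  have h1 (i : Fin k) : ∃ j, π.toPerm (.inl (Fin.castAdd 0 i)) = .inr j := by
    rcases hi : π.toPerm (.inl (Fin.castAdd 0 i)) with j | j
    · exact absurd hi (π.toPerm_inl_ne _ _)
    · exact ⟨j, rfl⟩
  choose f hf using h1
  have hf' (i : Fin k) : π.toPerm (.inr (f i)) = .inl (Fin.castAdd 0 i) := by
    rw [← hf, π.toPerm_toPerm]
  have hinj : Function.Injective f := fun i j hij => by
    have h := (hf i).trans ((congrArg Sum.inr hij).trans (hf j).symm)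
    exact Fin.castAdd_injective _ _ (Sum.inl_injective (π.toPerm.injective h))
  -- The bijection between the first k letters and the partners, to be extended to all k + 2
  -- letters.
  let e : {x // x ∈ Set.range (Fin.castAdd (n := k) 2)} ≃ {x // x ∈ Set.range f} :=
    (Equiv.ofInjective _ (Fin.castAdd_injective k 2)).symm.trans (Equiv.ofInjective f hinj)
  have ht (i : Fin k) : e.extendSubtype (Fin.castAdd 2 i) = f i := by
    rw [e.extendSubtype_apply_of_mem _ ⟨i, rfl⟩]
    simp [e, Equiv.ofInjective_symm_apply]
  have ht' (i : Fin 2) (j : Fin k) : e.extendSubtype (Fin.natAdd k i) ≠ f j := by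
    rw [← ht, e.extendSubtype.injective.ne_iff]
    exact (castAdd_ne_natAdd _ _).symm
  generalize e.extendSubtype = t at ht ht'
  refine ⟨t, (relabel_eq_iff _ _ _).2 (pair_cases (fun i => ?_) (fun i => ?_) fun i => ?_)⟩
  · rw [pairFun_inl]
    exact (congrArg Sum.inr (ht i)).trans (hf i).symm
  · rw [pairFun_castAdd]
    exact (hf' i).symm.trans (congrArg (fun x => π.toPerm (.inr x)) (ht i).symm)
  · rw [pairFun_natAdd]
    change Sum.inr (t _) = π.toPerm (.inr (t _))
    rcases hx : π.toPerm (.inr (t (Fin.natAdd k i))) with x | x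
    · refine absurd ?_ (ht' i x)
      refine Sum.inr_injective ((π.toPerm.injective ?_))
      exact hx.trans (hf' x).symm
    · obtain ⟨y, rfl⟩ := t.surjective x
      congr 1
      induction y using Fin.addCases with
      | left y =>
        rw [ht] at hx
        have h2 := π.toPerm_toPerm (.inr (t (Fin.natAdd k i)))
        rw [hx, hf'] at h2
        exact absurd h2 Sum.inl_ne_inr
      | right y =>
        have h3 : y ≠ i := by
          rintro rfl
          exact π.toPerm_ne _ hx
        exact congrArg _ (congrArg _ (swap_eq_of_ne h3))

lemma detected_stdPairing (k : ℕ) :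
    Detected (ubRep K (k + 0) (k + 2)) (stabHom k 0 2) (stabChar K k 0 2)
      (Finsupp.single (stdPairing k) 1) (Finsupp.lapply (stdPairing k)) where
  injective := stabHom_injective k 0 2
  mem := fun ⟨σ, α, β⟩ => by
    rw [ubRep_single, stabHom_apply, relabel_stdPairing_juxt, stabChar_apply,
      Subsingleton.elim α 1]
    simp
  self := by simp
  off := fun ⟨t, s⟩ hγ => by
    classical
    rw [ubRep_single, Finsupp.lapply_apply, Finsupp.single_apply, if_neg]
    exact fun h => hγ (exists_of_relabel_eq h)

lemma span_stdPairing (k : ℕ) : Submodule.span K (Set.range fun γ =>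
    ubRep K (k + 0) (k + 2) γ (Finsupp.single (stdPairing k) 1)) = ⊤ := by
  rw [eq_top_iff, ← (Finsupp.basisSingleOne (R := K) (ι := UpMatching (k + 0) (k + 2))).span_eq,
    Submodule.span_le]
  rintro _ ⟨π, rfl⟩
  obtain ⟨t, rfl⟩ := exists_relabel_eq π
  refine Submodule.subset_span ⟨(t, 1), ?_⟩
  rw [Finsupp.coe_basisSingleOne]
  exact ubRep_single _ _

end Brauer

open TensorProduct

/-! ## Dimensions -/

section Dimensions

variable {k a b : ℕ} {V W : Type u} [AddCommGroup V] [Module K V] [FiniteDimensional K V]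
  [AddCommGroup W] [Module K W] [FiniteDimensional K W]

/-- The sum over the stabilizer of a generator of the products of the values of two characters. -/
def stabSum (ρ : Representation K (Perm (Fin (k + a))) V)
    (σ : Representation K (Perm (Fin (k + b))) W) : K :=
  ∑ x : Perm (Fin k) × Perm (Fin a) × Perm (Fin b),
    ((Perm.sign x.2.1 : ℤ) : K) * (σ.character (juxt x.1 x.2.2) * ρ.character (juxt x.1 x.2.1))

variable (ρ : Representation K (Perm (Fin (k + a))) V)
  (σ : Representation K (Perm (Fin (k + b))) W)

lemma stabChar_inv (x : Perm (Fin k) × Perm (Fin a) × Perm (Fin b)) :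
    stabChar K k a b x⁻¹ = ((Perm.sign x.2.1 : ℤ) : K) := by
  rw [stabChar_apply]
  change ((Perm.sign x.2.1⁻¹ : ℤ) : K) = _
  rw [Perm.sign_inv]

/-- The character of Hom(V, W) involves an inverse on the source, which is harmless for
permutations. -/
lemma finite_and_finrank_ext [CharZero K] (x : CasimirGen a b) :
    Module.Finite K (Abelian.Ext.{u + 1} (trivMod ρ) (trivMod σ) 1) ∧
    (Fintype.card (Perm (Fin k) × Perm (Fin a) × Perm (Fin b)) : K) *
      Module.finrank K (Abelian.Ext.{u + 1} (trivMod ρ) (trivMod σ) 1) = stabSum ρ σ := by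
  refine ⟨Module.Finite.equiv (extEquiv x ρ σ).symm, ?_⟩
  rw [(extEquiv x ρ σ).finrank_eq, card_mul_finrank_isotypic]
  refine Finset.sum_congr rfl fun y _ => ?_
  rw [stabChar_inv, Representation.char_linHom, mul_comm (Representation.character _ _)]
  congr 2
  exact char_perm_inv ρ (juxt y.1 y.2.1)

/-- The dual of the external tensor product has inverses on both factors; removing them leaves the
same sum as for the Ext-group. -/
lemma finite_and_finrank_balanced [CharZero K] {B : Type u} [AddCommGroup B] [Module K B]
    {L : Representation K (Perm (Fin (k + b))) B} {R : Representation K (Perm (Fin (k + a)))ᵐᵒᵖ B}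
    (hLR : ∀ g h b, L g (R h b) = R h (L g b)) {c : B} {ℓ : B →ₗ[K] K}
    (h : Detected (bimodRep L R hLR) (stabHom k a b) (stabChar K k a b) c ℓ)
    (hspan : Submodule.span K (Set.range fun γ => bimodRep L R hLR γ c) = ⊤) :
    Module.Finite K (Balanced σ L R ρ) ∧
    (Fintype.card (Perm (Fin k) × Perm (Fin a) × Perm (Fin b)) : K) *
      Module.finrank K (Balanced σ L R ρ) = stabSum ρ σ := by
  obtain ⟨h1, h2⟩ := balanced_of_detected (ρ := σ) (σ := ρ) hLR h hspan
  refine ⟨h1, h2.trans (Finset.sum_congr rfl fun y _ => ?_)⟩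
  rw [stabChar_inv, char_perm_inv, char_perm_inv]
  rfl

/-- The first Ext-group of two concentrated modules is isomorphic to a balanced tensor product over
a bimodule generated by an element with the same stabilizer as the generator. -/
lemma ext_equiv_balanced [CharZero K] {B : Type u} [AddCommGroup B] [Module K B]
    (x : CasimirGen a b)
    {L : Representation K (Perm (Fin (k + b))) B} {R : Representation K (Perm (Fin (k + a)))ᵐᵒᵖ B}
    (hLR : ∀ g h b, L g (R h b) = R h (L g b)) {c : B} {ℓ : B →ₗ[K] K}
    (h : Detected (bimodRep L R hLR) (stabHom k a b) (stabChar K k a b) c ℓ)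
    (hspan : Submodule.span K (Set.range fun γ => bimodRep L R hLR γ c) = ⊤) :
    Nonempty (Abelian.Ext.{u + 1} (trivMod ρ) (trivMod σ) 1 ≃ₗ[K] Balanced σ L R ρ) := by
  obtain ⟨h1, h2⟩ := finite_and_finrank_ext ρ σ x
  obtain ⟨h3, h4⟩ := finite_and_finrank_balanced ρ σ hLR h hspan
  have hc : (Fintype.card (Perm (Fin k) × Perm (Fin a) × Perm (Fin b)) : K) ≠ 0 :=
    Nat.cast_ne_zero.2 Fintype.card_ne_zero
  have h5 := mul_left_cancel₀ hc (h2.trans h4.symm)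
  exact FiniteDimensional.nonempty_linearEquiv_of_finrank_eq (Nat.cast_injective h5)

end Dimensions

/-! ## Littlewood-Richardson coefficients -/

section LittlewoodRichardson

lemma card_mul_LR [CharZero K] {a b : ℕ} (lam : (a + b).Partition) (rho : a.Partition)
    (nu : b.Partition) :
    (Fintype.card (Perm (Fin a) × Perm (Fin b)) : K) * LR K lam rho nu =
      ∑ x : Perm (Fin a) × Perm (Fin b), (spechtRep K lam).character (juxt x.1 x.2) *
        ((spechtRep K rho).character x.1 * (spechtRep K nu).character x.2) := by
  rw [LR, dif_pos rfl, finrank_intertwiningMap_ind]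
  refine Finset.sum_congr rfl fun x _ => ?_
  rw [Representation.char_tensor, Pi.mul_apply, ← char_perm_inv (spechtRep K rho) x.1,
    ← char_perm_inv (spechtRep K nu) x.2]
  rfl

/-- The restriction of a character to the first factor of a Young subgroup, averaged against a
function on the second factor. -/
lemma sum_char_juxt_conj {V : Type u} [AddCommGroup V] [Module K V] {k a : ℕ}
    (ρ : Representation K (Perm (Fin (k + a))) V) (w : Perm (Fin a) → K) (g h : Perm (Fin k))
    (hgh : IsConj g h) :
    ∑ α, ρ.character (juxt g α) * w α = ∑ α, ρ.character (juxt h α) * w α := by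
  obtain ⟨c, rfl⟩ := isConj_iff.1 hgh
  refine Finset.sum_congr rfl fun α _ => ?_
  have h1 : (juxt (c * g * c⁻¹) α : Perm (Fin (k + a))) = juxt c 1 * juxt g α * (juxt c 1)⁻¹ := by
    have h2 (y : Perm (Fin k) × Perm (Fin a) →* Perm (Fin (k + a))) :
        y ((c, 1) * (g, α) * (c, 1)⁻¹) = y (c, 1) * y (g, α) * (y (c, 1))⁻¹ := by
      rw [map_mul, map_mul, map_inv]
    refine Eq.trans ?_ (h2 (youngSubgroup rfl))
    simp only [Prod.mk_mul_mk, Prod.inv_mk, one_mul, inv_one, mul_one]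
    rfl
  rw [h1, Representation.char_conj]

/-- The class functions A and C of S_k are the restrictions of the two characters, summed against
the sign of S_2 and over the trivial S_1. Up to group orders their inner products with the character
of S_ρ are the two coefficients, and completeness turns the sum over ρ into the inner product of A
and C. -/
lemma sum_LR_bracket [CharZero K] {k : ℕ} (lam : (k + 2).Partition) (mu : (k + 1).Partition) :
    (Fintype.card (Perm (Fin k) × Perm (Fin 2) × Perm (Fin 1)) : K) *
      (∑ rho : k.Partition, LR K lam rho part11 * LR K mu rho part1 : ℕ) =
      stabSum (spechtRep K lam) (spechtRep K mu) := by
  let A (σ : Perm (Fin k)) : K :=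
    ∑ α, (spechtRep K lam).character (juxt σ α) * ((Perm.sign α : ℤ) : K)
  let C (σ : Perm (Fin k)) : K := ∑ β : Perm (Fin 1), (spechtRep K mu).character (juxt σ β) * 1
  have hA (rho : k.Partition) : (Fintype.card (Perm (Fin k) × Perm (Fin 2)) : K) *
      LR K lam rho part11 = ∑ σ, A σ * (spechtRep K rho).character σ := by
    rw [card_mul_LR, Fintype.sum_prod_type]
    refine Finset.sum_congr rfl fun σ _ => ?_
    rw [Finset.sum_mul]
    refine Finset.sum_congr rfl fun α _ => ?_
    rw [char_part11]
    ring
  have hC (rho : k.Partition) : (Fintype.card (Perm (Fin k) × Perm (Fin 1)) : K) *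
      LR K mu rho part1 = ∑ σ, C σ * (spechtRep K rho).character σ := by
    rw [card_mul_LR, Fintype.sum_prod_type]
    refine Finset.sum_congr rfl fun σ _ => ?_
    rw [Finset.sum_mul]
    refine Finset.sum_congr rfl fun β _ => ?_
    rw [char_part1]
    ring
  have h1 := sum_char_mul_sum_char A C (sum_char_juxt_conj (spechtRep K lam) _)
  simp only [← hA, ← hC] at h1
  have h2 : stabSum (spechtRep K lam) (spechtRep K mu) = ∑ σ, A σ * C σ := by
    rw [stabSum, Fintype.sum_prod_type]
    refine Finset.sum_congr rfl fun σ _ => ?_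
    rw [Fintype.sum_prod_type, Finset.sum_mul_sum]
    refine Finset.sum_congr rfl fun α _ => Finset.sum_congr rfl fun β _ => ?_
    ring
  have hc : (Fintype.card (Perm (Fin k)) : K) ≠ 0 := Nat.cast_ne_zero.2 Fintype.card_ne_zero
  refine mul_left_cancel₀ hc ?_
  rw [h2, ← h1]
  simp only [Fintype.card_prod, Nat.cast_mul, Nat.cast_sum, Finset.mul_sum]
  refine Finset.sum_congr rfl fun rho _ => ?_
  ring

/-- The source factor S_0 is trivial, so the stabilizer is the Young subgroup S_k × S_2 and the sum
is the one given by Frobenius reciprocity. -/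
lemma LR_casimir [CharZero K] {k : ℕ} (lam : (k + 0).Partition) (mu : (k + 2).Partition) :
    (Fintype.card (Perm (Fin k) × Perm (Fin 0) × Perm (Fin 2)) : K) * (LR K mu lam part2 : ℕ) =
      stabSum (spechtRep K lam) (spechtRep K mu) := by
  have h := card_mul_LR (K := K) (a := k + 0) (b := 2) mu lam part2
  have h1 : Fintype.card (Perm (Fin k) × Perm (Fin 0) × Perm (Fin 2)) =
      Fintype.card (Perm (Fin (k + 0)) × Perm (Fin 2)) := by
    simp [Fintype.card_prod]
  rw [h1, h, stabSum, Fintype.sum_prod_type, Fintype.sum_prod_type]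
  refine Finset.sum_congr rfl fun σ _ => ?_
  refine Eq.trans ?_ (Fintype.sum_prod_type _).symm
  refine Eq.trans ?_ (Fintype.sum_unique _).symm
  refine Finset.sum_congr rfl fun β _ => ?_
  rw [char_part2, mul_one, Subsingleton.elim (default : Perm (Fin 0)) 1, Perm.sign_one,
    Units.val_one, Int.cast_one, one_mul]
  congr 2
  ext i
  exact congrArg Fin.val (juxt_castAdd σ (1 : Perm (Fin 0)) i).symm

end LittlewoodRichardson

end ExtCasimir

end

/-! ### The theorem -/

open ExtCasimir in
theorem theorem3p4 {K : Type u} [Field K] [CharZero K] {n m : ℕ}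
    (lam : n.Partition) (mu : m.Partition) :
    (n = m + 1 → Nonempty (Ext1 K lam mu ≃ₗ[K]
      Balanced (spechtRep K mu) ((catLie K).leftAct n m) ((catLie K).rightAct n m)
        (spechtRep K lam))) ∧
    (m = n + 2 → Nonempty (Ext1 K lam mu ≃ₗ[K]
      Balanced (spechtRep K mu) (ubLeftAct K n m) (ubRightAct K n m) (spechtRep K lam))) ∧
    (n ≠ m + 1 → m ≠ n + 2 → Nonempty (Ext1 K lam mu ≃ₗ[K] PUnit.{u + 1})) ∧
    Module.Finite K (Ext1 K lam mu) ∧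
    Module.finrank K (Ext1 K lam mu) =
      if n = m + 1 then ∑ rho : (n - 2).Partition, LR K lam rho part11 * LR K mu rho part1
      else if m = n + 2 then LR K mu lam part2
      else 0 := by
  by_cases h1 : n = m + 1
  · subst h1
    -- For n = 1, m = 0 the degrees differ by one but no bracket fits: both spaces are zero.
    rcases m with _ | k
    · have hs : Subsingleton (Ext1 K lam mu) :=
        subsingleton_ext (spechtRep K lam) (spechtRep K mu) fun k a b x h2 h3 => by
          have := x.arity
          omega
      have hb : Subsingleton (Balanced (spechtRep K mu) ((catLie K).leftAct (0 + 1) 0)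
          ((catLie K).rightAct (0 + 1) 0) (spechtRep K lam)) := by
        refine subsingleton_of_forall_eq 0 fun y => ?_
        refine LinearMap.congr_fun (f := LinearMap.id) (g := (0 : _ →ₗ[K] _))
          (Submodule.linearMap_qext _ ?_) y
        ext v f w
        have h4 : f = 0 := (subsingleton_lie_hom (K := K)).elim _ _
        simp [h4]
      refine ⟨fun _ => ⟨0⟩, fun h => by omega, fun h => absurd rfl h, inferInstance, ?_⟩
      rw [if_pos rfl, Module.finrank_zero_of_subsingleton]
      symm
      -- Truncated subtraction makes n - 2 equal to 0, so the sum is not empty; its terms vanish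
      -- because 0 + 2 ≠ 1.
      refine Finset.sum_eq_zero fun rho _ => ?_
      rw [LR, dif_neg (by omega), zero_mul]
    · obtain ⟨h2, h3⟩ := finite_and_finrank_ext (k := k) (a := 2) (b := 1) (spechtRep K lam)
        (spechtRep K mu) .bracket
      refine ⟨fun _ => ext_equiv_balanced (k := k) (a := 2) (b := 1) (spechtRep K lam)
        (spechtRep K mu) .bracket _ (detected_liePad k) (span_liePad k), fun h => by omega,
        fun h => absurd rfl h, h2, ?_⟩
      rw [if_pos rfl]
      have hc : (Fintype.card (Equiv.Perm (Fin k) × Equiv.Perm (Fin 2) × Equiv.Perm (Fin 1)) : K)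
          ≠ 0 := Nat.cast_ne_zero.2 Fintype.card_ne_zero
      exact Nat.cast_injective (mul_left_cancel₀ hc (h3.trans (sum_LR_bracket lam mu).symm))
  by_cases h2 : m = n + 2
  · subst h2
    -- The Casimir element has no inputs, so the padding is all of n, with n + 0 read as n.
    obtain ⟨h3, h4⟩ := finite_and_finrank_ext (k := n) (a := 0) (spechtRep K lam) (spechtRep K mu)
      .casimir
    refine ⟨fun h => absurd h h1, fun _ => ext_equiv_balanced (k := n) (a := 0) (b := 2)
      (spechtRep K lam) (spechtRep K mu) .casimir _ (detected_stdPairing n) (span_stdPairing n),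
      fun _ h => absurd rfl h, h3, ?_⟩
    rw [if_neg h1, if_pos rfl]
    have hc : (Fintype.card (Equiv.Perm (Fin n) × Equiv.Perm (Fin 0) × Equiv.Perm (Fin 2)) : K)
        ≠ 0 := Nat.cast_ne_zero.2 Fintype.card_ne_zero
    exact Nat.cast_injective (mul_left_cancel₀ hc (h4.trans (LR_casimir (k := n) lam mu).symm))
  · have hs : Subsingleton (Ext1 K lam mu) :=
      subsingleton_ext (spechtRep K lam) (spechtRep K mu) fun k a b x h3 h4 => by
        have := x.arity
        omega
    refine ⟨fun h => absurd h h1, fun h => absurd h h2, fun _ _ => ⟨0⟩, inferInstance, ?_⟩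
    rw [if_neg h1, if_neg h2, Module.finrank_zero_of_subsingleton]
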